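/- Let $n\ge 1$, $1<p<\infty$ and $1<q<\infty$. Let $P_t(x)=\dfrac{\Gamma(\frac{n+1}2)}{\pi^{(n+1)/2}}\,\dfrac{t}{(t^2+|x|^2)^{(n+1)/2}}$ $(x\in\mathbb R^n,\ t>0)$ be the Poisson kernel on $\mathbb R^n$, and let $\varphi_t$ denote one of the $n+1$ functions $$\varphi_t(x)=t\,\frac{\partial}{\partial t}P_t(x),\qquad \varphi_t(x)=t\,\frac{\partial}{\partial x_i}P_t(x)\quad(1\le i\le n).$$ Let $\Gamma=\{(z,t)\in\mathbb R^n\times(0,\infty): |z|<t\}$ be equipped with the measure $dz\,dt/t^{n+1}$. For a Banach space $B$ (real or complex) put $A=L^q(\Gamma;B)$, and regard a function $h$ on $\mathbb R^n$ with values in $A$ also as a function $h(x,z,t)=h(x)(z,t)$ of three variables. Let $\mathcal N$ be the set of all compactly supported continuous functions $h:\mathbb R^n\to A$ such that every $h(x)$ is a continuous function $\Gamma\to B$ supported in a compact subset of $\Gamma$ that does not depend on $x$. For $h\in\mathcal N$ define $$\Phi(h)(x,u,s)=\int_\Gamma\int_{\mathbb R^n}(\varphi_s*\varphi_t)(x+u+z-y)\,h(y,z,t)\,dy\,\frac{dz\,dt}{t^{n+1}},\qquad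 x\in\mathbb R^n,\ (u,s)\in\Gamma .$$ An $A$-valued atom is a function $a\in L^\infty(\mathbb R^n;A)$ with $\operatorname{supp}a\subset Q$, $\int a\,dx=0$ and $\|a\|_\infty\le 1/|Q|$ for some cube $Q$ with sides parallel to the axes. $H^1_a(\mathbb R^n;A)$ is the space of all $f=\sum_{k\ge1}\lambda_k a_k$ (convergence in $L^1(\mathbb R^n;A)$) with atoms $a_k$ and scalars $\lambda_k$ such that $\sum_k|\lambda_k|<\infty$, and $\|f\|_{H^1_a}$ is the infimum of $\sum_k|\lambda_k|$ over all such representations. Then there is a constant $c$, depending only on $p$, $q$ and $n$, such that for every Banach space $B$ and each of the $n+1$ choices of $\varphi$ the following holds. The integral defining $\Phi(h)$ converges absolutely for every $h\in\mathcal N$, and there are linear operators $$\Phi_p:L^p(\mathbb R^n;A)\to L^p(\mathbb R^n;A),\qquad \Phi_1:H^1_a(\mathbb R^n;A)\to L^1(\mathbb R^n;A)$$ that extend $\Phi$, that is, $\Phi_p(h)=\Phi(h)$ for all $h\in\mathcal N$ and $\Phi_1(h)=\Phi(h)$ for all $h\in\mathcal N\cap H^1_a(\mathbb R^n;A)$,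 that agree on $L^p(\mathbb R^n;A)\cap H^1_a(\mathbb R^n;A)$, and that satisfy $$\|\Phi_p(f)\|_{L^p(\mathbb R^n;A)}\le c\,\|f\|_{L^p(\mathbb R^n;A)},\qquad \|\Phi_1(f)\|_{L^1(\mathbb R^n;A)}\le c\,\|f\|_{H^1_a(\mathbb R^n;A)}$$ for all $f$ in the respective domains. -/

import Mathlib

open MeasureTheory Set
open scoped ENNReal Convolution

noncomputable section

namespace LusinCone

/-- `n`-dimensional Euclidean space. -/
abbrev E (n : ℕ) := EuclideanSpace ℝ (Fin n)

/-- The Poisson kernel `P_t(x)` (for `t > 0`). -/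
def poissonKernel (n : ℕ) (t : ℝ) (x : E n) : ℝ :=
  Real.Gamma (((n : ℝ) + 1) / 2) / Real.pi ^ (((n : ℝ) + 1) / 2) *
    (t / (t ^ 2 + ‖x‖ ^ 2) ^ (((n : ℝ) + 1) / 2))

/-- `φ_t(x) = t ∂_t P_t(x)`. -/
def phiTime (n : ℕ) (t : ℝ) (x : E n) : ℝ :=
  t * deriv (fun r => poissonKernel n r x) t

/-- `φ_t(x) = t ∂_{x_i} P_t(x)`. -/
def phiSpace (n : ℕ) (i : Fin n) (t : ℝ) (x : E n) : ℝ :=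
  t * lineDeriv ℝ (poissonKernel n t) x (EuclideanSpace.single i 1)

/-- The cone `Γ = {(z, t) : |z| < t}`. -/
def cone (n : ℕ) : Set (E n × ℝ) := {w | ‖w.1‖ < w.2}

/-- The measure `dz dt / t^(n+1)` on the cone, as a measure on `ℝⁿ × ℝ` carried by the cone. -/
def coneMeasure (n : ℕ) : Measure (E n × ℝ) :=
  (volume.restrict (cone n)).withDensity fun w => ENNReal.ofReal (1 / w.2 ^ (n + 1))

/-- The kernel `k_{s,t} = φ_s * φ_t` (convolution on `ℝⁿ`). -/
def kern {n : ℕ} (φ : ℝ → E n → ℝ) (s t : ℝ) (x : E n) : ℝ :=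
  (φ s ⋆[ContinuousLinearMap.mul ℝ ℝ, volume] φ t) x

/-- The Banach space `A = L^q(Γ; B)`. -/
abbrev A (n : ℕ) (q : ℝ≥0∞) (B : Type*) [NormedAddCommGroup B] :=
  Lp B q (coneMeasure n)

/-- The space `L^p(ℝⁿ; A)`. -/
abbrev LpA (n : ℕ) (p q : ℝ≥0∞) [Fact (1 ≤ q)] (B : Type*) [NormedAddCommGroup B] :=
  Lp (A n q B) p (volume : Measure (E n))

section Phi

variable {n : ℕ} {B : Type*} [NormedAddCommGroup B] [NormedSpace ℝ B]

/-- `Φ(g)(x, u, s) = ∫_Γ ∫_{ℝⁿ} φ_s * φ_t (x + u + z - y) g(y, z, t) dy dz dt / t^(n+1)`. -/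
def Phi (φ : ℝ → E n → ℝ) (g : E n → E n × ℝ → B) (x u : E n) (s : ℝ) : B :=
  ∫ w, (∫ y, kern φ s w.2 (x + u + w.1 - y) • g y w) ∂(coneMeasure n)

/-- Absolute convergence of the integral that defines `Φ(g)(x, u, s)`. -/
def PhiConverges (φ : ℝ → E n → ℝ) (g : E n → E n × ℝ → B) (x u : E n) (s : ℝ) : Prop :=
  Integrable (fun v : (E n × ℝ) × E n => kern φ s v.1.2 (x + u + v.1.1 - v.2) • g v.2 v.1)
    ((coneMeasure n).prod volume)

/-- `F : ℝⁿ → A` is, as a function of three variables, almost everywhere equal to `Φ(g)`. -/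
def IsPhi {q : ℝ≥0∞} (φ : ℝ → E n → ℝ) (g : E n → E n × ℝ → B) (F : E n → A n q B) : Prop :=
  ∀ᵐ x, ∀ᵐ w ∂(coneMeasure n), F x w = Phi φ g x w.1 w.2

end Phi

/-- `h : ℝⁿ → A` is continuous with compact support, and `g` is its version as a function of three
variables: for each `x` the function `g x` is continuous on the cone, represents `h x`, and is
supported in a compact subset of the cone that does not depend on `x`. -/
structure IsNice {n : ℕ} {q : ℝ≥0∞} [Fact (1 ≤ q)] {B : Type*} [NormedAddCommGroup B]
    (h : E n → A n q B) (g : E n → E n × ℝ → B) : Prop where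
  continuous : Continuous h
  hasCompactSupport : HasCompactSupport h
  represents : ∀ x, h x =ᵐ[coneMeasure n] g x
  continuousOn : ∀ x, ContinuousOn (g x) (cone n)
  compact_support : ∃ C : Set (E n × ℝ), IsCompact C ∧ C ⊆ cone n ∧ ∀ x, ∀ w ∉ C, g x w = 0

/-- The closed cube with lowest corner `b` and side length `l`, sides parallel to the axes. -/
def cube {n : ℕ} (b : E n) (l : ℝ) : Set (E n) := {x | ∀ i, b i ≤ x i ∧ x i ≤ b i + l}

section Hardy

variable (𝕜 : Type*) [RCLike 𝕜] {n : ℕ}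
  {X : Type*} [NormedAddCommGroup X] [NormedSpace ℝ X] [NormedSpace 𝕜 X]

/-- `X`-valued atoms. -/
def IsAtom (a : Lp X 1 (volume : Measure (E n))) : Prop :=
  ∃ (b : E n) (l : ℝ), 0 < l ∧ (∀ᵐ x, x ∉ cube b l → a x = 0) ∧ (∫ x, a x) = 0 ∧
    ∀ᵐ x, ‖a x‖ ≤ 1 / volume.real (cube b l)

/-- `f = ∑ λ_k a_k` with atoms `a_k` and scalars `λ_k` such that `∑ |λ_k| < ∞`. -/
def IsAtomicDecomposition (f : Lp X 1 (volume : Measure (E n)))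
    (c : ℕ → 𝕜) (a : ℕ → Lp X 1 (volume : Measure (E n))) : Prop :=
  (∀ k, IsAtom (a k)) ∧ (Summable fun k => ‖c k‖) ∧ HasSum (fun k => c k • a k) f

theorem isAtom_zero : IsAtom (0 : Lp X 1 (volume : Measure (E n))) := by
  have h0 := Lp.coeFn_zero X 1 (volume : Measure (E n))
  refine ⟨0, 1, one_pos, ?_, ?_, ?_⟩
  · filter_upwards [h0] with x hx _ using by simp [hx]
  · rw [integral_congr_ae h0]; simp
  · filter_upwards [h0] with x hx
    rw [hx]; simp

/-- The atomic Hardy space `H¹_a(ℝⁿ; X)`, as a subspace of `L¹(ℝⁿ; X)`. -/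
def hardy (n : ℕ) (X : Type*) [NormedAddCommGroup X] [NormedSpace ℝ X] [NormedSpace 𝕜 X] :
    Submodule 𝕜 (Lp X 1 (volume : Measure (E n))) where
  carrier := {f | ∃ c a, IsAtomicDecomposition 𝕜 f c a}
  zero_mem' := ⟨0, 0, fun _ => isAtom_zero, by simp,
    by simp⟩
  add_mem' := by
    rintro f g ⟨c, a, ha, hc, hf⟩ ⟨d, b, hb, hd, hg⟩
    obtain ⟨e⟩ : Nonempty (ℕ ≃ ℕ ⊕ ℕ) := ⟨Equiv.natSumNatEquivNat.symm⟩
    refine ⟨Sum.elim c d ∘ e, Sum.elim a b ∘ e, ?_, ?_, ?_⟩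
    · intro k
      rcases h : e k with j | j
      · simpa [h] using ha j
      · simpa [h] using hb j
    · have h1 : Summable fun k => ‖Sum.elim c d k‖ := Summable.sum _ hc hd
      exact h1.comp_injective e.injective
    · have h1 : HasSum (fun k => Sum.elim c d k • Sum.elim a b k) (f + g) :=
        HasSum.sum (f := fun k => Sum.elim c d k • Sum.elim a b k) hf hg
      exact (Equiv.hasSum_iff e (f := fun k => Sum.elim c d k • Sum.elim a b k)).2 h1
  smul_mem' := by
    rintro r f ⟨c, a, ha, hc, hf⟩
    refine ⟨fun k => r * c k, a, ha, ?_, ?_⟩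
    · simpa only [norm_mul] using hc.mul_left ‖r‖
    · simpa only [mul_smul] using hf.const_smul r

/-- The norm of `H¹_a(ℝⁿ; X)`: the infimum of `∑ |λ_k|` over all atomic decompositions. -/
def hardyNorm (f : Lp X 1 (volume : Measure (E n))) : ℝ :=
  sInf {r | ∃ c a, IsAtomicDecomposition 𝕜 f c a ∧ r = ∑' k, ‖c k‖}

end Hardy

end LusinCone

end

open LusinCone

/-!
The operator `Φ` is bounded because, after absolute values are taken, it is already dominated by a
positive operator that is bounded on `L^p(ℝⁿ; L^q)`. No singular integral theory is used, and no
property of `B` beyond completeness.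

*Kernel bounds.* Each `φ_t` has mean zero, is at most a multiple of `t / (t + |x|)^(n+1)`, and
satisfies the matching Lipschitz bound (`exists_isPoissonType`). The cancellation of the factor of
smaller scale, against the smoothness of the other one, gives
`|φ_s * φ_t (x)| ≤ K (st)^(1/4) / (s + t + |x|)^(n+1/2)` (`exists_abs_kern_le`), and interpolating
between this and a Lipschitz bound gives, for `D ≤ |x|, |x'|`,
`|φ_s * φ_t (x) - φ_s * φ_t (x')| ≤ K |x - x'|^(1/2) (st)^(1/8) / (s + t + D)^(n+3/4)`
(`exists_abs_kern_sub_le`). On the cone, `|u| < s` and `|z| < t`, so `x + u + z - y` may be replaced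
by `x - y` in the first bound.

*Boundedness on `L^p`.* The resulting symmetric positive kernel `coneKernel`, integrated over the
cone variable against a function of `y` alone, produces an average over an approximate identity of
scale `s`, hence at most a multiple of the Hardy–Littlewood maximal function at `x`
(`isMaximalKernel_coneKernel`). That suffices for all `1 < p, q < ∞`
(`IsMaximalKernel.exists_mixedNorm_le`): for `q ≤ p`, Hölder's inequality reduces the claim to
`L^(p/q)(L^1)`, where one dualizes against the maximal function; the case `p ≤ q` follows since the
operator is self-adjoint.

*Atoms.* Near the cube supporting an atom, Hölder's inequality and the bound on `L^q(L^q)` apply.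
Away from it, the mean of the atom being zero, the kernel may be replaced by its difference from its
value at a corner of the cube; the Hölder bound and Schur's test on the cone leave a majorant that
is integrable in `x` (`exists_mixedNorm_op_atom_le`).

*From functions of two variables to vector-valued functions.* Elements of `L^p(ℝⁿ; L^q(Γ; B))` have
jointly measurable representatives, and a jointly measurable function of finite mixed norm defines
such an element (`exists_stronglyMeasurable_rep`, `exists_LpLp_of_mixedNorm_ne_top`). The operator is
treated as the relation `IsOp` between vector-valued functions, which is independent of `p` and
single-valued. It is closed under `L¹` convergence (`IsOp.of_tendsto`), so that the bound for atoms
passes to their infinite combinations; and since both extensions realise the same relation, they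
agree on `L^p ∩ H¹` and are linear.
-/

noncomputable section

namespace LusinCone

/-! ### Power-type majorants -/

/-- The majorant `s^a / (s + d)^(n + a)` of Poisson type: as a function of `d = ‖x‖` on `ℝⁿ` it is
an `L¹`-normalised dilation of `(1 + ‖x‖)^(-(n + a))`. -/
def pk (n : ℕ) (a s d : ℝ) : ℝ := s ^ a / (s + d) ^ ((n : ℝ) + a)

/-- The two-scale majorant `(s t)^a / (s + t + d)^(n + b)`. -/
def sk (n : ℕ) (a b s t d : ℝ) : ℝ := (s * t) ^ a / (s + t + d) ^ ((n : ℝ) + b)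

/-- The integral of `pk n a s ‖x‖` over `ℝⁿ`, which does not depend on `s`. -/
def pkMass (n : ℕ) (a : ℝ) : ℝ := ∫ x : E n, pk n a 1 ‖x‖

theorem pk_nonneg {n : ℕ} {a s d : ℝ} (hs : 0 < s) (hd : 0 ≤ d) : 0 ≤ pk n a s d := by
  unfold pk; positivity

theorem pk_anti {n : ℕ} {a s d d' : ℝ} (ha : 0 ≤ a) (hs : 0 < s) (hd : 0 ≤ d) (h : d ≤ d') :
    pk n a s d' ≤ pk n a s d := by
  unfold pk; gcongr

theorem sk_nonneg {n : ℕ} {a b s t d : ℝ} (hs : 0 < s) (ht : 0 < t) (hd : 0 ≤ d) :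
    0 ≤ sk n a b s t d := by
  unfold sk; positivity

theorem pk_one {n : ℕ} {s d : ℝ} : pk n 1 s d = s / (s + d) ^ (n + 1) := by
  unfold pk
  rw [Real.rpow_one, ← Real.rpow_natCast]; push_cast; rfl

theorem pk_scale {n : ℕ} {a s d : ℝ} (hs : 0 < s) (hd : 0 ≤ d) :
    pk n a s d = (s ^ n)⁻¹ * pk n a 1 (s⁻¹ * d) := by
  unfold pk
  have h1 : s + d = s * (1 + s⁻¹ * d) := by field_simp
  rw [h1, Real.mul_rpow hs.le (by positivity), Real.rpow_add hs, Real.rpow_natCast, Real.one_rpow]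
  field_simp

theorem continuous_pk_norm {n : ℕ} {a s : ℝ} (ha : 0 ≤ a) (hs : 0 < s) :
    Continuous fun x : E n => pk n a s ‖x‖ := by
  unfold pk
  refine continuous_const.div ?_ fun x => by positivity
  exact (continuous_const.add continuous_norm).rpow_const fun x => Or.inr (by positivity)

theorem integrable_pk {n : ℕ} {a s : ℝ} (ha : 0 < a) (hs : 0 < s) :
    Integrable (fun x : E n => pk n a s ‖x‖) := by
  have h1 : Integrable (fun x : E n => pk n a 1 ‖x‖) := by
    have := integrable_one_add_norm (E := E n) (μ := volume) (r := n + a) (by simp [ha])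
    refine this.congr (Filter.Eventually.of_forall fun x => ?_)
    simp only [pk, Real.one_rpow, one_div]
    rw [Real.rpow_neg (by positivity)]
  have h2 := (h1.comp_smul (R := s⁻¹) (by positivity)).const_mul (s ^ n)⁻¹
  refine h2.congr (Filter.Eventually.of_forall fun x => ?_)
  simp only [norm_smul, norm_inv, Real.norm_eq_abs, abs_of_pos hs]
  exact (pk_scale hs (norm_nonneg x)).symm

theorem integral_pk {n : ℕ} {a s : ℝ} (hs : 0 < s) :
    ∫ x : E n, pk n a s ‖x‖ = pkMass n a := by
  have h2 := Measure.integral_comp_smul (volume : Measure (E n)) (fun x => pk n a 1 ‖x‖) s⁻¹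
  have h3 : ∀ x : E n, pk n a s ‖x‖ = (s ^ n)⁻¹ * pk n a 1 ‖s⁻¹ • x‖ := fun x => by
    simp only [norm_smul, norm_inv, Real.norm_eq_abs, abs_of_pos hs]
    exact pk_scale hs (norm_nonneg x)
  simp_rw [h3]
  rw [integral_const_mul, h2, pkMass]
  simp [abs_of_pos hs]
  field_simp

theorem pkMass_nonneg (n : ℕ) (a : ℝ) : 0 ≤ pkMass n a :=
  integral_nonneg fun x => pk_nonneg one_pos (norm_nonneg x)

theorem integrable_pk_sub {n : ℕ} {a s : ℝ} (ha : 0 < a) (hs : 0 < s) (x : E n) :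
    Integrable (fun y : E n => pk n a s ‖x - y‖) :=
  (integrable_pk ha hs).comp_sub_left x

theorem integral_pk_sub {n : ℕ} {a s : ℝ} (hs : 0 < s) (x : E n) :
    ∫ y : E n, pk n a s ‖x - y‖ = pkMass n a := by
  rw [integral_sub_left_eq_self (fun y => pk n a s ‖y‖)]
  exact integral_pk hs

/-- Comparing arguments within a factor `2`. -/
theorem pk_le_of_le_two_mul {n : ℕ} {a s s' d d' : ℝ} (ha : 0 ≤ a) (hs : 0 < s)
    (hs' : 0 < s') (hd : 0 ≤ d) (hd' : 0 ≤ d') (hss : s ≤ s') (h : s' + d' ≤ 2 * (s + d)) :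
    pk n a s d ≤ 2 ^ ((n : ℝ) + a) * pk n a s' d' := by
  unfold pk
  rw [mul_div_assoc', div_le_div_iff₀ (by positivity) (by positivity)]
  calc s ^ a * (s' + d') ^ ((n : ℝ) + a)
      ≤ s' ^ a * (2 * (s + d)) ^ ((n : ℝ) + a) := by gcongr
    _ = _ := by rw [Real.mul_rpow (by positivity) (by positivity)]; ring

/-- The pointwise bound behind `pk n a s * pk n 1 t ≲ pk n a t` (convolution) for `s ≤ t`: either
`y` or `x - y` is as large as `x`. -/
theorem pk_mul_pk_le {n : ℕ} {a s t : ℝ} (ha : 0 < a) (ha1 : a ≤ 1) (hs : 0 < s) (hst : s ≤ t)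
    (x y : E n) :
    pk n a s ‖y‖ * pk n 1 t ‖x - y‖ ≤
      2 ^ (n + 1) * pk n a t ‖x‖ * (pk n a s ‖y‖ + pk n 1 t ‖x - y‖) := by
  have ht : 0 < t := hs.trans_le hst
  have tri : ‖x‖ ≤ ‖x - y‖ + ‖y‖ := by simpa using norm_add_le (x - y) y
  have hxn := norm_nonneg x
  have hyn := norm_nonneg y
  have hxy := norm_nonneg (x - y)
  have p1 : 0 ≤ pk n a s ‖y‖ := pk_nonneg hs hyn
  have p2 : 0 ≤ pk n 1 t ‖x - y‖ := pk_nonneg ht hxy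
  have p3 : 0 ≤ pk n a t ‖x‖ := pk_nonneg ht hxn
  have e2 : (2 : ℝ) ^ ((n : ℝ) + 1) = 2 ^ (n + 1) := by
    rw [← Real.rpow_natCast]; push_cast; rfl
  rcases le_total (t + ‖x‖) (2 * (t + ‖x - y‖)) with h | h
  · have h1 : pk n 1 t ‖x - y‖ ≤ 2 ^ (n + 1) * pk n a t ‖x‖ := by
      refine (pk_le_of_le_two_mul zero_le_one ht ht hxy hxn le_rfl h).trans ?_
      rw [e2]; gcongr
      unfold pk
      have : t ≤ t + ‖x‖ := by linarith
      rw [div_le_div_iff₀ (by positivity) (by positivity)]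
      have e3 : (t + ‖x‖) ^ ((n : ℝ) + 1) = (t + ‖x‖) ^ ((n : ℝ) + a) * (t + ‖x‖) ^ (1 - a) := by
        rw [← Real.rpow_add (by positivity)]; ring_nf
      have e4 : t ^ (1 : ℝ) = t ^ a * t ^ (1 - a) := by
        rw [← Real.rpow_add ht]; ring_nf
      have e5 : t ^ (1 - a) ≤ (t + ‖x‖) ^ (1 - a) := by
        apply Real.rpow_le_rpow ht.le this; linarith
      rw [e3, e4]
      have := mul_le_mul_of_nonneg_left e5
        (show 0 ≤ t ^ a * (t + ‖x‖) ^ ((n : ℝ) + a) by positivity)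
      linarith
    calc _ ≤ pk n a s ‖y‖ * (2 ^ (n + 1) * pk n a t ‖x‖) := by gcongr
      _ = 2 ^ (n + 1) * pk n a t ‖x‖ * pk n a s ‖y‖ := by ring
      _ ≤ _ := by gcongr; linarith
  · have h0 : t + ‖x‖ ≤ 2 * (s + ‖y‖) := by linarith
    have h1 : pk n a s ‖y‖ ≤ 2 ^ (n + 1) * pk n a t ‖x‖ := by
      refine (pk_le_of_le_two_mul ha.le hs ht hyn hxn hst h0).trans ?_
      gcongr
      rw [← e2]
      apply Real.rpow_le_rpow_of_exponent_le <;> linarith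
    calc _ ≤ (2 ^ (n + 1) * pk n a t ‖x‖) * pk n 1 t ‖x - y‖ := by gcongr
      _ ≤ _ := by gcongr; linarith

theorem pk_one_le (n : ℕ) {t d : ℝ} (ht : 0 < t) (hd : 0 ≤ d) : pk n 1 t d ≤ (t ^ n)⁻¹ := by
  rw [pk_one, div_le_iff₀ (by positivity)]
  have : t ^ (n + 1) ≤ (t + d) ^ (n + 1) := by gcongr; linarith
  calc t = (t ^ n)⁻¹ * t ^ (n + 1) := by field_simp; ring
    _ ≤ _ := by gcongr

theorem integrable_pk_mul_pk {n : ℕ} {a s t : ℝ} (ha : 0 < a) (hs : 0 < s) (ht : 0 < t)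
    (x : E n) : Integrable fun y : E n => pk n a s ‖y‖ * pk n 1 t ‖x - y‖ := by
  refine (integrable_pk ha hs).mul_bdd (c := (t ^ n)⁻¹) ?_ ?_
  · exact ((continuous_pk_norm zero_le_one ht).comp
      (continuous_const.sub continuous_id)).aestronglyMeasurable
  · refine Filter.Eventually.of_forall fun y => ?_
    rw [Real.norm_of_nonneg (pk_nonneg ht (norm_nonneg _))]
    exact pk_one_le n ht (norm_nonneg _)

theorem integral_pk_mul_pk_le {n : ℕ} {a s t : ℝ} (ha : 0 < a) (ha1 : a ≤ 1) (hs : 0 < s)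
    (hst : s ≤ t) (x : E n) : ∫ y : E n, pk n a s ‖y‖ * pk n 1 t ‖x - y‖ ≤
      2 ^ (n + 1) * (pkMass n a + pkMass n 1) * pk n a t ‖x‖ := by
  have ht : 0 < t := hs.trans_le hst
  refine (integral_mono (integrable_pk_mul_pk ha hs ht x)
    (((integrable_pk ha hs).add (integrable_pk_sub one_pos ht x)).const_mul
      (2 ^ (n + 1) * pk n a t ‖x‖)) (pk_mul_pk_le ha ha1 hs hst x)).trans (le_of_eq ?_)
  simp only [Pi.add_apply]
  rw [integral_const_mul, integral_add (integrable_pk ha hs)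
    (integrable_pk_sub one_pos ht x), integral_pk hs, integral_pk_sub ht]
  ring

/-! ### Poisson-type families of kernels -/

/-- What the proof uses of `φ`: joint continuity, the size and Lipschitz bounds of the Poisson
kernel, and the cancellation `∫ φ_t = 0`. -/
structure IsPoissonType {n : ℕ} (φ : ℝ → E n → ℝ) (C : ℝ) : Prop where
  nonneg : 0 ≤ C
  continuousOn : ContinuousOn (fun v : ℝ × E n => φ v.1 v.2) (Ioi 0 ×ˢ univ)
  bound : ∀ t, 0 < t → ∀ x, |φ t x| ≤ C * pk n 1 t ‖x‖
  lipschitz : ∀ t, 0 < t → ∀ x x', |φ t x - φ t x'| ≤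
    C * (‖x - x'‖ / t) * (pk n 1 t ‖x‖ + pk n 1 t ‖x'‖)
  integral_eq_zero : ∀ t, 0 < t → ∫ x, φ t x = 0

namespace IsPoissonType

variable {n : ℕ} {φ : ℝ → E n → ℝ} {C : ℝ}

theorem mono (h : IsPoissonType φ C) {C' : ℝ} (hC : C ≤ C') : IsPoissonType φ C' where
  nonneg := h.nonneg.trans hC
  continuousOn := h.continuousOn
  bound t ht x := (h.bound t ht x).trans <|
    mul_le_mul_of_nonneg_right hC (pk_nonneg ht (norm_nonneg x))
  lipschitz t ht x x' := (h.lipschitz t ht x x').trans <| by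
    have := pk_nonneg (n := n) (a := 1) ht (norm_nonneg x)
    have := pk_nonneg (n := n) (a := 1) ht (norm_nonneg x')
    gcongr
  integral_eq_zero := h.integral_eq_zero

theorem continuous (h : IsPoissonType φ C) {t : ℝ} (ht : 0 < t) : Continuous (φ t) := by
  have h1 : Continuous fun x : E n => (t, x) := by fun_prop
  exact h.continuousOn.comp_continuous h1 fun x => ⟨ht, mem_univ _⟩

theorem integrable (h : IsPoissonType φ C) {t : ℝ} (ht : 0 < t) : Integrable (φ t) :=
  ((integrable_pk one_pos ht).const_mul C).mono' (h.continuous ht).aestronglyMeasurable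
    (Filter.Eventually.of_forall (h.bound t ht))

theorem kern_eq (φ : ℝ → E n → ℝ) (s t : ℝ) (x : E n) :
    kern φ s t x = ∫ y, φ s y * φ t (x - y) := by
  simp [kern, convolution]

theorem kern_symm (φ : ℝ → E n → ℝ) (s t : ℝ) (x : E n) : kern φ s t x = kern φ t s x := by
  rw [kern_eq, kern_eq, ← integral_sub_left_eq_self _ _ x]
  simp [mul_comm]

/-- The integrand of `φ_s * φ_t` is integrable. -/
theorem integrable_mul (h : IsPoissonType φ C) {s t : ℝ} (hs : 0 < s) (ht : 0 < t) (x : E n) :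
    Integrable fun y => φ s y * φ t (x - y) := by
  refine (h.integrable hs).mul_bdd (c := C * (t ^ n)⁻¹) ?_ ?_
  · exact ((h.continuous ht).comp (continuous_const.sub continuous_id)).aestronglyMeasurable
  · refine Filter.Eventually.of_forall fun y => (h.bound t ht _).trans ?_
    have := h.nonneg
    gcongr
    exact pk_one_le n ht (norm_nonneg _)

/-- Geometric mean of two upper bounds: `min 1 r ≤ √r`. -/
theorem min_le_sqrt {A r X : ℝ} (hr : 0 ≤ r) (hX : 0 ≤ X) (h1 : A ≤ X) (h2 : A ≤ r * X) :
    A ≤ r ^ (1 / 2 : ℝ) * X := by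
  rcases le_total r 1 with h | h
  · refine h2.trans (mul_le_mul_of_nonneg_right ?_ hX)
    simpa using Real.rpow_le_rpow_of_exponent_ge' hr h (by norm_num) (show (1 / 2 : ℝ) ≤ 1 by norm_num)
  · refine h1.trans (le_mul_of_one_le_left hX (Real.one_le_rpow h (by norm_num)))

end IsPoissonType

namespace IsPoissonType

variable {n : ℕ} {φ : ℝ → E n → ℝ} {C : ℝ}

theorem rpow_le_mul_rpow {s t : ℝ} (hs : 0 < s) (hst : s ≤ t) (a : ℝ) (ha : 0 ≤ a) :
    s ^ (2 * a) ≤ (s * t) ^ a := by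
  have ht : 0 < t := hs.trans_le hst
  rw [two_mul, Real.rpow_add hs, Real.mul_rpow hs.le ht.le]
  gcongr

/-- `φ_s * φ_t` gains a power of `s / t`: the cancellation of the kernel at the smaller scale is
played against the Lipschitz bound of the other one. -/
theorem abs_kern_le_of_le (h : IsPoissonType φ C) {s t : ℝ} (hs : 0 < s) (hst : s ≤ t) (x : E n) :
    |kern φ s t x| ≤ C ^ 2 * (2 ^ (n + 1) * (pkMass n (1 / 2) + pkMass n 1) + pkMass n (1 / 2)) *
      (s ^ (1 / 2 : ℝ) / (t + ‖x‖) ^ ((n : ℝ) + 1 / 2)) := by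
  have ht : 0 < t := hs.trans_le hst
  have hC := h.nonneg
  have e1 : kern φ s t x = ∫ y, φ s y * (φ t (x - y) - φ t x) := by
    simp_rw [mul_sub]
    rw [integral_sub (h.integrable_mul hs ht x) ((h.integrable hs).mul_const _), integral_mul_const,
      h.integral_eq_zero s hs, kern_eq]
    simp
  set D : ℝ := C ^ 2 * (s ^ (1 / 2 : ℝ) * (t ^ (1 / 2 : ℝ))⁻¹) with hD
  have hD0 : 0 ≤ D := by positivity
  have hp : pk n 1 t ‖x‖ ≤ pk n (1 / 2) t ‖x‖ := by
    unfold pk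
    have hx := norm_nonneg x
    rw [div_le_div_iff₀ (by positivity) (by positivity)]
    have e3 : (t + ‖x‖) ^ ((n : ℝ) + 1) =
        (t + ‖x‖) ^ ((n : ℝ) + 1 / 2) * (t + ‖x‖) ^ (1 / 2 : ℝ) := by
      rw [← Real.rpow_add (by positivity)]; ring_nf
    have e4 : t ^ (1 : ℝ) = t ^ (1 / 2 : ℝ) * t ^ (1 / 2 : ℝ) := by
      rw [← Real.rpow_add ht]; ring_nf
    rw [e3, e4]
    have : t ^ (1 / 2 : ℝ) ≤ (t + ‖x‖) ^ (1 / 2 : ℝ) := by gcongr; linarith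
    have := mul_le_mul_of_nonneg_left this
      (show 0 ≤ t ^ (1 / 2 : ℝ) * (t + ‖x‖) ^ ((n : ℝ) + 1 / 2) by positivity)
    linarith
  have key : ∀ y, ‖φ s y * (φ t (x - y) - φ t x)‖ ≤
      D * (pk n (1 / 2) s ‖y‖ * pk n 1 t ‖x - y‖ + pk n (1 / 2) s ‖y‖ * pk n 1 t ‖x‖) := by
    intro y
    have hy := norm_nonneg y
    have p1 := pk_nonneg (n := n) (a := 1) ht (norm_nonneg (x - y))
    have p2 := pk_nonneg (n := n) (a := 1) ht (norm_nonneg x)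
    have p3 := pk_nonneg (n := n) (a := 1) hs hy
    have b1 : |φ t (x - y) - φ t x| ≤
        (‖y‖ / t) ^ (1 / 2 : ℝ) * (C * (pk n 1 t ‖x - y‖ + pk n 1 t ‖x‖)) := by
      refine min_le_sqrt (by positivity) (by positivity) ?_ ?_
      · refine (abs_sub _ _).trans ?_
        have := h.bound t ht (x - y)
        have := h.bound t ht x
        linarith
      · refine (h.lipschitz t ht (x - y) x).trans (le_of_eq ?_)
        rw [sub_sub_cancel_left, norm_neg]; ring
    have b2 : pk n 1 s ‖y‖ * ‖y‖ ^ (1 / 2 : ℝ) ≤ s ^ (1 / 2 : ℝ) * pk n (1 / 2) s ‖y‖ := by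
      unfold pk
      rw [div_mul_eq_mul_div, mul_div_assoc', div_le_div_iff₀ (by positivity) (by positivity)]
      have e3 : (s + ‖y‖) ^ ((n : ℝ) + 1) =
          (s + ‖y‖) ^ ((n : ℝ) + 1 / 2) * (s + ‖y‖) ^ (1 / 2 : ℝ) := by
        rw [← Real.rpow_add (by positivity)]; ring_nf
      have e4 : s ^ (1 : ℝ) = s ^ (1 / 2 : ℝ) * s ^ (1 / 2 : ℝ) := by
        rw [← Real.rpow_add hs]; ring_nf
      have e5 : ‖y‖ ^ (1 / 2 : ℝ) ≤ (s + ‖y‖) ^ (1 / 2 : ℝ) := by gcongr; linarith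
      rw [e3, e4]
      have := mul_le_mul_of_nonneg_left e5
        (show 0 ≤ s ^ (1 / 2 : ℝ) * s ^ (1 / 2 : ℝ) * (s + ‖y‖) ^ ((n : ℝ) + 1 / 2) by positivity)
      linarith
    rw [norm_mul, Real.norm_eq_abs, Real.norm_eq_abs]
    calc |φ s y| * |φ t (x - y) - φ t x|
        ≤ (C * pk n 1 s ‖y‖) *
          ((‖y‖ / t) ^ (1 / 2 : ℝ) * (C * (pk n 1 t ‖x - y‖ + pk n 1 t ‖x‖))) := by
            gcongr
            exact h.bound s hs y
      _ = C ^ 2 * (t ^ (1 / 2 : ℝ))⁻¹ * (pk n 1 t ‖x - y‖ + pk n 1 t ‖x‖) *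
          (pk n 1 s ‖y‖ * ‖y‖ ^ (1 / 2 : ℝ)) := by
            rw [Real.div_rpow hy ht.le]; ring
      _ ≤ C ^ 2 * (t ^ (1 / 2 : ℝ))⁻¹ * (pk n 1 t ‖x - y‖ + pk n 1 t ‖x‖) *
          (s ^ (1 / 2 : ℝ) * pk n (1 / 2) s ‖y‖) := by gcongr
      _ = _ := by rw [hD]; ring
  have i1 := integrable_pk_mul_pk (n := n) (a := 1 / 2) (by norm_num) hs ht x
  have i2 := (integrable_pk (n := n) (a := 1 / 2) (by norm_num) hs).mul_const (pk n 1 t ‖x‖)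
  have h2 := norm_integral_le_of_norm_le ((i1.add i2).const_mul D) (Filter.Eventually.of_forall key)
  rw [← e1, Real.norm_eq_abs] at h2
  refine h2.trans ?_
  have h3 := integral_pk_mul_pk_le (n := n) (a := 1 / 2) (by norm_num) (by norm_num) hs hst x
  simp only [Pi.add_apply]
  rw [integral_const_mul, integral_add i1 i2, integral_mul_const, integral_pk hs]
  have m1 := pkMass_nonneg n (1 / 2)
  calc _ ≤ D * (2 ^ (n + 1) * (pkMass n (1 / 2) + pkMass n 1) * pk n (1 / 2) t ‖x‖ +
        pkMass n (1 / 2) * pk n (1 / 2) t ‖x‖) := by gcongr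
    _ = C ^ 2 * (2 ^ (n + 1) * (pkMass n (1 / 2) + pkMass n 1) + pkMass n (1 / 2)) *
        ((s ^ (1 / 2 : ℝ) * (t ^ (1 / 2 : ℝ))⁻¹) * pk n (1 / 2) t ‖x‖) := by rw [hD]; ring
    _ = _ := by
      unfold pk
      congr 1
      field_simp

/-- Size of `φ_s * φ_t`. -/
theorem exists_abs_kern_le (n : ℕ) (C : ℝ) : ∃ K, 0 ≤ K ∧ ∀ φ : ℝ → E n → ℝ, IsPoissonType φ C →
    ∀ s t, 0 < s → 0 < t → ∀ x, |kern φ s t x| ≤ K * sk n (1 / 4) (1 / 2) s t ‖x‖ := by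
  have m1 := pkMass_nonneg n (1 / 2)
  have m2 := pkMass_nonneg n 1
  set K₀ := C ^ 2 * (2 ^ (n + 1) * (pkMass n (1 / 2) + pkMass n 1) + pkMass n (1 / 2)) with hK
  have hK0 : 0 ≤ K₀ := by positivity
  refine ⟨K₀ * 2 ^ ((n : ℝ) + 1 / 2), by positivity, fun φ h => ?_⟩
  have h0 : ∀ s t, 0 < s → s ≤ t → ∀ x, |kern φ s t x| ≤
      K₀ * (s ^ (1 / 2 : ℝ) / (t + ‖x‖) ^ ((n : ℝ) + 1 / 2)) :=
    fun s t hs hst x => h.abs_kern_le_of_le hs hst x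
  clear_value K₀
  have main : ∀ s t, 0 < s → s ≤ t → ∀ x,
      |kern φ s t x| ≤ K₀ * 2 ^ ((n : ℝ) + 1 / 2) * sk n (1 / 4) (1 / 2) s t ‖x‖ := by
    intro s t hs hst x
    have ht : 0 < t := hs.trans_le hst
    have hx := norm_nonneg x
    refine (h0 s t hs hst x).trans ?_
    rw [mul_assoc]
    refine mul_le_mul_of_nonneg_left ?_ hK0
    unfold sk
    rw [mul_div_assoc', div_le_div_iff₀ (by positivity) (by positivity)]
    have e1 := rpow_le_mul_rpow hs hst (1 / 4) (by norm_num)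
    have e2 : (s + t + ‖x‖) ^ ((n : ℝ) + 1 / 2) ≤ (2 * (t + ‖x‖)) ^ ((n : ℝ) + 1 / 2) := by
      gcongr; linarith
    rw [Real.mul_rpow (by norm_num) (by positivity)] at e2
    norm_num at e1
    calc _ ≤ (s * t) ^ (1 / 4 : ℝ) * (2 ^ ((n : ℝ) + 1 / 2) * (t + ‖x‖) ^ ((n : ℝ) + 1 / 2)) := by
          gcongr
      _ = _ := by ring
  intro s t hs ht x
  rcases le_total s t with hst | hst
  · exact main s t hs hst x
  · rw [kern_symm]
    refine (main t s ht hst x).trans (le_of_eq ?_)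
    unfold sk
    rw [mul_comm t s, add_comm t s]

/-- Lipschitz bound for `φ_s * φ_t`, `s ≤ t`, at points of norm at least `D`: the smoothness falls on
the factor `φ_t` of larger scale, the other factor being integrable. -/
theorem abs_kern_sub_le_of_le (h : IsPoissonType φ C) {s t : ℝ} (hs : 0 < s) (hst : s ≤ t)
    {x x' : E n} {D : ℝ} (hD : 0 ≤ D) (hx : D ≤ ‖x‖) (hx' : D ≤ ‖x'‖) :
    |kern φ s t x - kern φ s t x'| ≤
      C ^ 2 * (2 ^ (n + 1) * (pkMass n 1 + pkMass n 1) * 2) *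
      (‖x - x'‖ / (t + D) ^ (n + 1)) := by
  have ht : 0 < t := hs.trans_le hst
  have hC := h.nonneg
  have e1 : kern φ s t x - kern φ s t x' = ∫ y, φ s y * (φ t (x - y) - φ t (x' - y)) := by
    simp_rw [mul_sub]
    rw [integral_sub (h.integrable_mul hs ht x) (h.integrable_mul hs ht x'), kern_eq, kern_eq]
  set L : ℝ := C ^ 2 * (‖x - x'‖ / t) with hL
  have hL0 : 0 ≤ L := by positivity
  have i1 := integrable_pk_mul_pk (n := n) (a := 1) (by norm_num) hs ht x
  have i2 := integrable_pk_mul_pk (n := n) (a := 1) (by norm_num) hs ht x'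
  have key : ∀ y, ‖φ s y * (φ t (x - y) - φ t (x' - y))‖ ≤
      L * (pk n 1 s ‖y‖ * pk n 1 t ‖x - y‖ + pk n 1 s ‖y‖ * pk n 1 t ‖x' - y‖) := by
    intro y
    have p3 := pk_nonneg (n := n) (a := 1) hs (norm_nonneg y)
    have b1 := h.lipschitz t ht (x - y) (x' - y)
    rw [sub_sub_sub_cancel_right] at b1
    rw [norm_mul, Real.norm_eq_abs, Real.norm_eq_abs]
    calc _ ≤ (C * pk n 1 s ‖y‖) *
          (C * (‖x - x'‖ / t) * (pk n 1 t ‖x - y‖ + pk n 1 t ‖x' - y‖)) := by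
            gcongr
            exact h.bound s hs y
      _ = _ := by rw [hL]; ring
  have h2 := norm_integral_le_of_norm_le ((i1.add i2).const_mul L) (Filter.Eventually.of_forall key)
  rw [← e1, Real.norm_eq_abs] at h2
  refine h2.trans ?_
  have h3 := integral_pk_mul_pk_le (n := n) (a := 1) (by norm_num) (by norm_num) hs hst x
  have h4 := integral_pk_mul_pk_le (n := n) (a := 1) (by norm_num) (by norm_num) hs hst x'
  have m1 := pkMass_nonneg n 1
  have a1 := pk_anti (n := n) (a := 1) zero_le_one ht hD hx
  have a2 := pk_anti (n := n) (a := 1) zero_le_one ht hD hx'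
  simp only [Pi.add_apply]
  rw [integral_const_mul, integral_add i1 i2]
  calc _ ≤ L * (2 ^ (n + 1) * (pkMass n 1 + pkMass n 1) * pk n 1 t D +
        2 ^ (n + 1) * (pkMass n 1 + pkMass n 1) * pk n 1 t D) := by
          gcongr
          · exact h3.trans (by gcongr)
          · exact h4.trans (by gcongr)
    _ = _ := by
      rw [hL, pk_one]
      field_simp
      ring

/-- Hölder continuity of `φ_s * φ_t`, by interpolating between its size and its Lipschitz bound. -/
theorem exists_abs_kern_sub_le (n : ℕ) (C : ℝ) : ∃ K, 0 ≤ K ∧ ∀ φ : ℝ → E n → ℝ,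
    IsPoissonType φ C → ∀ s t, 0 < s → 0 < t → ∀ (x x' : E n) (D : ℝ), 0 ≤ D → D ≤ ‖x‖ → D ≤ ‖x'‖ →
      |kern φ s t x - kern φ s t x'| ≤
        K * (‖x - x'‖ ^ (1 / 2 : ℝ) * sk n (1 / 8) (3 / 4) s t D) := by
  have m2 := pkMass_nonneg n 1
  obtain ⟨K₁, hK₁, h₁⟩ := exists_abs_kern_le n C
  set K₂ := C ^ 2 * (2 ^ (n + 1) * (pkMass n 1 + pkMass n 1) * 2) * 2 ^ (n + 1) with hK₂d
  have hK₂ : 0 ≤ K₂ := by positivity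
  refine ⟨(K₂ * (2 * K₁)) ^ (1 / 2 : ℝ), by positivity, fun φ h => ?_⟩
  have main : ∀ s t, 0 < s → s ≤ t → ∀ (x x' : E n) (D : ℝ), 0 ≤ D → D ≤ ‖x‖ → D ≤ ‖x'‖ →
      |kern φ s t x - kern φ s t x'| ≤ K₂ * (‖x - x'‖ / (s + t + D) ^ (n + 1)) := by
    intro s t hs hst x x' D hD hx hx'
    have ht : 0 < t := hs.trans_le hst
    refine (h.abs_kern_sub_le_of_le hs hst hD hx hx').trans ?_
    rw [hK₂d, mul_assoc _ (2 ^ (n + 1) : ℝ)]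
    gcongr
    rw [mul_div_assoc', div_le_div_iff₀ (by positivity) (by positivity)]
    calc ‖x - x'‖ * (s + t + D) ^ (n + 1) ≤ ‖x - x'‖ * (2 * (t + D)) ^ (n + 1) := by
          gcongr; linarith
      _ = _ := by rw [mul_pow]; ring
  intro s t hs ht x x' D hD hx hx'
  have b1 : |kern φ s t x - kern φ s t x'| ≤ K₂ * (‖x - x'‖ / (s + t + D) ^ (n + 1)) := by
    rcases le_total s t with hst | hst
    · exact main s t hs hst x x' D hD hx hx'
    · rw [kern_symm φ s, kern_symm φ s, add_comm s t]
      exact main t s ht hst x x' D hD hx hx'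
  have b2 : |kern φ s t x - kern φ s t x'| ≤ 2 * K₁ * sk n (1 / 4) (1 / 2) s t D := by
    have anti : ∀ z : E n, D ≤ ‖z‖ →
        sk n (1 / 4) (1 / 2) s t ‖z‖ ≤ sk n (1 / 4) (1 / 2) s t D := by
      intro z hz; unfold sk; gcongr
    refine (abs_sub _ _).trans ?_
    have c1 := (h₁ φ h s t hs ht x).trans (mul_le_mul_of_nonneg_left (anti x hx) hK₁)
    have c2 := (h₁ φ h s t hs ht x').trans (mul_le_mul_of_nonneg_left (anti x' hx') hK₁)
    linarith
  have hsk := sk_nonneg (n := n) (a := 1 / 4) (b := 1 / 2) hs ht hD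
  set A := |kern φ s t x - kern φ s t x'|
  have hA : 0 ≤ A := abs_nonneg _
  have e1 : A = (A * A) ^ (1 / 2 : ℝ) := by
    rw [← Real.sqrt_eq_rpow, Real.sqrt_mul_self hA]
  have gen : ∀ a b c e : ℝ, 0 ≤ a → 0 ≤ b → 0 ≤ c → 0 ≤ e → (a * (b * (c * e⁻¹))) ^ (1 / 2 : ℝ) =
      a ^ (1 / 2 : ℝ) * (b ^ (1 / 2 : ℝ) * (c ^ (1 / 2 : ℝ) / e ^ (1 / 2 : ℝ))) := by
    intro a b c e ha hb hc he
    rw [Real.mul_rpow ha (by positivity), Real.mul_rpow hb (by positivity),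
      Real.mul_rpow hc (by positivity), Real.inv_rpow he, ← div_eq_mul_inv (c ^ (1 / 2 : ℝ))]
  rw [e1]
  clear_value K₂
  calc (A * A) ^ (1 / 2 : ℝ) ≤ ((K₂ * (‖x - x'‖ / (s + t + D) ^ (n + 1))) *
        (2 * K₁ * sk n (1 / 4) (1 / 2) s t D)) ^ (1 / 2 : ℝ) := by gcongr
    _ = ((K₂ * (2 * K₁)) * (‖x - x'‖ * ((s * t) ^ (1 / 4 : ℝ) *
        ((s + t + D) ^ ((2 * (n + 3 / 4)) : ℝ))⁻¹))) ^ (1 / 2 : ℝ) := by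
          congr 1
          unfold sk
          have e2 : (s + t + D) ^ ((2 * (n + 3 / 4)) : ℝ) =
              (s + t + D) ^ (n + 1) * (s + t + D) ^ ((n : ℝ) + 1 / 2) := by
            rw [← Real.rpow_natCast, ← Real.rpow_add (by positivity)]
            congr 1; push_cast; ring
          rw [e2]
          field_simp
    _ = _ := by
      rw [gen _ _ _ _ (by positivity) (by positivity) (by positivity) (by positivity),
        ← Real.rpow_mul (by positivity), ← Real.rpow_mul (by positivity)]
      unfold sk
      congr 4
      · norm_num
      · ring

end IsPoissonType

/-! ### The Poisson kernel -/

/-- `√(t² + ‖x‖²)`, the length of `(x, t)` in the half-space `ℝⁿ × (0, ∞)`. -/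
def jap {n : ℕ} (t : ℝ) (x : E n) : ℝ := √(t ^ 2 + ‖x‖ ^ 2)

/-- The normalising constant of the Poisson kernel. -/
def poissonConst (n : ℕ) : ℝ := Real.Gamma (((n : ℝ) + 1) / 2) / Real.pi ^ (((n : ℝ) + 1) / 2)

theorem poissonConst_nonneg (n : ℕ) : 0 ≤ poissonConst n := by
  unfold poissonConst
  have := Real.Gamma_pos_of_pos (show 0 < ((n : ℝ) + 1) / 2 by positivity)
  positivity

section jap

variable {n : ℕ} {t : ℝ} (ht : 0 < t) (x x' : E n)
include ht

theorem jap_pos : 0 < jap t x := Real.sqrt_pos.2 (by positivity)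

omit ht in
theorem le_jap (t : ℝ) (x : E n) : t ≤ jap t x := by
  rw [jap]; apply Real.le_sqrt_of_sq_le; nlinarith [sq_nonneg ‖x‖]

omit ht in
theorem add_le_two_mul_jap (t : ℝ) (x : E n) : t + ‖x‖ ≤ 2 * jap t x := by
  have : ‖x‖ ≤ jap t x := by rw [jap]; apply Real.le_sqrt_of_sq_le; nlinarith
  have := le_jap t x
  linarith

omit ht in
theorem norm_le_jap (t : ℝ) (x : E n) : ‖x‖ ≤ jap t x := by
  rw [jap]; apply Real.le_sqrt_of_sq_le; nlinarith

theorem abs_jap_sub_le : |jap t x - jap t x'| ≤ ‖x - x'‖ := by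
  have key : ∀ a b : E n, jap t a ≤ jap t b + ‖a - b‖ := by
    intro a b
    have hb := norm_le_jap t b
    have hj := jap_pos ht b
    rw [jap, Real.sqrt_le_left (by positivity)]
    have h1 : jap t b ^ 2 = t ^ 2 + ‖b‖ ^ 2 := Real.sq_sqrt (by positivity)
    have h2 : ‖a‖ ≤ ‖b‖ + ‖a - b‖ := by simpa using norm_add_le b (a - b)
    have h3 : ‖a‖ ^ 2 ≤ (‖b‖ + ‖a - b‖) ^ 2 := by gcongr
    nlinarith [mul_le_mul_of_nonneg_right hb (norm_nonneg (a - b))]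
  rw [abs_sub_le_iff]
  constructor
  · linarith [key x x']
  · have := key x' x
    rw [norm_sub_rev] at this
    linarith

theorem rpow_eq_jap_pow : (t ^ 2 + ‖x‖ ^ 2) ^ (((n : ℝ) + 1) / 2) = jap t x ^ (n + 1) := by
  rw [jap, Real.sqrt_eq_rpow, ← Real.rpow_natCast (_ ^ (1 / 2 : ℝ)), ← Real.rpow_mul (by positivity)]
  congr 1; push_cast; ring

/-- Powers of `jap` are within a factor of the Poisson-type majorant. -/
theorem mul_inv_jap_pow_le : t * (jap t x ^ (n + 1))⁻¹ ≤ 2 ^ (n + 1) * pk n 1 t ‖x‖ := by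
  have hj := jap_pos ht x
  rw [pk_one, ← div_eq_mul_inv, mul_div_assoc', div_le_div_iff₀ (by positivity) (by positivity)]
  have : (t + ‖x‖) ^ (n + 1) ≤ (2 * jap t x) ^ (n + 1) := by
    gcongr; exact add_le_two_mul_jap t x
  rw [mul_pow] at this
  nlinarith

omit ht in
theorem abs_inv_pow_sub_le {a b : ℝ} (ha : 0 < a) (hb : 0 < b) (k : ℕ) :
    |(a ^ k)⁻¹ - (b ^ k)⁻¹| ≤ k * |a - b| * ((a ^ (k + 1))⁻¹ + (b ^ (k + 1))⁻¹) := by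
  wlog hab : a ≤ b generalizing a b
  · rw [abs_sub_comm, abs_sub_comm a b, add_comm (a ^ (k + 1))⁻¹]
    exact this hb ha (le_of_not_ge hab)
  rcases k with _ | k
  · simp
  have h1 := abs_pow_sub_pow_le a⁻¹ b⁻¹ (k + 1)
  have hinv : b⁻¹ ≤ a⁻¹ := by gcongr
  rw [abs_of_pos (inv_pos.2 ha), abs_of_pos (inv_pos.2 hb), max_eq_left hinv] at h1
  have h2 : |a⁻¹ - b⁻¹| ≤ |a - b| * (a⁻¹ * a⁻¹) := by
    have : a⁻¹ - b⁻¹ = (b - a) * (a⁻¹ * b⁻¹) := by field_simp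
    rw [this, abs_mul, abs_sub_comm b a, abs_of_pos (show 0 < a⁻¹ * b⁻¹ by positivity)]
    gcongr
  simp only [← inv_pow]
  calc |a⁻¹ ^ (k + 1) - b⁻¹ ^ (k + 1)| ≤ |a⁻¹ - b⁻¹| * ((k + 1 : ℕ) : ℝ) * a⁻¹ ^ k := h1
    _ ≤ (|a - b| * (a⁻¹ * a⁻¹)) * ((k + 1 : ℕ) : ℝ) * a⁻¹ ^ k := by gcongr
    _ = ((k + 1 : ℕ) : ℝ) * |a - b| * (a⁻¹ ^ (k + 1 + 1)) := by ring
    _ ≤ _ := by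
      have : 0 ≤ b⁻¹ ^ (k + 1 + 1) := by positivity
      gcongr; linarith

theorem abs_inv_jap_pow_sub_le (k : ℕ) : |(jap t x ^ k)⁻¹ - (jap t x' ^ k)⁻¹| ≤
    k * ‖x - x'‖ * ((jap t x ^ (k + 1))⁻¹ + (jap t x' ^ (k + 1))⁻¹) := by
  have h1 := jap_pos ht x
  have h2 := jap_pos ht x'
  refine (abs_inv_pow_sub_le h1 h2 k).trans ?_
  have := abs_jap_sub_le ht x x'
  gcongr

theorem pow_mul_inv_jap_pow_le (j k : ℕ) :
    t ^ j * (jap t x ^ (k + j))⁻¹ ≤ (jap t x ^ k)⁻¹ := by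
  have h1 := jap_pos ht x
  have h2 : t ^ j ≤ jap t x ^ j := by gcongr; exact le_jap t x
  calc _ ≤ jap t x ^ j * (jap t x ^ (k + j))⁻¹ := by gcongr
    _ = _ := by rw [pow_add]; field_simp

theorem abs_coord_mul_sub_le (k : ℕ) (i : Fin n) :
    |x i * (jap t x ^ k)⁻¹ - x' i * (jap t x' ^ k)⁻¹| ≤
      (k + 1) * ‖x - x'‖ * ((jap t x ^ k)⁻¹ + (jap t x' ^ k)⁻¹) := by
  wlog hle : jap t x ≤ jap t x' generalizing x x'
  · rw [abs_sub_comm, norm_sub_rev, add_comm (jap t x ^ k)⁻¹]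
    exact this x' x (le_of_not_ge hle)
  have h1 := jap_pos ht x
  have h2 := jap_pos ht x'
  have d1 : |x i - x' i| ≤ ‖x - x'‖ := PiLp.norm_apply_le (x - x') i
  have d2 : |x i| ≤ jap t x := (PiLp.norm_apply_le x i).trans (norm_le_jap t x)
  have e : x i * (jap t x ^ k)⁻¹ - x' i * (jap t x' ^ k)⁻¹ =
    x i * ((jap t x ^ k)⁻¹ - (jap t x' ^ k)⁻¹) + (x i - x' i) * (jap t x' ^ k)⁻¹ := by ring
  rw [e]
  refine (abs_add_le _ _).trans ?_
  rw [abs_mul, abs_mul, abs_of_pos (show 0 < (jap t x' ^ k)⁻¹ by positivity)]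
  calc _ ≤ jap t x * (k * ‖x - x'‖ * ((jap t x ^ (k + 1))⁻¹ + (jap t x' ^ (k + 1))⁻¹)) +
        ‖x - x'‖ * (jap t x' ^ k)⁻¹ := by
          gcongr; exact abs_inv_jap_pow_sub_le ht x x' k
    _ = k * ‖x - x'‖ * (jap t x * (jap t x ^ (k + 1))⁻¹ + jap t x * (jap t x' ^ (k + 1))⁻¹) +
        ‖x - x'‖ * (jap t x' ^ k)⁻¹ := by ring
    _ ≤ k * ‖x - x'‖ * ((jap t x ^ k)⁻¹ + (jap t x' ^ k)⁻¹) +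
        ‖x - x'‖ * ((jap t x ^ k)⁻¹ + (jap t x' ^ k)⁻¹) := by
          have a1 : jap t x * (jap t x ^ (k + 1))⁻¹ = (jap t x ^ k)⁻¹ := by
            rw [pow_succ]; field_simp
          have a2 : jap t x * (jap t x' ^ (k + 1))⁻¹ ≤ (jap t x' ^ k)⁻¹ := by
            calc _ ≤ jap t x' * (jap t x' ^ (k + 1))⁻¹ := by gcongr
              _ = _ := by rw [pow_succ]; field_simp
          rw [a1]
          gcongr
          have : 0 ≤ (jap t x ^ k)⁻¹ := by positivity
          linarith
    _ = _ := by ring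

end jap

theorem continuous_jap {n : ℕ} : Continuous fun v : ℝ × E n => jap v.1 v.2 := by
  unfold jap; fun_prop

theorem poissonKernel_eq {n : ℕ} {t : ℝ} (ht : 0 < t) (x : E n) :
    poissonKernel n t x = poissonConst n * (t * (jap t x ^ (n + 1))⁻¹) := by
  rw [poissonKernel, rpow_eq_jap_pow ht, poissonConst, div_eq_mul_inv t]

/-- The derivative of a negative power of `√g`. -/
theorem hasDerivAt_inv_sqrt_pow {g : ℝ → ℝ} {g' r : ℝ} (hg : HasDerivAt g g' r) (h0 : 0 < g r)
    (k : ℕ) : HasDerivAt (fun r => (√(g r) ^ k)⁻¹) (-(k / 2) * g' * (√(g r) ^ (k + 2))⁻¹) r := by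
  have hs : 0 < √(g r) := Real.sqrt_pos.2 h0
  have h := ((hg.sqrt h0.ne').pow k).inv (pow_pos hs k).ne'
  refine h.congr_deriv ?_
  rcases k with _ | k
  · simp
  simp only [Nat.add_sub_cancel, Pi.pow_apply]
  field_simp
  ring

theorem phiTime_eq {n : ℕ} {t : ℝ} (ht : 0 < t) (x : E n) :
    HasDerivAt (fun r => poissonKernel n r x) (t⁻¹ * phiTime n t x) t ∧
    phiTime n t x = poissonConst n * (t * (jap t x ^ (n + 1))⁻¹ -
      (n + 1) * (t * (t ^ 2 * (jap t x ^ (n + 3))⁻¹))) := by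
  have h1 : HasDerivAt (fun r : ℝ => r ^ 2 + ‖x‖ ^ 2) (2 * t) t := by
    simpa using (hasDerivAt_pow 2 t).add_const (‖x‖ ^ 2)
  have h2 := ((hasDerivAt_id t).mul
    (hasDerivAt_inv_sqrt_pow h1 (by positivity) (n + 1))).const_mul (poissonConst n)
  have h3 : (fun r => poissonKernel n r x) =ᶠ[nhds t]
      fun r => poissonConst n * (r * (√(r ^ 2 + ‖x‖ ^ 2) ^ (n + 1))⁻¹) := by
    filter_upwards [lt_mem_nhds ht] with r hr using poissonKernel_eq hr x
  have h4 := h2.congr_of_eventuallyEq h3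
  have h5 : phiTime n t x = poissonConst n * (t * (jap t x ^ (n + 1))⁻¹ -
      (n + 1) * (t * (t ^ 2 * (jap t x ^ (n + 3))⁻¹))) := by
    rw [phiTime, h4.deriv]
    simp only [jap, id]
    push_cast
    ring
  refine ⟨?_, h5⟩
  have : t⁻¹ * phiTime n t x = deriv (fun r => poissonKernel n r x) t := by
    rw [phiTime]; field_simp
  rw [this]
  exact h4.differentiableAt.hasDerivAt

theorem phiSpace_eq {n : ℕ} {t : ℝ} (ht : 0 < t) (i : Fin n) (x : E n) :
    phiSpace n i t x = -(poissonConst n * (n + 1)) * (t ^ 2 * (x i * (jap t x ^ (n + 3))⁻¹)) := by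
  have h0 : ∀ r : ℝ, ‖x + r • EuclideanSpace.single i (1 : ℝ)‖ ^ 2 =
      ‖x‖ ^ 2 + 2 * r * x i + r ^ 2 := by
    intro r
    rw [norm_add_sq_real, inner_smul_right, norm_smul]
    simp [EuclideanSpace.inner_single_right]
    ring
  have h1 : HasDerivAt (fun r : ℝ => t ^ 2 + ‖x + r • EuclideanSpace.single i (1 : ℝ)‖ ^ 2)
      (2 * x i) 0 := by
    simp_rw [h0]
    have a := (((hasDerivAt_id (0 : ℝ)).const_mul 2).mul_const (x i)).const_add (‖x‖ ^ 2)
    have b := (a.add (hasDerivAt_pow 2 (0 : ℝ))).const_add (t ^ 2)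
    simpa using b
  have h2 := ((hasDerivAt_inv_sqrt_pow h1 (by positivity) (n + 1)).const_mul
    t).const_mul (poissonConst n)
  have h3 := h2.congr_of_eventuallyEq (f₁ := fun r : ℝ =>
    poissonKernel n t (x + r • EuclideanSpace.single i (1 : ℝ)))
    (Filter.Eventually.of_forall fun r => poissonKernel_eq ht _)
  rw [phiSpace, lineDeriv, h3.deriv]
  simp only [jap, zero_smul, add_zero]
  push_cast
  ring

theorem continuousOn_inv_jap_pow {n : ℕ} (k : ℕ) :
    ContinuousOn (fun v : ℝ × E n => (jap v.1 v.2 ^ k)⁻¹) (Ioi 0 ×ˢ univ) :=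
  (continuous_jap.pow k).continuousOn.inv₀ fun v hv => (pow_pos (jap_pos hv.1 v.2) k).ne'

theorem mul_inv_jap_add_le {n : ℕ} {t : ℝ} (ht : 0 < t) (x x' : E n) (δ : ℝ) (hδ : 0 ≤ δ) :
    δ * ((jap t x ^ (n + 1))⁻¹ + (jap t x' ^ (n + 1))⁻¹) ≤
      2 ^ (n + 1) * ((δ / t) * (pk n 1 t ‖x‖ + pk n 1 t ‖x'‖)) := by
  have h1 := mul_inv_jap_pow_le ht x
  have h2 := mul_inv_jap_pow_le ht x'
  calc _ = (δ / t) * (t * (jap t x ^ (n + 1))⁻¹ + t * (jap t x' ^ (n + 1))⁻¹) := by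
        field_simp
    _ ≤ (δ / t) * (2 ^ (n + 1) * pk n 1 t ‖x‖ + 2 ^ (n + 1) * pk n 1 t ‖x'‖) := by gcongr
    _ = _ := by ring

theorem exists_isPoissonType_phiSpace (n : ℕ) :
    ∃ C, ∀ i : Fin n, IsPoissonType (phiSpace n i) C := by
  have hc := poissonConst_nonneg n
  set c := poissonConst n * (n + 1) with hcd
  have hc0 : 0 ≤ c := by positivity
  refine ⟨c * (n + 4) * 2 ^ (n + 1), fun i => ⟨by positivity, ?_, ?_, ?_, ?_⟩⟩
  · have h : ContinuousOn (fun v : ℝ × E n =>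
        -c * (v.1 ^ 2 * (v.2 i * (jap v.1 v.2 ^ (n + 3))⁻¹))) (Ioi 0 ×ˢ univ) := by
      have := continuousOn_inv_jap_pow (n := n) (n + 3)
      have h2 : Continuous fun v : ℝ × E n => v.2 i := by fun_prop
      exact continuousOn_const.mul
        ((continuous_fst.pow 2).continuousOn.mul (h2.continuousOn.mul this))
    exact h.congr fun v hv => phiSpace_eq hv.1 i v.2
  · intro t ht x
    have hj := jap_pos ht x
    have d2 : |x i| ≤ jap t x := (PiLp.norm_apply_le x i).trans (norm_le_jap t x)
    rw [phiSpace_eq ht, abs_mul, abs_neg, abs_of_nonneg hc0, abs_mul, abs_mul,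
      abs_of_pos (show 0 < t ^ 2 by positivity),
      abs_of_pos (show 0 < (jap t x ^ (n + 3))⁻¹ by positivity)]
    calc _ ≤ c * (t ^ 2 * (jap t x * (jap t x ^ (n + 3))⁻¹)) := by gcongr
      _ = c * (t * (t ^ 1 * (jap t x ^ (n + 1 + 1))⁻¹)) := by
        congr 1; field_simp; ring
      _ ≤ c * (t * (jap t x ^ (n + 1))⁻¹) := by
        gcongr; exact pow_mul_inv_jap_pow_le ht x 1 (n + 1)
      _ ≤ c * (2 ^ (n + 1) * pk n 1 t ‖x‖) :=
        mul_le_mul_of_nonneg_left (mul_inv_jap_pow_le ht x) hc0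
      _ ≤ _ := by
        have := pk_nonneg (n := n) (a := 1) ht (norm_nonneg x)
        rw [mul_assoc c, mul_assoc c, mul_assoc ((n : ℝ) + 4)]
        refine mul_le_mul_of_nonneg_left (le_mul_of_one_le_left (by positivity) ?_) hc0
        have : (0 : ℝ) ≤ n := by positivity
        linarith
  · intro t ht x x'
    rw [phiSpace_eq ht, phiSpace_eq ht, ← mul_sub, ← mul_sub, abs_mul, abs_neg, abs_of_nonneg hc0,
      abs_mul, abs_of_pos (show 0 < t ^ 2 by positivity)]
    calc _ ≤ c * (t ^ 2 * (((n + 3 : ℕ) + 1) * ‖x - x'‖ *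
            ((jap t x ^ (n + 3))⁻¹ + (jap t x' ^ (n + 3))⁻¹))) := by
          gcongr; exact abs_coord_mul_sub_le ht x x' (n + 3) i
      _ = c * (n + 4) * (‖x - x'‖ * (t ^ 2 * (jap t x ^ (n + 1 + 2))⁻¹ +
            t ^ 2 * (jap t x' ^ (n + 1 + 2))⁻¹)) := by push_cast; ring
      _ ≤ c * (n + 4) * (‖x - x'‖ * ((jap t x ^ (n + 1))⁻¹ + (jap t x' ^ (n + 1))⁻¹)) := by
          gcongr
          · exact pow_mul_inv_jap_pow_le ht x 2 (n + 1)
          · exact pow_mul_inv_jap_pow_le ht x' 2 (n + 1)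
      _ ≤ c * (n + 4) * (2 ^ (n + 1) * ((‖x - x'‖ / t) * (pk n 1 t ‖x‖ + pk n 1 t ‖x'‖))) := by
          refine mul_le_mul_of_nonneg_left ?_ (by positivity)
          exact mul_inv_jap_add_le ht x x' _ (norm_nonneg _)
      _ = _ := by ring
  · -- the kernel is odd
    intro t ht
    have h : ∀ x, phiSpace n i t (-x) = -phiSpace n i t x := fun x => by
      rw [phiSpace_eq ht, phiSpace_eq ht]
      simp [jap]
    have h2 := integral_neg_eq_self (phiSpace n i t) (volume : Measure (E n))
    simp_rw [h, integral_neg] at h2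
    linarith

/-- The integral of the Poisson kernel does not depend on `t`. -/
theorem integral_poissonKernel {n : ℕ} {t : ℝ} (ht : 0 < t) :
    ∫ x : E n, poissonKernel n t x = ∫ x : E n, poissonKernel n 1 x := by
  have h3 : ∀ x : E n, poissonKernel n t x = (t ^ n)⁻¹ * poissonKernel n 1 (t⁻¹ • x) := fun x => by
    have hj : jap t x = t * jap 1 (t⁻¹ • x) := by
      rw [jap, jap, norm_smul, Real.norm_of_nonneg (by positivity)]
      have : t ^ 2 + ‖x‖ ^ 2 = t ^ 2 * (1 ^ 2 + (t⁻¹ * ‖x‖) ^ 2) := by field_simp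
      rw [this, Real.sqrt_mul (by positivity), Real.sqrt_sq ht.le]
    have := jap_pos one_pos (t⁻¹ • x)
    rw [poissonKernel_eq ht, poissonKernel_eq one_pos, hj]
    rw [mul_pow]
    field_simp
    ring
  simp_rw [h3]
  rw [integral_const_mul, Measure.integral_comp_smul]
  simp [abs_of_pos ht]
  field_simp

theorem exists_isPoissonType_phiTime (n : ℕ) : ∃ C, IsPoissonType (phiTime n) C := by
  have hc := poissonConst_nonneg n
  set c := poissonConst n with hcd
  set C := c * ((n + 1) * (n + 4)) * 2 ^ (n + 1) with hC
  have hn : (0 : ℝ) ≤ n := by positivity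
  have cont : ContinuousOn (fun v : ℝ × E n => phiTime n v.1 v.2) (Ioi 0 ×ˢ univ) := by
    have h : ContinuousOn (fun v : ℝ × E n => c * (v.1 * (jap v.1 v.2 ^ (n + 1))⁻¹ -
      (n + 1) * (v.1 * (v.1 ^ 2 * (jap v.1 v.2 ^ (n + 3))⁻¹)))) (Ioi 0 ×ˢ univ) := by
      have h1 := continuousOn_inv_jap_pow (n := n) (n + 1)
      have h3 := continuousOn_inv_jap_pow (n := n) (n + 3)
      have h2 : ContinuousOn (fun v : ℝ × E n => v.1) (Ioi 0 ×ˢ univ) :=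
        continuous_fst.continuousOn
      exact continuousOn_const.mul ((h2.mul h1).sub
        (continuousOn_const.mul (h2.mul ((h2.pow 2).mul h3))))
    exact h.congr fun v hv => (phiTime_eq hv.1 v.2).2
  have bound : ∀ t, 0 < t → ∀ x, |phiTime n t x| ≤ C * pk n 1 t ‖x‖ := by
    intro t ht x
    have hj := jap_pos ht x
    have p := pk_nonneg (n := n) (a := 1) ht (norm_nonneg x)
    rw [(phiTime_eq ht x).2, abs_mul, abs_of_nonneg hc]
    have h1 := pow_mul_inv_jap_pow_le ht x 2 (n + 1)
    have h2 := mul_inv_jap_pow_le ht x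
    calc _ ≤ c * (|t * (jap t x ^ (n + 1))⁻¹| +
          |(n + 1) * (t * (t ^ 2 * (jap t x ^ (n + 3))⁻¹))|) := by gcongr; exact abs_sub _ _
      _ = c * (t * (jap t x ^ (n + 1))⁻¹ + (n + 1) * (t * (t ^ 2 * (jap t x ^ (n + 3))⁻¹))) := by
          rw [abs_of_nonneg (by positivity), abs_of_nonneg (by positivity)]
      _ ≤ c * (t * (jap t x ^ (n + 1))⁻¹ + (n + 1) * (t * (jap t x ^ (n + 1))⁻¹)) := by
          gcongr
      _ = c * (n + 2) * (t * (jap t x ^ (n + 1))⁻¹) := by ring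
      _ ≤ c * (n + 2) * (2 ^ (n + 1) * pk n 1 t ‖x‖) := by gcongr
      _ ≤ c * ((n + 1) * (n + 4)) * (2 ^ (n + 1) * pk n 1 t ‖x‖) := by gcongr; nlinarith
      _ = _ := by rw [hC]; ring
  refine ⟨C, by positivity, cont, bound, ?_, ?_⟩
  · intro t ht x x'
    rw [(phiTime_eq ht x).2, (phiTime_eq ht x').2, ← mul_sub, abs_mul, abs_of_nonneg hc]
    have a1 := abs_inv_jap_pow_sub_le ht x x' (n + 1)
    have a2 := abs_inv_jap_pow_sub_le ht x x' (n + 3)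
    have b1 := pow_mul_inv_jap_pow_le ht x 1 (n + 1)
    have b1' := pow_mul_inv_jap_pow_le ht x' 1 (n + 1)
    have b2 := pow_mul_inv_jap_pow_le ht x 3 (n + 1)
    have b2' := pow_mul_inv_jap_pow_le ht x' 3 (n + 1)
    have e : t * (jap t x ^ (n + 1))⁻¹ - (n + 1) * (t * (t ^ 2 * (jap t x ^ (n + 3))⁻¹)) -
        (t * (jap t x' ^ (n + 1))⁻¹ - (n + 1) * (t * (t ^ 2 * (jap t x' ^ (n + 3))⁻¹))) =
        t * ((jap t x ^ (n + 1))⁻¹ - (jap t x' ^ (n + 1))⁻¹) -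
        (n + 1) * t ^ 3 * ((jap t x ^ (n + 3))⁻¹ - (jap t x' ^ (n + 3))⁻¹) := by ring
    rw [e]
    set J := (jap t x ^ (n + 1))⁻¹ + (jap t x' ^ (n + 1))⁻¹ with hJ
    have hJ0 : 0 ≤ J := by
      have := jap_pos ht x
      have := jap_pos ht x'
      positivity
    have c1 : |t * ((jap t x ^ (n + 1))⁻¹ - (jap t x' ^ (n + 1))⁻¹)| ≤
        (n + 1) * ‖x - x'‖ * J := by
      rw [abs_mul, abs_of_pos ht]
      calc _ ≤ t * _ := mul_le_mul_of_nonneg_left a1 ht.le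
        _ = (n + 1) * ‖x - x'‖ * (t ^ 1 * (jap t x ^ (n + 1 + 1))⁻¹ +
          t ^ 1 * (jap t x' ^ (n + 1 + 1))⁻¹) := by push_cast; ring
        _ ≤ _ := by rw [hJ]; gcongr
    have c2 : |(n + 1) * t ^ 3 * ((jap t x ^ (n + 3))⁻¹ - (jap t x' ^ (n + 3))⁻¹)| ≤
        (n + 1) * (n + 3) * ‖x - x'‖ * J := by
      rw [abs_mul, abs_of_pos (by positivity)]
      calc _ ≤ (n + 1) * t ^ 3 * _ := mul_le_mul_of_nonneg_left a2 (by positivity)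
        _ = (n + 1) * (n + 3) * ‖x - x'‖ * (t ^ 3 * (jap t x ^ (n + 1 + 3))⁻¹ +
          t ^ 3 * (jap t x' ^ (n + 1 + 3))⁻¹) := by push_cast; ring
        _ ≤ _ := by rw [hJ]; gcongr
    calc _ ≤ c * ((n + 1) * ‖x - x'‖ * J + (n + 1) * (n + 3) * ‖x - x'‖ * J) := by
          gcongr
          exact (abs_sub _ _).trans (add_le_add c1 c2)
      _ = c * ((n + 1) * (n + 4)) * (‖x - x'‖ * J) := by ring
      _ ≤ c * ((n + 1) * (n + 4)) *
          (2 ^ (n + 1) * ((‖x - x'‖ / t) * (pk n 1 t ‖x‖ + pk n 1 t ‖x'‖))) := by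
          refine mul_le_mul_of_nonneg_left ?_ (by positivity)
          exact mul_inv_jap_add_le ht x x' _ (norm_nonneg _)
      _ = _ := by rw [hC]; ring
  · -- differentiate the constant function `r ↦ ∫ P_r`
    intro t ht
    have hC0 : 0 ≤ C := by positivity
    have contP : ∀ r, 0 < r → Continuous (phiTime n r) := fun r hr =>
      cont.comp_continuous (f := fun x : E n => (r, x)) (by fun_prop) fun x => ⟨hr, mem_univ _⟩
    have contQ : ∀ r, 0 < r → Continuous (fun x : E n => poissonKernel n r x) := fun r hr => by
      simp_rw [poissonKernel_eq hr]
      have := (continuousOn_inv_jap_pow (n := n) (n + 1)).comp_continuous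
        (f := fun x : E n => (r, x)) (by fun_prop) fun x => ⟨hr, mem_univ _⟩
      exact continuous_const.mul (continuous_const.mul this)
    have hint : Integrable fun x : E n => poissonKernel n t x := by
      refine ((integrable_pk one_pos ht).const_mul (c * 2 ^ (n + 1))).mono'
        (contQ t ht).aestronglyMeasurable (Filter.Eventually.of_forall fun x => ?_)
      have := jap_pos ht x
      rw [poissonKernel_eq ht, Real.norm_of_nonneg (by positivity), mul_assoc]
      exact mul_le_mul_of_nonneg_left (mul_inv_jap_pow_le ht x) hc
    have key := hasDerivAt_integral_of_dominated_loc_of_deriv_le (μ := (volume : Measure (E n)))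
      (F := fun r x => poissonKernel n r x) (F' := fun r x => r⁻¹ * phiTime n r x) (x₀ := t)
      (s := Ioi (t / 2)) (bound := fun x => C * ((t / 2)⁻¹ * pk n 1 (t / 2) ‖x‖))
      (Ioi_mem_nhds (by linarith)) ?_ hint ?_ ?_ ?_ ?_
    · have h1 := key.2
      have h2 : (fun r => ∫ x : E n, poissonKernel n r x) =ᶠ[nhds t]
          fun _ => ∫ x : E n, poissonKernel n 1 x := by
        filter_upwards [lt_mem_nhds ht] with r hr using integral_poissonKernel hr
      have h3 := (h1.congr_of_eventuallyEq h2.symm).unique (hasDerivAt_const t _)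
      rw [integral_const_mul] at h3
      have := ht.ne'
      simpa [this] using h3
    · filter_upwards [lt_mem_nhds ht] with r hr using (contQ r hr).aestronglyMeasurable
    · exact (continuous_const.mul (contP t ht)).aestronglyMeasurable
    · refine Filter.Eventually.of_forall fun x r hr => ?_
      have hr' : t / 2 < r := hr
      have hr0 : 0 < r := by linarith
      rw [norm_mul, Real.norm_of_nonneg (by positivity)]
      calc r⁻¹ * |phiTime n r x| ≤ r⁻¹ * (C * pk n 1 r ‖x‖) := by gcongr; exact bound r hr0 x
        _ = C * ((r + ‖x‖) ^ (n + 1))⁻¹ := by rw [pk_one]; field_simp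
        _ ≤ C * ((t / 2 + ‖x‖) ^ (n + 1))⁻¹ := by gcongr
        _ = _ := by rw [pk_one]; field_simp
    · exact ((integrable_pk one_pos (by positivity)).const_mul _).const_mul _
    · refine Filter.Eventually.of_forall fun x r hr => ?_
      have hr' : t / 2 < r := hr
      exact (phiTime_eq (by linarith) x).1

/-- All the kernels of the statement are of Poisson type, with the same constant. -/
theorem exists_isPoissonType (n : ℕ) : ∃ C, ∀ φ : ℝ → E n → ℝ,
    (φ = phiTime n ∨ ∃ i, φ = phiSpace n i) → IsPoissonType φ C := by
  obtain ⟨C₁, h₁⟩ := exists_isPoissonType_phiTime n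
  obtain ⟨C₂, h₂⟩ := exists_isPoissonType_phiSpace n
  refine ⟨max C₁ C₂, ?_⟩
  rintro φ (rfl | ⟨i, rfl⟩)
  · exact h₁.mono (le_max_left _ _)
  · exact (h₂ i).mono (le_max_right _ _)

/-- Joint continuity of `φ_s * φ_t`. -/
theorem IsPoissonType.continuousAt_kern {n : ℕ} {φ : ℝ → E n → ℝ} {C : ℝ} (h : IsPoissonType φ C)
    {s t : ℝ} (hs : 0 < s) (ht : 0 < t) (x : E n) :
    ContinuousAt (fun v : ℝ × ℝ × E n => kern φ v.1 v.2.1 v.2.2) (s, t, x) := by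
  simp_rw [kern_eq]
  have hC := h.nonneg
  have hφ : ∀ r z, 0 < r → ContinuousAt (fun v : ℝ × E n => φ v.1 v.2) (r, z) := fun r z hr =>
    h.continuousOn.continuousAt (prod_mem_nhds (Ioi_mem_nhds hr) Filter.univ_mem)
  have near : ∀ᶠ v : ℝ × ℝ × E n in nhds (s, t, x), (s / 2 < v.1 ∧ v.1 < 2 * s) ∧ t / 2 < v.2.1 := by
    have c1 : Filter.Tendsto (fun v : ℝ × ℝ × E n => v.1) (nhds (s, t, x)) (nhds s) :=
      continuousAt_fst
    have c2 : Filter.Tendsto (fun v : ℝ × ℝ × E n => v.2.1) (nhds (s, t, x)) (nhds t) :=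
      (continuous_fst.comp continuous_snd).continuousAt
    exact ((c1.eventually (lt_mem_nhds (by linarith))).and
      (c1.eventually (gt_mem_nhds (by linarith)))).and (c2.eventually (lt_mem_nhds (by linarith)))
  refine continuousAt_of_dominated
    (bound := fun y => C * (4 * pk n 1 (s / 2) ‖y‖) * (C * ((t / 2) ^ n)⁻¹)) ?_ ?_ ?_ ?_
  · filter_upwards [near] with v hv
    exact (h.integrable_mul (by linarith [hv.1.1]) (by linarith [hv.2]) v.2.2).aestronglyMeasurable
  · filter_upwards [near] with v hv
    refine Filter.Eventually.of_forall fun y => ?_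
    have hv1 : 0 < v.1 := by linarith [hv.1.1]
    have hv2 : 0 < v.2.1 := by linarith [hv.2]
    have b1 := h.bound v.1 hv1 y
    have b2 := h.bound v.2.1 hv2 (v.2.2 - y)
    have b3 : pk n 1 v.1 ‖y‖ ≤ 4 * pk n 1 (s / 2) ‖y‖ := by
      rw [pk_one, pk_one, mul_div_assoc']
      have := hv.1.1
      have := hv.1.2
      gcongr
      linarith
    have b4 : pk n 1 v.2.1 ‖v.2.2 - y‖ ≤ ((t / 2) ^ n)⁻¹ := by
      refine (pk_one_le n hv2 (norm_nonneg _)).trans ?_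
      have := hv.2
      gcongr
    have p := pk_nonneg (n := n) (a := 1) hv1 (norm_nonneg y)
    have p2 := pk_nonneg (n := n) (a := 1) hv2 (norm_nonneg (v.2.2 - y))
    have p3 := pk_nonneg (n := n) (a := 1) (half_pos hs) (norm_nonneg y)
    rw [norm_mul]
    calc _ ≤ (C * pk n 1 v.1 ‖y‖) * (C * pk n 1 v.2.1 ‖v.2.2 - y‖) :=
          mul_le_mul b1 b2 (abs_nonneg _) (by positivity)
      _ ≤ _ := by gcongr
  · exact (((integrable_pk one_pos (by positivity)).const_mul _).const_mul _).mul_const _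
  · refine Filter.Eventually.of_forall fun y => ?_
    have c1 : ContinuousAt (fun v : ℝ × ℝ × E n => φ v.1 y) (s, t, x) :=
      ContinuousAt.comp (g := fun v : ℝ × E n => φ v.1 v.2)
        (f := fun v : ℝ × ℝ × E n => (v.1, y)) (hφ s y hs) (by fun_prop)
    have c2 : ContinuousAt (fun v : ℝ × ℝ × E n => φ v.2.1 (v.2.2 - y)) (s, t, x) :=
      ContinuousAt.comp (g := fun v : ℝ × E n => φ v.1 v.2)
        (f := fun v : ℝ × ℝ × E n => (v.2.1, v.2.2 - y)) (hφ t (x - y) ht) (by fun_prop)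
    exact c1.mul c2

/-! ### Positive operators on mixed-norm spaces -/

section Mixed

variable {X Y : Type*} [MeasurableSpace X] [MeasurableSpace Y] {α : Measure X} {β : Measure Y}

/-- The norm of `L^p(α; L^q(β))` of a nonnegative function of two variables. -/
def mixedNorm (α : Measure X) (β : Measure Y) (p q : ℝ) (F : X × Y → ℝ≥0∞) : ℝ≥0∞ :=
  (∫⁻ x, (∫⁻ y, F (x, y) ^ q ∂β) ^ (p / q) ∂α) ^ (1 / p)

/-- Hölder's inequality with respect to the measure with density `k`. -/
theorem lintegral_weight_mul_le {Z : Type*} [MeasurableSpace Z] {μ : Measure Z} {q q' : ℝ}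
    (hq : q.HolderConjugate q') {k H : Z → ℝ≥0∞} (hk : Measurable k) (hH : Measurable H) :
    ∫⁻ z, k z * H z ∂μ ≤ (∫⁻ z, k z ∂μ) ^ (1 / q') * (∫⁻ z, k z * H z ^ q ∂μ) ^ (1 / q) := by
  have h := ENNReal.lintegral_mul_le_Lp_mul_Lq μ hq.symm (f := fun z => k z ^ (1 / q'))
    (g := fun z => k z ^ (1 / q) * H z) (hk.pow_const _).aemeasurable
    ((hk.pow_const _).mul hH).aemeasurable
  have e1 : ∀ z, ((fun z => k z ^ (1 / q')) * fun z => k z ^ (1 / q) * H z) z = k z * H z := by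
    intro z
    simp only [Pi.mul_apply]
    rw [← mul_assoc, ← ENNReal.rpow_add_of_nonneg _ _ (by simpa using hq.symm.nonneg)
      (by simpa using hq.nonneg)]
    have : 1 / q' + 1 / q = 1 := by simpa using hq.symm.inv_add_inv_eq_one
    rw [this, ENNReal.rpow_one]
  have e2 : ∀ z, (k z ^ (1 / q')) ^ q' = k z := fun z => by
    rw [← ENNReal.rpow_mul, one_div_mul_cancel hq.symm.ne_zero, ENNReal.rpow_one]
  have e3 : ∀ z, (k z ^ (1 / q) * H z) ^ q = k z * H z ^ q := fun z => by
    rw [ENNReal.mul_rpow_of_nonneg _ _ hq.nonneg, ← ENNReal.rpow_mul,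
      one_div_mul_cancel hq.ne_zero, ENNReal.rpow_one]
  simp_rw [e1, e2, e3] at h
  exact h

/-- Hölder's inequality for mixed norms. -/
theorem lintegral_mul_le_mixedNorm [SFinite β] {p p' q q' : ℝ} (hp : p.HolderConjugate p')
    (hq : q.HolderConjugate q') {F G : X × Y → ℝ≥0∞} (hF : Measurable F) (hG : Measurable G)
    [SFinite α] : ∫⁻ v, F v * G v ∂(α.prod β) ≤ mixedNorm α β p q F * mixedNorm α β p' q' G := by
  rw [lintegral_prod (fun v => F v * G v) (hF.mul hG).aemeasurable]
  have mF : Measurable fun x => (∫⁻ y, F (x, y) ^ q ∂β) ^ (1 / q) :=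
    (hF.pow_const q).lintegral_prod_right'.pow_const _
  have mG : Measurable fun x => (∫⁻ y, G (x, y) ^ q' ∂β) ^ (1 / q') :=
    (hG.pow_const q').lintegral_prod_right'.pow_const _
  calc _ ≤ ∫⁻ x, (∫⁻ y, F (x, y) ^ q ∂β) ^ (1 / q) * (∫⁻ y, G (x, y) ^ q' ∂β) ^ (1 / q') ∂α :=
        lintegral_mono fun x => ENNReal.lintegral_mul_le_Lp_mul_Lq β hq
          (hF.comp measurable_prodMk_left).aemeasurable
          (hG.comp measurable_prodMk_left).aemeasurable
    _ ≤ _ := ENNReal.lintegral_mul_le_Lp_mul_Lq α hp mF.aemeasurable mG.aemeasurable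
    _ = _ := by
      simp only [← ENNReal.rpow_mul, one_div_mul_eq_div]
      rfl

theorem mixedNorm_tendsto {p q : ℝ} (hp : 0 < p) (hq : 0 < q) [SFinite β]
    {F : X × Y → ℝ≥0∞} {f : ℕ → X × Y → ℝ≥0∞} (hf : ∀ m, Measurable (f m)) (hmono : Monotone f)
    (hlim : ∀ v, Filter.Tendsto (fun m => f m v) Filter.atTop (nhds (F v))) :
    Filter.Tendsto (fun m => mixedNorm α β p q (f m)) Filter.atTop (nhds (mixedNorm α β p q F)) := by
  have hpq : 0 ≤ p / q := by positivity
  refine ((ENNReal.continuous_rpow_const (y := 1 / p)).tendsto _).comp ?_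
  refine lintegral_tendsto_of_tendsto_of_monotone
    (fun m => (((hf m).pow_const q).lintegral_prod_right'.pow_const _).aemeasurable) ?_ ?_
  · refine Filter.Eventually.of_forall fun x m m' hmm => ?_
    refine ENNReal.rpow_le_rpow (lintegral_mono fun y => ?_) hpq
    exact ENNReal.rpow_le_rpow (hmono hmm _) hq.le
  · refine Filter.Eventually.of_forall fun x => ?_
    refine ((ENNReal.continuous_rpow_const (y := p / q)).tendsto _).comp ?_
    refine lintegral_tendsto_of_tendsto_of_monotone
      (fun m => (((hf m).comp measurable_prodMk_left).pow_const q).aemeasurable) ?_ ?_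
    · exact Filter.Eventually.of_forall fun y m m' hmm => ENNReal.rpow_le_rpow (hmono hmm _) hq.le
    · exact Filter.Eventually.of_forall fun y =>
        ((ENNReal.continuous_rpow_const (y := q)).tendsto _).comp (hlim _)

/-- The converse of Hölder's inequality for mixed norms, for a function of finite norm. The test
function is `F^(q-1) ‖F(x, ·)‖_q^(p-q)`. -/
theorem mixedNorm_le_of_forall_of_ne_top [SFinite α] [SFinite β] {p p' q q' : ℝ}
    (hp : p.HolderConjugate p')
    (hq : q.HolderConjugate q') {F : X × Y → ℝ≥0∞} (hF : Measurable F) {K : ℝ≥0∞}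
    (hfin : ∀ x, ∫⁻ y, F (x, y) ^ q ∂β ≠ ∞)
    (hI : ∫⁻ x, (∫⁻ y, F (x, y) ^ q ∂β) ^ (p / q) ∂α ≠ ∞)
    (h : ∀ V : X × Y → ℝ≥0∞, Measurable V →
      ∫⁻ v, F v * V v ∂(α.prod β) ≤ K * mixedNorm α β p' q' V) :
    mixedNorm α β p q F ≤ K := by
  set P : X → ℝ≥0∞ := fun x => ∫⁻ y, F (x, y) ^ q ∂β with hP
  have mP : Measurable P := (hF.pow_const q).lintegral_prod_right'
  set V : X × Y → ℝ≥0∞ := fun v => P v.1 ^ ((p - q) / q) * F v ^ (q - 1) with hV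
  have mV : Measurable V := ((mP.comp measurable_fst).pow_const _).mul (hF.pow_const _)
  have hq0 := hq.pos
  have hq1 : 0 < q - 1 := sub_pos.2 hq.lt
  have mFy : ∀ x, Measurable fun y => F (x, y) ^ q := fun x =>
    (hF.comp measurable_prodMk_left).pow_const q
  have eFV : ∀ x, ∫⁻ y, F (x, y) * V (x, y) ∂β = P x ^ (p / q) := by
    intro x
    have e1 : ∀ y, F (x, y) * V (x, y) = P x ^ ((p - q) / q) * F (x, y) ^ q := fun y => by
      rw [hV]
      have : F (x, y) ^ q = F (x, y) ^ (1 : ℝ) * F (x, y) ^ (q - 1) := by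
        rw [← ENNReal.rpow_add_of_nonneg _ _ zero_le_one hq1.le]; congr 1; ring
      rw [this, ENNReal.rpow_one]; ring
    simp_rw [e1]
    rw [lintegral_const_mul _ (mFy x)]
    change P x ^ ((p - q) / q) * P x = _
    rcases eq_or_ne (P x) 0 with h0 | h0
    · rw [h0, mul_zero, ENNReal.zero_rpow_of_pos (div_pos hp.pos hq0)]
    · nth_rewrite 2 [← ENNReal.rpow_one (P x)]
      rw [← ENNReal.rpow_add _ _ h0 (hfin x)]
      congr 1
      field_simp
      ring
  have eV : ∀ x, (∫⁻ y, V (x, y) ^ q' ∂β) ^ (p' / q') = P x ^ (p / q) := by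
    intro x
    have e1 : ∀ y, V (x, y) ^ q' = P x ^ ((p - q) / q * q') * F (x, y) ^ q := fun y => by
      rw [hV]
      rw [ENNReal.mul_rpow_of_nonneg _ _ hq.symm.nonneg, ← ENNReal.rpow_mul, ← ENNReal.rpow_mul,
        hq.sub_one_mul_conj]
    simp_rw [e1]
    rw [lintegral_const_mul _ (mFy x)]
    change (P x ^ ((p - q) / q * q') * P x) ^ (p' / q') = _
    rcases eq_or_ne (P x) 0 with h0 | h0
    · rw [h0, mul_zero, ENNReal.zero_rpow_of_pos (div_pos hp.pos hq0),
        ENNReal.zero_rpow_of_pos (div_pos hp.symm.pos hq.symm.pos)]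
    · nth_rewrite 2 [← ENNReal.rpow_one (P x)]
      rw [← ENNReal.rpow_add _ _ h0 (hfin x), ← ENNReal.rpow_mul]
      congr 1
      have a1 := hq.sub_one_mul_conj
      have a2 := hp.sub_one_mul_conj
      have hq'0 := hq.symm.ne_zero
      have hp'0 := hp.symm.ne_zero
      field_simp
      linear_combination q' * a2 - p' * a1
  set I := ∫⁻ x, P x ^ (p / q) ∂α with hIdef
  have key := h V mV
  rw [lintegral_prod (fun v => F v * V v) (hF.mul mV).aemeasurable] at key
  simp only [eFV, mixedNorm, eV] at key
  change I ≤ K * I ^ (1 / p') at key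
  change I ^ (1 / p) ≤ K
  rcases eq_or_ne I 0 with h0 | h0
  · rw [h0, ENNReal.zero_rpow_of_pos (by simpa using hp.pos)]; exact zero_le
  have hne : I ^ (1 / p') ≠ 0 := by simp [h0, hI]
  have hnt : I ^ (1 / p') ≠ ∞ := by
    apply ENNReal.rpow_ne_top_of_nonneg _ hI
    simpa using hp.symm.nonneg
  have e2 : I = I ^ (1 / p) * I ^ (1 / p') := by
    rw [← ENNReal.rpow_add _ _ h0 hI]
    have : 1 / p + 1 / p' = 1 := by simpa using hp.inv_add_inv_eq_one
    rw [this, ENNReal.rpow_one]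
  nth_rewrite 1 [e2] at key
  exact (ENNReal.mul_le_mul_iff_left hne hnt).1 key

/-- The converse of Hölder's inequality for mixed norms. -/
theorem mixedNorm_le_of_forall [SigmaFinite α] [SigmaFinite β] {p p' q q' : ℝ}
    (hp : p.HolderConjugate p')
    (hq : q.HolderConjugate q') {F : X × Y → ℝ≥0∞} (hF : Measurable F) {K : ℝ≥0∞}
    (h : ∀ V : X × Y → ℝ≥0∞, Measurable V →
      ∫⁻ v, F v * V v ∂(α.prod β) ≤ K * mixedNorm α β p' q' V) :
    mixedNorm α β p q F ≤ K := by
  have hq0 := hq.pos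
  have hpq : 0 < p / q := div_pos hp.pos hq.pos
  set s : ℕ → Set (X × Y) := fun m => spanningSets α m ×ˢ spanningSets β m with hs
  have ms : ∀ m, MeasurableSet (s m) := fun m =>
    (measurableSet_spanningSets α m).prod (measurableSet_spanningSets β m)
  have smono : Monotone s := fun m m' hm =>
    prod_mono (monotone_spanningSets α hm) (monotone_spanningSets β hm)
  set f : ℕ → X × Y → ℝ≥0∞ := fun m => (s m).indicator fun v => min (F v) m with hf
  have mf : ∀ m, Measurable (f m) := fun m => (hF.min measurable_const).indicator (ms m)
  have fle : ∀ m v, f m v ≤ F v := fun m v =>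
    indicator_apply_le' (fun _ => min_le_left _ _) fun _ => zero_le
  have fmono : Monotone f := by
    intro m m' hm v
    refine indicator_apply_le' (fun hv => ?_) fun _ => zero_le
    rw [hf]
    simp only [indicator_of_mem (smono hm hv)]
    exact min_le_min le_rfl (by exact_mod_cast hm)
  have flim : ∀ v, Filter.Tendsto (fun m => f m v) Filter.atTop (nhds (F v)) := by
    intro v
    have h1 : Filter.Tendsto (fun m : ℕ => min (F v) (m : ℝ≥0∞)) Filter.atTop
        (nhds (min (F v) ∞)) :=
      tendsto_const_nhds.min ENNReal.tendsto_nat_nhds_top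
    rw [min_eq_left le_top] at h1
    refine h1.congr' ?_
    obtain ⟨i, hi⟩ := mem_iUnion.1 ((iUnion_spanningSets α).symm ▸ mem_univ v.1)
    obtain ⟨j, hj⟩ := mem_iUnion.1 ((iUnion_spanningSets β).symm ▸ mem_univ v.2)
    filter_upwards [Filter.eventually_ge_atTop (max i j)] with m hm
    have : v ∈ s m := ⟨monotone_spanningSets α ((le_max_left _ _).trans hm) hi,
      monotone_spanningSets β ((le_max_right _ _).trans hm) hj⟩
    rw [hf]
    simp only [indicator_of_mem this]
  refine le_of_tendsto' (mixedNorm_tendsto hp.pos hq.pos mf fmono flim) fun m => ?_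
  have bd : ∀ x, ∫⁻ y, f m (x, y) ^ q ∂β ≤
      (spanningSets α m).indicator (fun _ => (m : ℝ≥0∞) ^ q * β (spanningSets β m)) x := by
    intro x
    by_cases hx : x ∈ spanningSets α m
    · rw [indicator_of_mem hx]
      calc _ ≤ ∫⁻ y, (spanningSets β m).indicator (fun _ => (m : ℝ≥0∞) ^ q) y ∂β := by
            refine lintegral_mono fun y => ?_
            by_cases hy : y ∈ spanningSets β m
            · rw [indicator_of_mem hy]
              refine ENNReal.rpow_le_rpow ?_ hq0.le
              exact indicator_apply_le' (fun _ => min_le_right _ _) fun _ => zero_le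
            · have : (x, y) ∉ s m := fun hv => hy hv.2
              simp only [hf, indicator_of_notMem this, ENNReal.zero_rpow_of_pos hq0, zero_le]
        _ = _ := by rw [lintegral_indicator (measurableSet_spanningSets β m)]; simp
    · have : ∀ y, (x, y) ∉ s m := fun y hv => hx hv.1
      simp [hf, indicator_of_notMem (this _), ENNReal.zero_rpow_of_pos hq0]
  have cfin : (m : ℝ≥0∞) ^ q * β (spanningSets β m) ≠ ∞ :=
    ENNReal.mul_ne_top (ENNReal.rpow_ne_top_of_nonneg hq0.le (ENNReal.natCast_ne_top m))
      (measure_spanningSets_lt_top β m).ne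
  refine mixedNorm_le_of_forall_of_ne_top hp hq (mf m) (fun x => ?_) ?_ fun V hV =>
    (lintegral_mono fun v => mul_le_mul_left (fle m v) _).trans (h V hV)
  · refine ne_top_of_le_ne_top ?_ (bd x)
    by_cases hx : x ∈ spanningSets α m
    · rw [indicator_of_mem hx]; exact cfin
    · rw [indicator_of_notMem hx]; exact ENNReal.zero_ne_top
  · refine ne_top_of_le_ne_top ?_ (lintegral_mono fun x => ENNReal.rpow_le_rpow (bd x) hpq.le)
    have : ∀ x, (spanningSets α m).indicator (fun _ => (m : ℝ≥0∞) ^ q * β (spanningSets β m)) x ^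
        (p / q) = (spanningSets α m).indicator
          (fun _ => ((m : ℝ≥0∞) ^ q * β (spanningSets β m)) ^ (p / q)) x := by
      intro x
      by_cases hx : x ∈ spanningSets α m
      · simp [indicator_of_mem hx]
      · simp [indicator_of_notMem hx, hpq]
    simp_rw [this]
    rw [lintegral_indicator (measurableSet_spanningSets α m), setLIntegral_const]
    exact ENNReal.mul_ne_top (ENNReal.rpow_ne_top_of_nonneg hpq.le cfin)
      (measure_spanningSets_lt_top α m).ne

/-- The converse of Hölder's inequality. -/
theorem lintegral_rpow_le_of_forall [SigmaFinite α] {r r' : ℝ} (hr : r.HolderConjugate r')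
    {F : X → ℝ≥0∞} (hF : Measurable F) {K : ℝ≥0∞}
    (h : ∀ w : X → ℝ≥0∞, Measurable w →
      ∫⁻ x, F x * w x ∂α ≤ K * (∫⁻ x, w x ^ r' ∂α) ^ (1 / r')) :
    (∫⁻ x, F x ^ r ∂α) ^ (1 / r) ≤ K := by
  have := mixedNorm_le_of_forall (α := α) (β := Measure.dirac ()) hr hr
    (F := fun v => F v.1) (hF.comp measurable_fst) (K := K) fun V hV => by
      rw [lintegral_prod (fun v => F v.1 * V v) ((hF.comp measurable_fst).mul hV).aemeasurable]
      have := h (fun x => V (x, ())) (hV.comp measurable_prodMk_right)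
      simpa [mixedNorm, div_self hr.symm.ne_zero] using this
  simpa [mixedNorm, div_self hr.ne_zero] using this

/-- What the boundedness proof uses of a positive kernel `S` on `X × Y`: symmetry, bounded
integrals, and domination by a maximal operator, acting on functions of the first variable only. -/
structure IsMaximalKernel (α : Measure X) (β : Measure Y) (S : X × Y → X × Y → ℝ≥0∞) : Prop where
  measurable : Measurable (Function.uncurry S)
  symm : ∀ v v', S v v' = S v' v
  lintegral_le : ∃ C : ℝ≥0∞, C ≠ ∞ ∧ ∀ v, ∫⁻ v', S v v' ∂(α.prod β) ≤ C
  maximal : ∀ r : ℝ, 1 < r → ∃ D : ℝ≥0∞, D ≠ ∞ ∧ ∀ w : X → ℝ≥0∞, Measurable w →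
    ∃ M : X → ℝ≥0∞, Measurable M ∧ (∀ v, ∫⁻ v', S v v' * w v'.1 ∂(α.prod β) ≤ M v.1) ∧
      (∫⁻ x, M x ^ r ∂α) ^ (1 / r) ≤ D * (∫⁻ x, w x ^ r ∂α) ^ (1 / r)

namespace IsMaximalKernel

variable [SigmaFinite α] [SigmaFinite β] {S : X × Y → X × Y → ℝ≥0∞}

theorem measurable_lintegral (hS : IsMaximalKernel α β S) {H : X × Y → ℝ≥0∞} (hH : Measurable H) :
    Measurable fun v => ∫⁻ v', S v v' * H v' ∂(α.prod β) := by
  have : Measurable fun z : (X × Y) × (X × Y) => S z.1 z.2 * H z.2 :=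
    hS.measurable.mul (hH.comp measurable_snd)
  exact this.lintegral_prod_right'

/-- The operator with kernel `S` is self-adjoint. -/
theorem lintegral_mul_comm (hS : IsMaximalKernel α β S) {H V : X × Y → ℝ≥0∞} (hH : Measurable H)
    (hV : Measurable V) :
    ∫⁻ v, (∫⁻ v', S v v' * H v' ∂(α.prod β)) * V v ∂(α.prod β) =
      ∫⁻ v, H v * (∫⁻ v', S v v' * V v' ∂(α.prod β)) ∂(α.prod β) := by
  have mS : ∀ v, Measurable (S v) := fun v => hS.measurable.comp measurable_prodMk_left
  have m3 : Measurable fun z : (X × Y) × (X × Y) => S z.1 z.2 * H z.2 * V z.1 :=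
    (hS.measurable.mul (hH.comp measurable_snd)).mul (hV.comp measurable_fst)
  calc _ = ∫⁻ v, ∫⁻ v', S v v' * H v' * V v ∂(α.prod β) ∂(α.prod β) :=
        lintegral_congr fun v => (lintegral_mul_const _ ((mS v).mul hH)).symm
    _ = ∫⁻ v', ∫⁻ v, S v v' * H v' * V v ∂(α.prod β) ∂(α.prod β) :=
        lintegral_lintegral_swap m3.aemeasurable
    _ = _ := by
        refine lintegral_congr fun v' => ?_
        have mSV : Measurable fun v => S v' v * V v := (mS v').mul hV
        rw [← lintegral_const_mul _ mSV]
        refine lintegral_congr fun v => ?_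
        rw [hS.symm v v']; ring

/-- The operator with kernel `S` is bounded from `L^r(L^1)` to `L^r(L^1)`: its adjoint acts on
functions of the first variable as a maximal operator. -/
theorem exists_mixedNorm_one_le (hS : IsMaximalKernel α β S) {r : ℝ} (hr : 1 ≤ r) :
    ∃ K : ℝ≥0∞, K ≠ ∞ ∧ ∀ G : X × Y → ℝ≥0∞, Measurable G →
      mixedNorm α β r 1 (fun v => ∫⁻ v', S v v' * G v' ∂(α.prod β)) ≤ K * mixedNorm α β r 1 G := by
  rcases hr.eq_or_lt with rfl | hr
  · obtain ⟨C, hC, h⟩ := hS.lintegral_le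
    refine ⟨C, hC, fun G hG => ?_⟩
    have h1 := hS.lintegral_mul_comm hG (V := fun _ => 1) measurable_const
    simp only [mul_one] at h1
    simp only [mixedNorm, div_one, ENNReal.rpow_one]
    rw [← lintegral_prod (fun v => ∫⁻ v', S v v' * G v' ∂(α.prod β))
      (hS.measurable_lintegral hG).aemeasurable, h1, ← lintegral_prod G hG.aemeasurable, mul_comm, ← lintegral_mul_const _ hG]
    exact lintegral_mono fun v => mul_le_mul_right (h v) _
  · have hc := Real.HolderConjugate.conjExponent hr
    set r' := r.conjExponent
    obtain ⟨D, hD, h⟩ := hS.maximal r' hc.symm.lt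
    refine ⟨D, hD, fun G hG => ?_⟩
    have mN := (hS.measurable_lintegral hG).lintegral_prod_right' (ν := β)
    have mG := hG.lintegral_prod_right' (ν := β)
    simp only [mixedNorm, div_one, ENNReal.rpow_one]
    refine lintegral_rpow_le_of_forall hc mN fun w hw => ?_
    obtain ⟨M, hM, hM1, hM2⟩ := h w hw
    calc ∫⁻ x, (∫⁻ y, ∫⁻ v', S (x, y) v' * G v' ∂(α.prod β) ∂β) * w x ∂α
        = ∫⁻ v, (∫⁻ v', S v v' * G v' ∂(α.prod β)) * w v.1 ∂(α.prod β) := by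
          rw [lintegral_prod (fun v => (∫⁻ v', S v v' * G v' ∂(α.prod β)) * w v.1)
            ((hS.measurable_lintegral hG).mul (hw.comp measurable_fst)).aemeasurable]
          refine lintegral_congr fun x => (lintegral_mul_const _ ?_).symm
          exact (hS.measurable_lintegral hG).comp measurable_prodMk_left
      _ = ∫⁻ v, G v * (∫⁻ v', S v v' * w v'.1 ∂(α.prod β)) ∂(α.prod β) :=
          hS.lintegral_mul_comm hG (hw.comp measurable_fst)
      _ ≤ ∫⁻ v, G v * M v.1 ∂(α.prod β) := lintegral_mono fun v => mul_le_mul_right (hM1 v) _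
      _ = ∫⁻ x, (∫⁻ y, G (x, y) ∂β) * M x ∂α := by
          rw [lintegral_prod (fun v => G v * M v.1) (hG.mul (hM.comp measurable_fst)).aemeasurable]
          refine lintegral_congr fun x => ?_
          exact lintegral_mul_const (M x) (f := fun y => G (x, y)) (hG.comp measurable_prodMk_left)
      _ ≤ (∫⁻ x, (∫⁻ y, G (x, y) ∂β) ^ r ∂α) ^ (1 / r) * (∫⁻ x, M x ^ r' ∂α) ^ (1 / r') :=
          ENNReal.lintegral_mul_le_Lp_mul_Lq α hc mG.aemeasurable hM.aemeasurable
      _ ≤ (∫⁻ x, (∫⁻ y, G (x, y) ∂β) ^ r ∂α) ^ (1 / r) *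
          (D * (∫⁻ x, w x ^ r' ∂α) ^ (1 / r')) := mul_le_mul_right hM2 _
      _ = _ := by ring

/-- The case `q ≤ p`: as `∫ S ≤ C`, Hölder's inequality bounds the `q`-th power of the image of `H`
by a multiple of the image of `H ^ q`, and `L^p(L^q)` becomes `L^(p/q)(L^1)`. -/
theorem exists_mixedNorm_le_of_le (hS : IsMaximalKernel α β S) {p q : ℝ} (hq : 1 < q)
    (hqp : q ≤ p) :
    ∃ K : ℝ≥0∞, K ≠ ∞ ∧ ∀ H : X × Y → ℝ≥0∞, Measurable H →
      mixedNorm α β p q (fun v => ∫⁻ v', S v v' * H v' ∂(α.prod β)) ≤ K * mixedNorm α β p q H := by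
  have hc := Real.HolderConjugate.conjExponent hq
  set q' := q.conjExponent
  have hq0 := hc.pos
  have hp0 : 0 < p := hq0.trans_le hqp
  obtain ⟨C, hC, h1⟩ := hS.lintegral_le
  obtain ⟨K, hK, h2⟩ := hS.exists_mixedNorm_one_le (r := p / q) ((one_le_div hq0).2 hqp)
  have e0 : ∀ F : X × Y → ℝ≥0∞,
      mixedNorm α β p q F = (mixedNorm α β (p / q) 1 fun v => F v ^ q) ^ (1 / q) := by
    intro F
    simp only [mixedNorm, ENNReal.rpow_one, div_one]
    rw [← ENNReal.rpow_mul]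
    congr 1
    field_simp
  refine ⟨(C ^ (1 / q') * K ^ (1 / q)), ENNReal.mul_ne_top
    (ENNReal.rpow_ne_top_of_nonneg (by simpa using hc.symm.nonneg) hC)
    (ENNReal.rpow_ne_top_of_nonneg (by simpa using hc.nonneg) hK), fun H hH => ?_⟩
  have pt : ∀ v, (∫⁻ v', S v v' * H v' ∂(α.prod β)) ^ q ≤
      C ^ (q / q') * ∫⁻ v', S v v' * H v' ^ q ∂(α.prod β) := by
    intro v
    have h3 := lintegral_weight_mul_le (μ := α.prod β) hc (k := S v)
      (hS.measurable.comp measurable_prodMk_left) hH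
    calc _ ≤ (C ^ (1 / q') * (∫⁻ v', S v v' * H v' ^ q ∂(α.prod β)) ^ (1 / q)) ^ q := by
          refine ENNReal.rpow_le_rpow (h3.trans ?_) hc.nonneg
          refine mul_le_mul_left (ENNReal.rpow_le_rpow (h1 v) ?_) _
          simpa using hc.symm.nonneg
      _ = _ := by
          rw [ENNReal.mul_rpow_of_nonneg _ _ hc.nonneg, ← ENNReal.rpow_mul, ← ENNReal.rpow_mul,
            one_div_mul_cancel hc.ne_zero, ENNReal.rpow_one, one_div_mul_eq_div]
  have hpq : 0 < p / q := by positivity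
  have mono : ∀ F G : X × Y → ℝ≥0∞, (∀ v, F v ≤ G v) →
      mixedNorm α β (p / q) 1 F ≤ mixedNorm α β (p / q) 1 G := by
    intro F G hFG
    unfold mixedNorm
    refine ENNReal.rpow_le_rpow (lintegral_mono fun x => ENNReal.rpow_le_rpow
      (lintegral_mono fun y => ENNReal.rpow_le_rpow (hFG _) zero_le_one) ?_) ?_
    · positivity
    · positivity
  have mH := hH.pow_const q
  have mU := hS.measurable_lintegral mH
  have const : mixedNorm α β (p / q) 1 (fun v => C ^ (q / q') *
      ∫⁻ v', S v v' * H v' ^ q ∂(α.prod β)) = C ^ (q / q') * mixedNorm α β (p / q) 1 (fun v =>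
      ∫⁻ v', S v v' * H v' ^ q ∂(α.prod β)) := by
    simp only [mixedNorm, ENNReal.rpow_one, div_one]
    have : ∀ x, (∫⁻ y, C ^ (q / q') * ∫⁻ v', S (x, y) v' * H v' ^ q ∂(α.prod β) ∂β) ^ (p / q) =
        (C ^ (q / q')) ^ (p / q) *
          (∫⁻ y, ∫⁻ v', S (x, y) v' * H v' ^ q ∂(α.prod β) ∂β) ^ (p / q) := fun x => by
      have mUx : Measurable fun y => ∫⁻ v', S (x, y) v' * H v' ^ q ∂(α.prod β) :=
        mU.comp measurable_prodMk_left
      rw [lintegral_const_mul _ mUx, ENNReal.mul_rpow_of_nonneg _ _ hpq.le]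
    simp_rw [this]
    rw [lintegral_const_mul _ (mU.lintegral_prod_right'.pow_const _),
      ENNReal.mul_rpow_of_nonneg _ _ (by positivity), ← ENNReal.rpow_mul (C ^ (q / q')),
      mul_one_div_cancel hpq.ne', ENNReal.rpow_one]
  rw [e0, e0 H]
  calc _ ≤ (C ^ (q / q') * (K * mixedNorm α β (p / q) 1 fun v => H v ^ q)) ^ (1 / q) := by
        refine ENNReal.rpow_le_rpow ?_ (by positivity)
        refine (mono _ _ pt).trans (const.le.trans ?_)
        exact mul_le_mul_right (h2 _ mH) _
    _ = _ := by
        rw [ENNReal.mul_rpow_of_nonneg _ _ (by positivity),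
          ENNReal.mul_rpow_of_nonneg _ _ (by positivity), ← ENNReal.rpow_mul, ← mul_assoc]
        congr 3
        field_simp

/-- A positive operator whose kernel is dominated by a maximal operator is bounded on
`L^p(L^q)`: for `q ≤ p` by duality with `L^{(p/q)'}`, for `p ≤ q` by self-adjointness. -/
theorem exists_mixedNorm_le (hS : IsMaximalKernel α β S) {p q : ℝ} (hp : 1 < p) (hq : 1 < q) :
    ∃ K : ℝ≥0∞, K ≠ ∞ ∧ ∀ H : X × Y → ℝ≥0∞, Measurable H →
      mixedNorm α β p q (fun v => ∫⁻ v', S v v' * H v' ∂(α.prod β)) ≤ K * mixedNorm α β p q H := by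
  rcases le_total q p with hqp | hqp
  · exact hS.exists_mixedNorm_le_of_le hq hqp
  have hpc := Real.HolderConjugate.conjExponent hp
  have hqc := Real.HolderConjugate.conjExponent hq
  set p' := p.conjExponent
  set q' := q.conjExponent
  have hqp' : q' ≤ p' := by
    have h1 := hpc.inv_add_inv_eq_one
    have h2 := hqc.inv_add_inv_eq_one
    have h3 : q⁻¹ ≤ p⁻¹ := inv_anti₀ hpc.pos hqp
    rw [← inv_le_inv₀ hpc.symm.pos hqc.symm.pos]
    linarith
  obtain ⟨K, hK, h⟩ := hS.exists_mixedNorm_le_of_le hqc.symm.lt hqp'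
  refine ⟨K, hK, fun H hH => ?_⟩
  refine mixedNorm_le_of_forall hpc hqc (hS.measurable_lintegral hH) fun V hV => ?_
  rw [hS.lintegral_mul_comm hH hV]
  refine (lintegral_mul_le_mixedNorm hpc hqc hH (hS.measurable_lintegral hV)).trans ?_
  refine (mul_le_mul_right (h V hV) _).trans (le_of_eq ?_)
  ring

end IsMaximalKernel
end Mixed

/-! ### The Hardy–Littlewood maximal function -/

/-- The centred maximal function over balls with radii the powers of `2`; the countable supremum
makes it measurable. -/
def maxFun {n : ℕ} (f : E n → ℝ≥0∞) (x : E n) : ℝ≥0∞ :=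
  ⨆ k : ℤ, (volume (Metric.ball x ((2 : ℝ) ^ k)))⁻¹ * ∫⁻ y in Metric.ball x ((2 : ℝ) ^ k), f y

section

variable {n : ℕ}

theorem volume_ball_eq (x : E n) {r : ℝ} (hr : 0 < r) :
    volume (Metric.ball x r) = ENNReal.ofReal (r ^ n) * volume (Metric.ball (0 : E n) 1) := by
  have := Measure.addHaar_ball_of_pos (volume : Measure (E n)) x hr
  simpa using this

theorem volume_ball_ne_zero (x : E n) {r : ℝ} (hr : 0 < r) : volume (Metric.ball x r) ≠ 0 :=
  (Metric.measure_ball_pos volume x hr).ne'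

theorem volume_ball_ne_top (x : E n) {r : ℝ} : volume (Metric.ball x r) ≠ ∞ :=
  measure_ball_lt_top.ne

theorem measurable_maxFun {f : E n → ℝ≥0∞} (hf : Measurable f) : Measurable (maxFun f) := by
  refine Measurable.iSup fun k => ?_
  have h1 : ∀ x : E n, volume (Metric.ball x ((2 : ℝ) ^ k)) =
      ENNReal.ofReal (((2 : ℝ) ^ k) ^ n) * volume (Metric.ball (0 : E n) 1) := fun x =>
    volume_ball_eq x (by positivity)
  simp_rw [h1]
  refine measurable_const.mul ?_
  have h2 : ∀ x : E n, ∫⁻ y in Metric.ball x ((2 : ℝ) ^ k), f y =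
      ∫⁻ y, {v : E n × E n | dist v.2 v.1 < (2 : ℝ) ^ k}.indicator (fun v => f v.2) (x, y) := by
    intro x
    rw [← lintegral_indicator measurableSet_ball]
    rfl
  simp_rw [h2]
  refine Measurable.lintegral_prod_right' ((hf.comp measurable_snd).indicator ?_)
  exact measurableSet_lt (measurable_snd.dist measurable_fst) measurable_const

/-- The weak type `(1, 1)` inequality, by Vitali's covering lemma. -/
theorem mul_volume_maxFun_le (hn : 0 < n) (f : E n → ℝ≥0∞) {c : ℝ≥0∞}
    (hc : c ≠ 0) (hc' : c ≠ ∞) :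
    c * volume {x | c < maxFun f x} ≤ 5 ^ n * ∫⁻ x, f x := by
  rcases eq_or_ne (∫⁻ x, f x) ∞ with hI | hI
  · rw [hI, ENNReal.mul_top (by simp)]; exact le_top
  set v₁ := volume (Metric.ball (0 : E n) 1) with hv₁
  have hv0 : v₁ ≠ 0 := volume_ball_ne_zero _ one_pos
  have hvt : v₁ ≠ ∞ := volume_ball_ne_top _
  set r : E n × ℤ → ℝ := fun a => (2 : ℝ) ^ a.2 with hr
  have hr0 : ∀ a, 0 < r a := fun a => by positivity
  set t : Set (E n × ℤ) := {a | c * volume (Metric.ball a.1 (r a)) ≤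
    ∫⁻ y in Metric.ball a.1 (r a), f y} with ht
  have hR : ∀ a ∈ t, r a ≤ 1 + ((∫⁻ x, f x) / (c * v₁)).toReal := by
    intro a ha
    rcases le_total (r a) 1 with h1 | h1
    · exact h1.trans (le_add_of_nonneg_right ENNReal.toReal_nonneg)
    · have h2 : ENNReal.ofReal (r a ^ n) ≤ (∫⁻ x, f x) / (c * v₁) := by
        rw [ENNReal.le_div_iff_mul_le (Or.inl (mul_ne_zero hc hv0))
          (Or.inl (ENNReal.mul_ne_top hc' hvt))]
        calc _ = c * volume (Metric.ball a.1 (r a)) := by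
              rw [volume_ball_eq _ (hr0 a)]; ring
          _ ≤ _ := le_trans ha (setLIntegral_le_lintegral _ _)
      have h3 : (∫⁻ x, f x) / (c * v₁) ≠ ∞ :=
        ENNReal.div_ne_top hI (mul_ne_zero hc hv0)
      have h4 := (ENNReal.ofReal_le_iff_le_toReal h3).1 h2
      have h5 : r a ≤ r a ^ n := le_self_pow₀ h1 hn.ne'
      linarith
  obtain ⟨u, hut, hdisj, hcov⟩ :=
    Vitali.exists_disjoint_subfamily_covering_enlargement_closedBall t (fun a => a.1) r _ hR 4
      (by norm_num)
  have hdisj' : u.PairwiseDisjoint fun a => Metric.ball a.1 (r a) := fun a ha b hb hab =>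
    (hdisj ha hb hab).mono Metric.ball_subset_closedBall Metric.ball_subset_closedBall
  have hcount : u.Countable := hdisj'.countable_of_isOpen (fun _ _ => Metric.isOpen_ball)
    fun a _ => ⟨a.1, Metric.mem_ball_self (hr0 a)⟩
  have hsub : {x | c < maxFun f x} ⊆ ⋃ a ∈ u, Metric.ball a.1 (5 * r a) := by
    intro x hx
    obtain ⟨k, hk⟩ := lt_iSup_iff.1 (show c < maxFun f x from hx)
    have hk' : (x, k) ∈ t := by
      have h0 := volume_ball_ne_zero x (show (0 : ℝ) < 2 ^ k by positivity)
      have h1 : volume (Metric.ball x ((2 : ℝ) ^ k)) ≠ ∞ := volume_ball_ne_top x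
      change c * volume (Metric.ball x ((2 : ℝ) ^ k)) ≤ _
      refine (mul_le_mul_left hk.le _).trans (le_of_eq ?_)
      rw [mul_comm, ← mul_assoc, ENNReal.mul_inv_cancel h0 h1, one_mul]
    obtain ⟨b, hb, hbs⟩ := hcov _ hk'
    refine mem_biUnion hb (Metric.closedBall_subset_ball ?_
      (hbs (Metric.mem_closedBall_self (hr0 (x, k)).le)))
    linarith [hr0 b]
  calc c * volume {x | c < maxFun f x}
      ≤ c * ∑' a : u, volume (Metric.ball a.1.1 (5 * r a)) :=
        mul_le_mul_right ((measure_mono hsub).trans (measure_biUnion_le _ hcount _)) _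
    _ = ∑' a : u, 5 ^ n * (c * volume (Metric.ball a.1.1 (r a))) := by
        rw [← ENNReal.tsum_mul_left]
        refine tsum_congr fun a => ?_
        rw [volume_ball_eq _ (hr0 a),
          volume_ball_eq _ (mul_pos (by norm_num) (hr0 a)), mul_pow,
          ENNReal.ofReal_mul (by positivity), ENNReal.ofReal_pow (by norm_num)]
        norm_num
        ring
    _ ≤ ∑' a : u, 5 ^ n * ∫⁻ y in Metric.ball a.1.1 (r a), f y :=
        ENNReal.tsum_le_tsum fun a => mul_le_mul_right (hut a.2) _
    _ = 5 ^ n * ∫⁻ y in ⋃ a ∈ u, Metric.ball a.1 (r a), f y := by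
        rw [ENNReal.tsum_mul_left,
          lintegral_biUnion hcount (fun _ _ => measurableSet_ball) hdisj']
    _ ≤ _ := mul_le_mul_right (setLIntegral_le_lintegral _ _) _

/-- `a^κ` as an integral over its level sets, valid up to `a = ∞`. -/
theorem lintegral_indicator_rpow {κ : ℝ} (hκ : 0 < κ) (a : ℝ≥0∞) :
    ∫⁻ c in Ioi (0 : ℝ), (if ENNReal.ofReal c < a then ENNReal.ofReal (κ * c ^ (κ - 1)) else 0) =
      a ^ κ := by
  have fin : ∀ b : ℝ, 0 ≤ b →
      ∫⁻ c in Ioi (0 : ℝ), (if ENNReal.ofReal c < ENNReal.ofReal b then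
        ENNReal.ofReal (κ * c ^ (κ - 1)) else 0) = ENNReal.ofReal b ^ κ := by
    intro b hb
    have e1 : ∀ c ∈ Ioi (0 : ℝ), (if ENNReal.ofReal c < ENNReal.ofReal b then
        ENNReal.ofReal (κ * c ^ (κ - 1)) else 0) =
        (Iio b).indicator (fun c => ENNReal.ofReal (κ * c ^ (κ - 1))) c := by
      intro c hc
      simp only [indicator, mem_Iio]
      congr 1
      exact propext (ENNReal.ofReal_lt_ofReal_iff_of_nonneg (le_of_lt hc))
    rw [setLIntegral_congr_fun measurableSet_Ioi e1, lintegral_indicator measurableSet_Iio,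
      Measure.restrict_restrict measurableSet_Iio, Iio_inter_Ioi]
    have ii : IntervalIntegrable (fun c : ℝ => κ * c ^ (κ - 1)) volume 0 b :=
      (intervalIntegral.intervalIntegrable_rpow' (by linarith)).const_mul κ
    rw [setLIntegral_congr Ioo_ae_eq_Ioc, ← ofReal_integral_eq_lintegral_ofReal]
    · rw [← intervalIntegral.integral_of_le hb, intervalIntegral.integral_const_mul,
        integral_rpow (Or.inl (by linarith)), ENNReal.ofReal_rpow_of_nonneg hb hκ.le]
      congr 1
      rw [sub_add_cancel, Real.zero_rpow hκ.ne']
      field_simp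
      ring
    · rwa [intervalIntegrable_iff_integrableOn_Ioc_of_le hb] at ii
    · filter_upwards [ae_restrict_mem measurableSet_Ioc] with c hc
      have := hc.1
      positivity
  rcases eq_or_ne a ∞ with rfl | ha
  · rw [ENNReal.top_rpow_of_pos hκ]
    refine top_le_iff.1 (ENNReal.le_of_forall_nnreal_lt fun m _ => ?_)
    have h1 := fin ((m : ℝ) ^ (1 / κ)) (by positivity)
    rw [ENNReal.ofReal_rpow_of_nonneg (by positivity) hκ.le, ← Real.rpow_mul m.coe_nonneg,
      one_div_mul_cancel hκ.ne', Real.rpow_one, ENNReal.ofReal_coe_nnreal] at h1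
    rw [← h1]
    refine lintegral_mono fun c => ?_
    simp only [ENNReal.ofReal_lt_top, if_true]
    split_ifs <;> simp
  · rw [← ENNReal.ofReal_toReal ha]
    exact fin _ ENNReal.toReal_nonneg

/-- Splitting at height `c`: only the part of `f` above `c` matters for the level set of the maximal
function above `2c`. -/
theorem maxFun_le_add {f : E n → ℝ≥0∞} (hf : Measurable f) (c : ℝ≥0∞) (x : E n) :
    maxFun f x ≤ maxFun ({y | c < f y}.indicator f) x + c := by
  refine iSup_le fun k => ?_
  have hr : (0 : ℝ) < 2 ^ k := by positivity
  have h0 := volume_ball_ne_zero x hr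
  have h1 : volume (Metric.ball x ((2 : ℝ) ^ k)) ≠ ∞ := volume_ball_ne_top x
  have ms : MeasurableSet {y | c < f y} := measurableSet_lt measurable_const hf
  calc _ ≤ (volume (Metric.ball x ((2 : ℝ) ^ k)))⁻¹ *
        ∫⁻ y in Metric.ball x ((2 : ℝ) ^ k), ({y | c < f y}.indicator f y + c) := by
          refine mul_le_mul_right (lintegral_mono fun y => ?_) _
          by_cases hy : c < f y
          · simp [indicator, hy]
          · simp [indicator, hy, not_lt.1 hy]
    _ = (volume (Metric.ball x ((2 : ℝ) ^ k)))⁻¹ *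
        (∫⁻ y in Metric.ball x ((2 : ℝ) ^ k), {y | c < f y}.indicator f y) + c := by
          rw [lintegral_add_left (hf.indicator ms), mul_add, setLIntegral_const, mul_comm c,
            ← mul_assoc, ENNReal.inv_mul_cancel h0 h1, one_mul]
    _ ≤ _ := by
          gcongr
          exact le_iSup (fun k : ℤ => (volume (Metric.ball x ((2 : ℝ) ^ k)))⁻¹ *
            ∫⁻ y in Metric.ball x ((2 : ℝ) ^ k), {y | c < f y}.indicator f y) k

/-- The maximal function is bounded on `L^r` for `1 < r`. -/
theorem lintegral_maxFun_rpow_le (hn : 0 < n) {r : ℝ} (hr : 1 < r) {f : E n → ℝ≥0∞}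
    (hf : Measurable f) :
    ∫⁻ x, maxFun f x ^ r ≤
      (2 * 5 ^ n * ENNReal.ofReal (r / (r - 1)) * 2 ^ (r - 1)) * ∫⁻ x, f x ^ r := by
  have hr0 : 0 < r := by linarith
  have hr1 : 0 < r - 1 := by linarith
  have mM := measurable_maxFun hf
  have mset : MeasurableSet {v : E n × ℝ | ENNReal.ofReal v.2 < maxFun f v.1} :=
    measurableSet_lt (ENNReal.measurable_ofReal.comp measurable_snd) (mM.comp measurable_fst)
  have mset2 : MeasurableSet {v : E n × ℝ | ENNReal.ofReal v.2 < 2 * f v.1} :=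
    measurableSet_lt (ENNReal.measurable_ofReal.comp measurable_snd)
      ((hf.comp measurable_fst).const_mul 2)
  have mp : ∀ κ : ℝ, Measurable fun c : ℝ => ENNReal.ofReal (κ * c ^ (κ - 1)) := fun κ =>
    ENNReal.measurable_ofReal.comp ((measurable_id.pow_const _).const_mul κ)
  simp_rw [← lintegral_indicator_rpow hr0 (maxFun f _)]
  rw [lintegral_lintegral_swap]
  swap
  · exact (Measurable.ite mset ((mp r).comp measurable_snd) measurable_const).aemeasurable
  set K : ℝ≥0∞ := 2 * 5 ^ n * ENNReal.ofReal (r / (r - 1)) with hK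
  have step : ∀ c ∈ Ioi (0 : ℝ), (∫⁻ x, if ENNReal.ofReal c < maxFun f x then
      ENNReal.ofReal (r * c ^ (r - 1)) else 0) ≤ ∫⁻ x, K * (f x *
        (if ENNReal.ofReal c < 2 * f x then ENNReal.ofReal ((r - 1) * c ^ ((r - 1) - 1)) else 0)) := by
    intro c hc
    have hc0 : 0 < c := hc
    set c' := ENNReal.ofReal (c / 2) with hc'
    have hc'0 : c' ≠ 0 := by simpa [hc'] using hc0
    have ecc : ENNReal.ofReal c = c' + c' := by
      rw [hc', ← ENNReal.ofReal_add (by positivity) (by positivity), add_halves]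
    have ms1 : MeasurableSet {x | ENNReal.ofReal c < maxFun f x} :=
      measurableSet_lt measurable_const mM
    have ms2 : MeasurableSet {x | c' < f x} := measurableSet_lt measurable_const hf
    have e1 : (∫⁻ x, if ENNReal.ofReal c < maxFun f x then
        ENNReal.ofReal (r * c ^ (r - 1)) else 0) =
        ENNReal.ofReal (r * c ^ (r - 1)) * volume {x | ENNReal.ofReal c < maxFun f x} := by
      rw [← setLIntegral_const, ← lintegral_indicator ms1]
      simp only [indicator, mem_ofPred_eq]
    have e2 : ENNReal.ofReal (r * c ^ (r - 1)) =
        2 * ENNReal.ofReal (r / (r - 1)) * ENNReal.ofReal ((r - 1) * c ^ ((r - 1) - 1)) * c' := by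
      have h2 : (2 : ℝ≥0∞) = ENNReal.ofReal 2 := by simp
      rw [hc', h2, ← ENNReal.ofReal_mul (by norm_num), ← ENNReal.ofReal_mul (by positivity),
        ← ENNReal.ofReal_mul (by positivity)]
      congr 1
      have : c ^ (r - 1) = c ^ (r - 1 - 1) * c := by
        rw [← Real.rpow_add_one hc0.ne']; congr 1; ring
      rw [this]
      field_simp
    have sub : volume {x | ENNReal.ofReal c < maxFun f x} ≤
        volume {x | c' < maxFun ({y | c' < f y}.indicator f) x} := by
      refine measure_mono fun x hx => ?_
      have h1 : c' + c' < maxFun f x := ecc ▸ hx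
      have h2 := h1.trans_le (maxFun_le_add hf c' x)
      exact lt_of_add_lt_add_right h2
    rw [e1, e2]
    calc _ ≤ 2 * ENNReal.ofReal (r / (r - 1)) * ENNReal.ofReal ((r - 1) * c ^ ((r - 1) - 1)) *
          (c' * volume {x | c' < maxFun ({y | c' < f y}.indicator f) x}) := by
          rw [← mul_assoc]; gcongr
      _ ≤ 2 * ENNReal.ofReal (r / (r - 1)) * ENNReal.ofReal ((r - 1) * c ^ ((r - 1) - 1)) *
          (5 ^ n * ∫⁻ x, {y | c' < f y}.indicator f x) := by
          exact mul_le_mul_right (mul_volume_maxFun_le hn _ hc'0 ENNReal.ofReal_ne_top) _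
      _ = K * ENNReal.ofReal ((r - 1) * c ^ ((r - 1) - 1)) * ∫⁻ x, {y | c' < f y}.indicator f x := by
          rw [hK]; ring
      _ = _ := by
          rw [← lintegral_const_mul _ (hf.indicator ms2)]
          refine lintegral_congr fun x => ?_
          have iff1 : c' < f x ↔ ENNReal.ofReal c < 2 * f x := by
            have : ENNReal.ofReal c = 2 * c' := by rw [ecc, two_mul]
            rw [this]
            exact (ENNReal.mul_lt_mul_iff_right (by norm_num) (by norm_num)).symm
          by_cases hx : c' < f x
          · rw [if_pos (iff1.1 hx), indicator_of_mem (show x ∈ {y | c' < f y} from hx)]; ring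
          · rw [if_neg (iff1.not.1 hx), indicator_of_notMem (show x ∉ {y | c' < f y} from hx)]
            simp
  refine (setLIntegral_mono' measurableSet_Ioi step).trans (le_of_eq ?_)
  rw [lintegral_lintegral_swap]
  swap
  · refine Measurable.aemeasurable ?_
    have : Measurable fun v : ℝ × E n => (if ENNReal.ofReal v.1 < 2 * f v.2 then
        ENNReal.ofReal ((r - 1) * v.1 ^ ((r - 1) - 1)) else 0) :=
      Measurable.ite (measurableSet_lt (ENNReal.measurable_ofReal.comp measurable_fst)
        ((hf.comp measurable_snd).const_mul 2)) ((mp (r - 1)).comp measurable_fst) measurable_const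
    exact ((hf.comp measurable_snd).mul this).const_mul K
  rw [← lintegral_const_mul _ (hf.pow_const r)]
  refine lintegral_congr fun x => ?_
  have m1 : Measurable fun c : ℝ => (if ENNReal.ofReal c < 2 * f x then
      ENNReal.ofReal ((r - 1) * c ^ ((r - 1) - 1)) else 0) :=
    Measurable.ite (measurableSet_lt ENNReal.measurable_ofReal measurable_const) (mp (r - 1))
      measurable_const
  rw [lintegral_const_mul _ (m1.const_mul _), lintegral_const_mul _ m1,
    lintegral_indicator_rpow hr1, ENNReal.mul_rpow_of_nonneg _ _ hr1.le]
  have : f x ^ r = f x * f x ^ (r - 1) := by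
    nth_rewrite 2 [← ENNReal.rpow_one (f x)]
    rw [← ENNReal.rpow_add_of_nonneg _ _ zero_le_one hr1.le]
    congr 1; ring
  rw [this]; ring

/-- The dyadic decomposition of the Poisson-type majorant into averages over balls. -/
theorem exists_lintegral_pk_mul_le_maxFun (n : ℕ) {a : ℝ} (ha : 0 < a) :
    ∃ C : ℝ≥0∞, C ≠ ∞ ∧ ∀ f : E n → ℝ≥0∞, Measurable f → ∀ t, 0 < t → ∀ x : E n,
      ∫⁻ y, ENNReal.ofReal (pk n a t ‖x - y‖) * f y ≤ C * maxFun f x := by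
  set v₁ := volume (Metric.ball (0 : E n) 1) with hv₁
  have hv0 : v₁ ≠ 0 := volume_ball_ne_zero _ one_pos
  have hvt : v₁ ≠ ∞ := volume_ball_ne_top _
  set ρ : ℝ := 2 ^ (-a) with hρ
  have hρ0 : 0 < ρ := by positivity
  have hρ1 : ρ < 1 := Real.rpow_lt_one_of_one_lt_of_neg (by norm_num) (by linarith)
  set c : ℝ≥0∞ := ENNReal.ofReal (2 ^ (n + a)) * v₁ with hc
  refine ⟨∑' m : ℕ, c * ENNReal.ofReal ρ ^ m, ?_, ?_⟩
  · rw [ENNReal.tsum_mul_left, ENNReal.tsum_geometric]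
    refine ENNReal.mul_ne_top (ENNReal.mul_ne_top ENNReal.ofReal_ne_top hvt) ?_
    rw [ENNReal.inv_ne_top]
    exact (tsub_pos_of_lt (ENNReal.ofReal_lt_one.2 hρ1)).ne'
  intro f hf t ht x
  obtain ⟨j, hj1, hj2⟩ := exists_mem_Ico_zpow ht (one_lt_two)
  have ez : ∀ i : ℤ, (2 : ℝ) ^ i = (2 : ℝ) ^ (i : ℝ) := fun i => (Real.rpow_intCast 2 i).symm
  set R : ℕ → ℝ := fun m => (2 : ℝ) ^ (j + 1 + m) with hR
  have hR0 : ∀ m, 0 < R m := fun m => by positivity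
  -- the value of `c ρ^m / |B(x, R m)|`
  have val : ∀ m : ℕ, c * ENNReal.ofReal ρ ^ m * (volume (Metric.ball x (R m)))⁻¹ =
      ENNReal.ofReal (2 ^ (n + a) * ρ ^ m * (R m ^ n)⁻¹) := by
    intro m
    rw [volume_ball_eq _ (hR0 m), ENNReal.mul_inv (Or.inr hvt) (Or.inr hv0), hc,
      ← ENNReal.ofReal_inv_of_pos (pow_pos (hR0 m) n), ← ENNReal.ofReal_pow hρ0.le,
      ENNReal.ofReal_mul (by positivity), ENNReal.ofReal_mul (by positivity)]
    calc _ = ENNReal.ofReal (2 ^ (n + a)) * ENNReal.ofReal (ρ ^ m) *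
          ENNReal.ofReal ((R m ^ n)⁻¹) * (v₁ * v₁⁻¹) := by ring
      _ = _ := by rw [ENNReal.mul_inv_cancel hv0 hvt, mul_one]
  have pt : ∀ y, ENNReal.ofReal (pk n a t ‖x - y‖) ≤ ∑' m : ℕ,
      (Metric.ball x (R m)).indicator
        (fun _ => c * ENNReal.ofReal ρ ^ m * (volume (Metric.ball x (R m)))⁻¹) y := by
    intro y
    have hd := norm_nonneg (x - y)
    obtain ⟨m, hm1, hm2⟩ : ∃ m : ℕ, ‖x - y‖ < R m ∧
        pk n a t ‖x - y‖ ≤ 2 ^ (n + a) * ρ ^ m * (R m ^ n)⁻¹ := by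
      rcases lt_or_ge ‖x - y‖ ((2 : ℝ) ^ (j + 1)) with h | h
      · refine ⟨0, by simpa [hR] using h, ?_⟩
        have h1 : pk n a t ‖x - y‖ ≤ (t ^ n)⁻¹ := by
          unfold pk
          rw [div_le_iff₀ (by positivity)]
          calc t ^ a = (t ^ n)⁻¹ * t ^ ((n : ℝ) + a) := by
                rw [Real.rpow_add ht, Real.rpow_natCast]; field_simp
            _ ≤ _ := by gcongr; linarith
        refine h1.trans ?_
        have h2 : (t ^ n)⁻¹ ≤ (((2 : ℝ) ^ j) ^ n)⁻¹ := by gcongr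
        refine h2.trans ?_
        have e : R 0 = 2 * 2 ^ j := by
          simp only [hR, Nat.cast_zero, add_zero]
          rw [zpow_add_one₀ (by norm_num), mul_comm]
        rw [e, mul_pow, Real.rpow_add (by norm_num), Real.rpow_natCast, pow_zero, mul_one]
        have h3 : (1 : ℝ) ≤ 2 ^ a := Real.one_le_rpow (by norm_num) ha.le
        calc (((2 : ℝ) ^ j) ^ n)⁻¹ = 1 * (((2 : ℝ) ^ j) ^ n)⁻¹ := by ring
          _ ≤ 2 ^ a * (((2 : ℝ) ^ j) ^ n)⁻¹ := by gcongr
          _ = _ := by field_simp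
      · have hd0 : 0 < ‖x - y‖ := lt_of_lt_of_le (by positivity) h
        obtain ⟨i, hi1, hi2⟩ := exists_mem_Ico_zpow hd0 (one_lt_two)
        have hij : j + 1 ≤ i := by
          by_contra hcon
          have : (2 : ℝ) ^ (i + 1) ≤ 2 ^ (j + 1) := zpow_le_zpow_right₀ (by norm_num) (by omega)
          linarith
        obtain ⟨m, hm⟩ := Int.eq_ofNat_of_zero_le (show 0 ≤ i - j by omega)
        have hRm : R m = 2 ^ (i + 1) := by simp only [hR]; congr 1; omega
        refine ⟨m, by rw [hRm]; exact hi2, ?_⟩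
        have h1 : pk n a t ‖x - y‖ ≤ (2 ^ (j + 1)) ^ a / (2 ^ i) ^ ((n : ℝ) + a) := by
          unfold pk
          gcongr
          linarith
        refine h1.trans (le_of_eq ?_)
        have hi : (i : ℝ) = j + m := by
          have : i = j + m := by omega
          rw [this]; push_cast; rfl
        rw [hRm, hρ, ez, ez, ez, ← Real.rpow_natCast, ← Real.rpow_natCast, div_eq_mul_inv,
          ← Real.rpow_mul (by norm_num), ← Real.rpow_mul (by norm_num),
          ← Real.rpow_mul (by norm_num), ← Real.rpow_mul (by norm_num),
          ← Real.rpow_neg (by norm_num), ← Real.rpow_neg (by norm_num),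
          ← Real.rpow_add (by norm_num), ← Real.rpow_add (by norm_num),
          ← Real.rpow_add (by norm_num)]
        congr 1
        push_cast
        rw [hi]
        ring
    refine le_trans ?_ (ENNReal.le_tsum m)
    rw [indicator_of_mem (by rwa [Metric.mem_ball, dist_comm, dist_eq_norm]), val]
    exact ENNReal.ofReal_le_ofReal hm2
  calc _ ≤ ∫⁻ y, ∑' m : ℕ, (Metric.ball x (R m)).indicator
        (fun _ => c * ENNReal.ofReal ρ ^ m * (volume (Metric.ball x (R m)))⁻¹) y * f y := by
        refine lintegral_mono fun y => ?_
        rw [ENNReal.tsum_mul_right]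
        exact mul_le_mul_left (pt y) _
    _ = ∑' m : ℕ, ∫⁻ y, (Metric.ball x (R m)).indicator
        (fun _ => c * ENNReal.ofReal ρ ^ m * (volume (Metric.ball x (R m)))⁻¹) y * f y := by
        refine lintegral_tsum fun m => ?_
        exact ((measurable_const.indicator measurableSet_ball).mul hf).aemeasurable
    _ ≤ ∑' m : ℕ, c * ENNReal.ofReal ρ ^ m * maxFun f x := by
        refine ENNReal.tsum_le_tsum fun m => ?_
        have e : ∀ y, (Metric.ball x (R m)).indicator
            (fun _ => c * ENNReal.ofReal ρ ^ m * (volume (Metric.ball x (R m)))⁻¹) y * f y =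
            c * ENNReal.ofReal ρ ^ m * (volume (Metric.ball x (R m)))⁻¹ *
              (Metric.ball x (R m)).indicator f y := by
          intro y
          by_cases hy : y ∈ Metric.ball x (R m)
          · simp [indicator_of_mem hy]
          · simp [indicator_of_notMem hy]
        simp_rw [e]
        rw [lintegral_const_mul _ (hf.indicator measurableSet_ball),
          lintegral_indicator measurableSet_ball, mul_assoc]
        refine mul_le_mul_right ?_ _
        exact le_iSup (fun k : ℤ => (volume (Metric.ball x ((2 : ℝ) ^ k)))⁻¹ *
          ∫⁻ y in Metric.ball x ((2 : ℝ) ^ k), f y) (j + 1 + m)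
    _ = _ := ENNReal.tsum_mul_right

end

/-! ### Integrals over the cone -/

section

variable {n : ℕ}

theorem measurableSet_cone : MeasurableSet (cone n) :=
  measurableSet_lt measurable_fst.norm measurable_snd

theorem isOpen_cone : IsOpen (cone n) :=
  isOpen_lt continuous_fst.norm continuous_snd

theorem pos_of_mem_cone {w : E n × ℝ} (hw : w ∈ cone n) : 0 < w.2 :=
  (norm_nonneg w.1).trans_lt hw

instance : SigmaFinite (coneMeasure n) := by
  unfold coneMeasure
  exact SigmaFinite.withDensity_ofReal _

theorem ae_mem_cone : ∀ᵐ w ∂(coneMeasure n), w ∈ cone n :=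
  (withDensity_absolutelyContinuous _ _).ae_le (ae_restrict_mem measurableSet_cone)

theorem measurable_coneDensity :
    Measurable fun w : E n × ℝ => ENNReal.ofReal (1 / w.2 ^ (n + 1)) := by
  fun_prop

/-- Integrating a function of the height over the cone. -/
theorem lintegral_coneMeasure {F : ℝ → ℝ≥0∞} (hF : Measurable F) :
    ∫⁻ w, F w.2 ∂(coneMeasure n) =
      volume (Metric.ball (0 : E n) 1) * ∫⁻ t in Ioi (0 : ℝ), F t * ENNReal.ofReal (1 / t) := by
  have m1 : Measurable fun w : E n × ℝ => F w.2 := hF.comp measurable_snd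
  rw [coneMeasure, lintegral_withDensity_eq_lintegral_mul _ measurable_coneDensity m1,
    ← lintegral_indicator measurableSet_cone, Measure.volume_eq_prod, lintegral_prod_symm]
  swap
  · exact ((measurable_coneDensity.mul m1).indicator measurableSet_cone).aemeasurable
  have m2 : Measurable fun t => F t * ENNReal.ofReal (1 / t) := hF.mul (by fun_prop)
  rw [← lintegral_indicator measurableSet_Ioi, ← lintegral_const_mul _
    (m2.indicator measurableSet_Ioi)]
  refine lintegral_congr fun t => ?_
  rcases le_or_gt t 0 with ht | ht
  · have : ∀ z : E n, (z, t) ∉ cone n := fun z hz => absurd (pos_of_mem_cone hz) (not_lt.2 ht)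
    simp [indicator_of_notMem (this _), indicator_of_notMem (show t ∉ Ioi (0 : ℝ) from not_lt.2 ht)]
  · have e : ∀ z : E n, (cone n).indicator ((fun w : E n × ℝ =>
        ENNReal.ofReal (1 / w.2 ^ (n + 1))) * fun w => F w.2) (z, t) =
        (Metric.ball (0 : E n) t).indicator
          (fun _ => ENNReal.ofReal (1 / t ^ (n + 1)) * F t) z := by
      intro z
      by_cases hz : ‖z‖ < t <;> simp [indicator, cone, hz]
    simp_rw [e]
    rw [lintegral_indicator measurableSet_ball, setLIntegral_const, volume_ball_eq _ ht,
      indicator_of_mem (show t ∈ Ioi (0 : ℝ) from ht)]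
    have e2 : ENNReal.ofReal (1 / t) = ENNReal.ofReal (1 / t ^ (n + 1)) * ENNReal.ofReal (t ^ n) := by
      rw [← ENNReal.ofReal_mul (by positivity)]
      congr 1
      field_simp
      ring
    rw [e2]; ring

/-- `∫_0^∞ t^(a-1) (r + t)^(-m) dt ≲ r^(a-m)`. -/
theorem lintegral_rpow_div_le {a m r : ℝ} (ha : 0 < a) (ham : a < m) (hr : 0 < r) :
    ∫⁻ t in Ioi (0 : ℝ), ENNReal.ofReal (t ^ (a - 1) / (r + t) ^ m) ≤
      ENNReal.ofReal ((1 / a + 1 / (m - a)) * r ^ (a - m)) := by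
  have hm : 0 < m := ha.trans ham
  rw [← Ioc_union_Ioi_eq_Ioi hr.le, lintegral_union measurableSet_Ioi Ioc_disjoint_Ioi_same, add_mul,
    ENNReal.ofReal_add (by positivity) (by have := sub_pos.2 ham; positivity)]
  refine add_le_add ?_ ?_
  · have ii : IntervalIntegrable (fun t : ℝ => t ^ (a - 1)) volume 0 r :=
      intervalIntegral.intervalIntegrable_rpow' (by linarith)
    calc _ ≤ ∫⁻ t in Ioc (0 : ℝ) r, ENNReal.ofReal (r ^ (-m) * t ^ (a - 1)) := by
          refine setLIntegral_mono' measurableSet_Ioc fun t ht => ENNReal.ofReal_le_ofReal ?_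
          have := ht.1
          rw [Real.rpow_neg hr.le, mul_comm, ← div_eq_mul_inv]
          gcongr; linarith
      _ = ENNReal.ofReal (∫ t in Ioc (0 : ℝ) r, r ^ (-m) * t ^ (a - 1)) := by
          rw [ofReal_integral_eq_lintegral_ofReal]
          · rw [intervalIntegrable_iff_integrableOn_Ioc_of_le hr.le] at ii
            exact ii.const_mul _
          · filter_upwards [ae_restrict_mem measurableSet_Ioc] with t ht
            have := ht.1
            positivity
      _ = _ := by
          congr 1
          rw [← intervalIntegral.integral_of_le hr.le, intervalIntegral.integral_const_mul,
            integral_rpow (Or.inl (by linarith)), sub_add_cancel, Real.zero_rpow ha.ne', sub_zero,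
            mul_div_assoc', ← Real.rpow_add hr]
          rw [neg_add_eq_sub]; ring
  · have ii : IntegrableOn (fun t : ℝ => t ^ (a - 1 - m)) (Ioi r) :=
      integrableOn_Ioi_rpow_of_lt (by linarith) hr
    calc _ ≤ ∫⁻ t in Ioi r, ENNReal.ofReal (t ^ (a - 1 - m)) := by
          refine setLIntegral_mono' measurableSet_Ioi fun t ht => ENNReal.ofReal_le_ofReal ?_
          have ht0 : 0 < t := hr.trans ht
          rw [Real.rpow_sub ht0 (a - 1) m]
          gcongr; linarith
      _ = ENNReal.ofReal (∫ t in Ioi r, t ^ (a - 1 - m)) := by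
          rw [ofReal_integral_eq_lintegral_ofReal ii]
          filter_upwards [ae_restrict_mem measurableSet_Ioi] with t ht
          have : 0 < t := hr.trans ht
          positivity
      _ = _ := by
          congr 1
          rw [integral_Ioi_rpow_of_lt (by linarith) hr]
          have h1 : a - 1 - m + 1 = a - m := by ring
          rw [h1]
          have h2 : a - m ≠ 0 := by linarith
          have h3 : m - a ≠ 0 := by linarith
          field_simp
          ring

/-- The constant in the integral of `sk` over the cone. -/
def coneConst (n : ℕ) (a b : ℝ) : ℝ≥0∞ :=
  volume (Metric.ball (0 : E n) 1) * ENNReal.ofReal (1 / a + 1 / (n + b - a))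

theorem coneConst_ne_top (n : ℕ) (a b : ℝ) : coneConst n a b ≠ ∞ :=
  ENNReal.mul_ne_top (volume_ball_ne_top _) ENNReal.ofReal_ne_top

theorem measurable_sk {Z : Type*} [MeasurableSpace Z] {a b : ℝ} {s t d : Z → ℝ} (hs : Measurable s)
    (ht : Measurable t) (hd : Measurable d) : Measurable fun z => sk n a b (s z) (t z) (d z) := by
  unfold sk
  exact ((hs.mul ht).pow_const _).div (((hs.add ht).add hd).pow_const _)

/-- Integrating out a cone variable: the power `t^a` makes the integral converge at `t = 0`, and
`a < n + b` at `t = ∞`. -/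
theorem lintegral_sk_le {a b s d : ℝ} (ha : 0 < a) (hab : a < n + b) (hs : 0 < s)
    (hd : 0 ≤ d) : ∫⁻ w, ENNReal.ofReal (sk n a b s w.2 d) ∂(coneMeasure n) ≤
      coneConst n a b * ENNReal.ofReal (s ^ a / (s + d) ^ ((n : ℝ) + b - a)) := by
  rw [lintegral_coneMeasure (F := fun t => ENNReal.ofReal (sk n a b s t d))
    (ENNReal.measurable_ofReal.comp (measurable_sk measurable_const measurable_id measurable_const)),
    coneConst, mul_assoc]
  refine mul_le_mul_right ?_ _
  have hr : 0 < s + d := by positivity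
  calc _ = ∫⁻ t in Ioi (0 : ℝ), ENNReal.ofReal (s ^ a) *
        ENNReal.ofReal (t ^ (a - 1) / (s + d + t) ^ ((n : ℝ) + b)) := by
        refine setLIntegral_congr_fun measurableSet_Ioi fun t ht => ?_
        have ht0 : 0 < t := ht
        have hsk := sk_nonneg (n := n) (a := a) (b := b) hs ht0 hd
        rw [← ENNReal.ofReal_mul hsk, ← ENNReal.ofReal_mul (by positivity)]
        congr 1
        unfold sk
        rw [Real.mul_rpow hs.le ht0.le, Real.rpow_sub_one ht0.ne',
          show s + t + d = s + d + t by ring]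
        field_simp
    _ ≤ ENNReal.ofReal (s ^ a) * ENNReal.ofReal
        ((1 / a + 1 / (n + b - a)) * (s + d) ^ (a - (n + b))) := by
        rw [lintegral_const_mul' _ _ ENNReal.ofReal_ne_top]
        exact mul_le_mul_right (lintegral_rpow_div_le ha hab hr) _
    _ = _ := by
        have := sub_pos.2 hab
        rw [← ENNReal.ofReal_mul (by positivity), ← ENNReal.ofReal_mul (by positivity)]
        congr 1
        rw [show a - ((n : ℝ) + b) = -(n + b - a) by ring, Real.rpow_neg hr.le]
        field_simp

/-- The positive kernel which dominates the kernel of `Φ`, extended by zero to heights `≤ 0`. -/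
def coneKernel (n : ℕ) (v v' : E n × (E n × ℝ)) : ℝ≥0∞ :=
  if 0 < v.2.2 ∧ 0 < v'.2.2 then
    ENNReal.ofReal (sk n (1 / 4) (1 / 2) v.2.2 v'.2.2 ‖v.1 - v'.1‖) else 0

theorem measurable_coneKernel : Measurable (Function.uncurry (coneKernel n)) := by
  unfold coneKernel Function.uncurry
  refine Measurable.ite ?_ ?_ measurable_const
  · have h1 : Measurable fun v : (E n × (E n × ℝ)) × (E n × (E n × ℝ)) => v.1.2.2 := by fun_prop
    have h2 : Measurable fun v : (E n × (E n × ℝ)) × (E n × (E n × ℝ)) => v.2.2.2 := by fun_prop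
    exact (measurableSet_lt measurable_const h1).inter (measurableSet_lt measurable_const h2)
  · exact ENNReal.measurable_ofReal.comp (measurable_sk (by fun_prop) (by fun_prop) (by fun_prop))

theorem coneKernel_symm (v v' : E n × (E n × ℝ)) : coneKernel n v v' = coneKernel n v' v := by
  unfold coneKernel sk
  simp only [and_comm, mul_comm v.2.2, add_comm v.2.2, norm_sub_rev v.1]

theorem lintegral_coneKernel_le (v : E n × (E n × ℝ)) (y : E n) :
    ∫⁻ w, coneKernel n v (y, w) ∂(coneMeasure n) ≤
      coneConst n (1 / 4) (1 / 2) *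
        (if 0 < v.2.2 then ENNReal.ofReal (pk n (1 / 4) v.2.2 ‖v.1 - y‖) else 0) := by
  by_cases hs : 0 < v.2.2
  · rw [if_pos hs]
    have hn : (0 : ℝ) ≤ n := by positivity
    have h := lintegral_sk_le (n := n) (a := 1 / 4) (b := 1 / 2) (by norm_num)
      (by linarith) hs (norm_nonneg (v.1 - y))
    have e : (n : ℝ) + 1 / 2 - 1 / 4 = n + 1 / 4 := by ring
    rw [e] at h
    refine le_trans (lintegral_mono fun w => ?_) h
    unfold coneKernel
    split_ifs <;> simp
  · simp [coneKernel, hs]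

theorem isMaximalKernel_coneKernel (hn : 0 < n) :
    IsMaximalKernel (volume : Measure (E n)) (coneMeasure n) (coneKernel n) := by
  have mk : ∀ v, Measurable (coneKernel n v) := fun v =>
    measurable_coneKernel.comp measurable_prodMk_left
  have mpk : ∀ (s : ℝ) (x : E n), 0 < s →
      Measurable fun y : E n => ENNReal.ofReal (pk n (1 / 4) s ‖x - y‖) := fun s x hs =>
    ENNReal.measurable_ofReal.comp ((continuous_pk_norm (by norm_num) hs).measurable.comp
      (measurable_const.sub measurable_id))
  obtain ⟨C, hC, hmax⟩ := exists_lintegral_pk_mul_le_maxFun n (a := 1 / 4) (by norm_num)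
  set c := coneConst n (1 / 4) (1 / 2)
  have hc : c ≠ ∞ := coneConst_ne_top _ _ _
  refine ⟨measurable_coneKernel, coneKernel_symm,
    ⟨c * ENNReal.ofReal (pkMass n (1 / 4)), ENNReal.mul_ne_top hc ENNReal.ofReal_ne_top, ?_⟩,
    fun r hr => ?_⟩
  · intro v
    rw [lintegral_prod _ (mk v).aemeasurable]
    refine (lintegral_mono fun y => lintegral_coneKernel_le v y).trans ?_
    by_cases hs : 0 < v.2.2
    · simp only [if_pos hs]
      rw [lintegral_const_mul _ (mpk _ _ hs), ← ofReal_integral_eq_lintegral_ofReal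
        (integrable_pk_sub (by norm_num) hs _)
        (Filter.Eventually.of_forall fun y => pk_nonneg hs (norm_nonneg _)), integral_pk_sub hs]
    · simp [hs]
  · refine ⟨c * C * (2 * 5 ^ n * ENNReal.ofReal (r / (r - 1)) * 2 ^ (r - 1)) ^ (1 / r), ?_, ?_⟩
    · refine ENNReal.mul_ne_top (ENNReal.mul_ne_top hc hC) ?_
      refine ENNReal.rpow_ne_top_of_nonneg (by positivity) ?_
      refine ENNReal.mul_ne_top (ENNReal.mul_ne_top ?_ ENNReal.ofReal_ne_top) ?_
      · exact ENNReal.mul_ne_top (by simp) (by simp)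
      · exact ENNReal.rpow_ne_top_of_nonneg (by linarith) (by simp)
    intro w hw
    refine ⟨fun x => c * C * maxFun w x, (measurable_maxFun hw).const_mul _, fun v => ?_, ?_⟩
    · rw [lintegral_prod (fun v' => coneKernel n v v' * w v'.1)
        ((mk v).mul (hw.comp measurable_fst)).aemeasurable]
      have e : ∀ y, ∫⁻ z, coneKernel n v (y, z) * w (y, z).1 ∂(coneMeasure n) =
          (∫⁻ z, coneKernel n v (y, z) ∂(coneMeasure n)) * w y := fun y =>
        lintegral_mul_const (w y) (f := fun z => coneKernel n v (y, z))
          ((mk v).comp measurable_prodMk_left)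
      simp_rw [e]
      refine (lintegral_mono fun y => mul_le_mul_left (lintegral_coneKernel_le v y) _).trans ?_
      by_cases hs : 0 < v.2.2
      · simp only [if_pos hs, mul_assoc]
        rw [lintegral_const_mul' _ _ hc]
        exact mul_le_mul_right (hmax w hw _ hs _) _
      · simp [hs]
    · have hr0 : 0 < r := by linarith
      simp_rw [ENNReal.mul_rpow_of_nonneg _ _ hr0.le]
      rw [lintegral_const_mul _ ((measurable_maxFun hw).pow_const r),
        ENNReal.mul_rpow_of_nonneg _ _ (by positivity : 0 ≤ 1 / r), ← ENNReal.mul_rpow_of_nonneg _ _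
        hr0.le, ← ENNReal.rpow_mul, mul_one_div_cancel hr0.ne', ENNReal.rpow_one, mul_assoc (c * C),
        ← ENNReal.mul_rpow_of_nonneg _ _ (by positivity : 0 ≤ 1 / r)]
      refine mul_le_mul_right (ENNReal.rpow_le_rpow ?_ (by positivity)) _
      exact lintegral_maxFun_rpow_le hn hr hw

end

/-! ### Functions with values in a Lebesgue space as functions of two variables -/

section Joint

variable {X Y B : Type*} [MeasurableSpace X] [MeasurableSpace Y] [NormedAddCommGroup B]
  {α : Measure X} {β : Measure Y} {p q : ℝ≥0∞}

/-- `L^q` convergence along a dominated sequence. -/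
theorem tendsto_eLpNorm_sub_of_dominated (hq0 : q ≠ 0) (hq : q ≠ ∞) {f : ℕ → Y → B} {g : Y → B}
    {h : Y → ℝ} (hf : ∀ k, AEStronglyMeasurable (f k) β) (hh : MemLp h q β)
    (hle : ∀ k, ∀ᵐ y ∂β, ‖f k y‖ ≤ h y)
    (hlim : ∀ᵐ y ∂β, Filter.Tendsto (fun k => f k y) Filter.atTop (nhds (g y))) :
    Filter.Tendsto (fun k => eLpNorm (f k - g) q β) Filter.atTop (nhds 0) := by
  have hqpos : 0 < q.toReal := ENNReal.toReal_pos hq0 hq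
  have hg : AEStronglyMeasurable g β := aestronglyMeasurable_of_tendsto_ae _ hf hlim
  have hgle : ∀ᵐ y ∂β, ‖g y‖ ≤ h y := by
    filter_upwards [hlim, ae_all_iff.2 hle] with y h1 h2
    exact le_of_tendsto' h1.norm h2
  simp_rw [eLpNorm_eq_lintegral_rpow_enorm_toReal hq0 hq]
  have key : Filter.Tendsto (fun k => ∫⁻ y, ‖(f k - g) y‖ₑ ^ q.toReal ∂β) Filter.atTop
      (nhds (∫⁻ _, 0 ∂β)) := by
    refine tendsto_lintegral_of_dominated_convergence' (fun y => (2 * ‖h y‖ₑ) ^ q.toReal)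
      (fun k => (((hf k).sub hg).enorm.pow_const _)) (fun k => ?_) ?_ ?_
    · filter_upwards [hle k, hgle] with y h1 h2
      refine ENNReal.rpow_le_rpow ?_ hqpos.le
      have h0 : 0 ≤ h y := (norm_nonneg _).trans h2
      have : ‖f k y - g y‖ ≤ 2 * h y := (norm_sub_le _ _).trans (by linarith)
      calc ‖f k y - g y‖ₑ = ENNReal.ofReal ‖f k y - g y‖ := (ofReal_norm _).symm
        _ ≤ ENNReal.ofReal (2 * h y) := ENNReal.ofReal_le_ofReal this
        _ = 2 * ‖h y‖ₑ := by
          rw [ENNReal.ofReal_mul (by norm_num), Real.enorm_of_nonneg h0]; simp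
    · simp_rw [ENNReal.mul_rpow_of_nonneg _ _ hqpos.le]
      rw [lintegral_const_mul' _ _ (ENNReal.rpow_ne_top_of_nonneg hqpos.le (by simp))]
      exact ENNReal.mul_ne_top (ENNReal.rpow_ne_top_of_nonneg hqpos.le (by simp))
        (lintegral_rpow_enorm_lt_top_of_eLpNorm_lt_top hq0 hq hh.eLpNorm_lt_top).ne
    · filter_upwards [hlim] with y hy
      have h1 : Filter.Tendsto (fun k => f k y - g y) Filter.atTop (nhds 0) := by
        simpa using hy.sub_const (g y)
      have h2 := ((ENNReal.continuous_rpow_const (y := q.toReal)).tendsto _).comp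
        (h1.enorm)
      simpa [hqpos, Function.comp_def] using h2
  have h3 := ((ENNReal.continuous_rpow_const (y := 1 / q.toReal)).tendsto _).comp key
  simpa [hqpos, Function.comp_def] using h3

variable [Fact (1 ≤ q)]

/-- `G` is, as a function of `x` with values in `L^q(β; B)`, strongly measurable. -/
def IsLpMeasurable (β : Measure Y) (q : ℝ≥0∞) [Fact (1 ≤ q)] (G : X × Y → B) : Prop :=
  ∃ Φ : X → Lp B q β, StronglyMeasurable Φ ∧ ∀ x, Φ x =ᵐ[β] fun y => G (x, y)

namespace IsLpMeasurable

theorem zero : IsLpMeasurable β q (0 : X × Y → B) :=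
  ⟨0, stronglyMeasurable_zero, fun _ => Lp.coeFn_zero B q β⟩

theorem add {G H : X × Y → B} (hG : IsLpMeasurable β q G) (hH : IsLpMeasurable β q H) :
    IsLpMeasurable β q (G + H) := by
  obtain ⟨Φ, h1, h2⟩ := hG
  obtain ⟨Ψ, h3, h4⟩ := hH
  refine ⟨Φ + Ψ, h1.add h3, fun x => ?_⟩
  filter_upwards [Lp.coeFn_add (Φ x) (Ψ x), h2 x, h4 x] with y e1 e2 e3
  change (Φ x + Ψ x : Lp B q β) y = _
  rw [e1, Pi.add_apply, e2, e3]
  rfl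

theorem sum {ι : Type*} (s : Finset ι) {G : ι → X × Y → B}
    (hG : ∀ i ∈ s, IsLpMeasurable β q (G i)) : IsLpMeasurable β q (∑ i ∈ s, G i) := by
  classical
  induction s using Finset.induction_on with
  | empty => simpa using zero
  | insert i s hi ih =>
    rw [Finset.sum_insert hi]
    exact (hG i (Finset.mem_insert_self _ _)).add
      (ih fun j hj => hG j (Finset.mem_insert_of_mem hj))

/-- Closure under dominated pointwise limits, by dominated convergence in `L^q`. -/
theorem of_tendsto (hq : q ≠ ∞) {f : ℕ → X × Y → B} {G : X × Y → B} {H : X × Y → ℝ}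
    (hf : ∀ k, IsLpMeasurable β q (f k)) (hH : ∀ x, MemLp (fun y => H (x, y)) q β)
    (hle : ∀ k v, ‖f k v‖ ≤ H v)
    (hlim : ∀ v, Filter.Tendsto (fun k => f k v) Filter.atTop (nhds (G v))) :
    IsLpMeasurable β q G := by
  choose Φ h1 h2 using hf
  have hq0 : q ≠ 0 := (zero_lt_one.trans_le Fact.out).ne'
  have sm : ∀ k x, AEStronglyMeasurable (fun y => f k (x, y)) β := fun k x =>
    (Lp.aestronglyMeasurable (Φ k x)).congr (h2 k x)
  have smG : ∀ x, AEStronglyMeasurable (fun y => G (x, y)) β := fun x =>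
    aestronglyMeasurable_of_tendsto_ae _ (fun k => sm k x)
      (Filter.Eventually.of_forall fun y => hlim (x, y))
  have memG : ∀ x, MemLp (fun y => G (x, y)) q β := fun x =>
    (hH x).mono' (smG x) (Filter.Eventually.of_forall fun y =>
      le_of_tendsto' (hlim (x, y)).norm fun k => hle k (x, y))
  refine ⟨fun x => (memG x).toLp, ?_, fun x => (memG x).coeFn_toLp⟩
  refine stronglyMeasurable_of_tendsto Filter.atTop h1 (tendsto_pi_nhds.2 fun x => ?_)
  rw [Lp.tendsto_Lp_iff_tendsto_eLpNorm]
  refine (tendsto_eLpNorm_sub_of_dominated hq0 hq (fun k => sm k x) (hH x)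
    (fun k => Filter.Eventually.of_forall fun y => hle k (x, y))
    (Filter.Eventually.of_forall fun y => hlim (x, y))).congr fun k => ?_
  refine eLpNorm_congr_ae ?_
  filter_upwards [h2 k x] with y hy
  simp [hy]

theorem indicator (hq : q ≠ ∞) {T : Set Y} (hT : MeasurableSet T) (hT' : β T ≠ ∞) (b : B)
    {D : Set (X × Y)} (hD : MeasurableSet D) :
    IsLpMeasurable β q ((D ∩ Prod.snd ⁻¹' T).indicator fun _ => b) := by
  have mem : MemLp (T.indicator fun _ => ‖b‖) q β := memLp_indicator_const q hT _ (Or.inr hT')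
  induction D, hD using MeasurableSpace.induction_on_inter generateFrom_prod.symm isPiSystem_prod with
  | empty =>
    rw [empty_inter, indicator_empty]
    exact zero
  | basic D hD =>
    obtain ⟨A, hA, C, hC, rfl⟩ := hD
    have hfin : β (C ∩ T) ≠ ∞ := ne_top_of_le_ne_top hT' (measure_mono inter_subset_right)
    refine ⟨A.indicator fun _ => indicatorConstLp q (hC.inter hT) hfin b,
      stronglyMeasurable_const.indicator hA, fun x => ?_⟩
    by_cases hx : x ∈ A
    · rw [indicator_of_mem hx]
      filter_upwards [indicatorConstLp_coeFn (p := q) (hs := hC.inter hT) (hμs := hfin) (c := b)]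
        with y hy
      rw [hy]
      by_cases hy' : y ∈ C ∩ T
      · rw [indicator_of_mem hy', indicator_of_mem (by exact ⟨⟨hx, hy'.1⟩, hy'.2⟩)]
      · rw [indicator_of_notMem hy', indicator_of_notMem fun h => hy' ⟨h.1.2, h.2⟩]
    · rw [indicator_of_notMem hx]
      filter_upwards [Lp.coeFn_zero B q β] with y hy
      rw [hy, indicator_of_notMem fun h => hx h.1.1]
      rfl
  | compl D hD ih =>
    obtain ⟨Φ, h1, h2⟩ := ih
    refine ⟨fun x => indicatorConstLp q hT hT' b - Φ x, stronglyMeasurable_const.sub h1,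
      fun x => ?_⟩
    filter_upwards [indicatorConstLp_coeFn (p := q) (hs := hT) (hμs := hT') (c := b), h2 x,
      Lp.coeFn_sub (indicatorConstLp q hT hT' b) (Φ x)] with y e1 e2 e3
    rw [e3, Pi.sub_apply, e1, e2]
    by_cases hy : y ∈ T <;> by_cases hxy : (x, y) ∈ D <;> simp [Set.indicator, hy, hxy]
  | iUnion D hdisj hD ih =>
    refine of_tendsto hq (f := fun k => ∑ i ∈ Finset.range k,
      (D i ∩ Prod.snd ⁻¹' T).indicator fun _ => b) (H := fun v => T.indicator (fun _ => ‖b‖) v.2)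
      (fun k => sum _ fun i _ => ih i) (fun x => mem) ?_ ?_
    all_goals
      have key : ∀ k v, (∑ i ∈ Finset.range k, (D i ∩ Prod.snd ⁻¹' T).indicator (fun _ => b)) v =
          ((⋃ i ∈ Finset.range k, D i) ∩ Prod.snd ⁻¹' T).indicator (fun _ => b) v := by
        intro k v
        rw [iUnion₂_inter, Finset.sum_apply, ← Finset.indicator_biUnion_apply]
        intro i _ j _ hij
        exact (hdisj hij).mono inter_subset_left inter_subset_left
    · intro k v
      rw [key]
      by_cases hv : v.2 ∈ T
      · rw [indicator_of_mem hv]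
        exact norm_indicator_le_norm_self _ _
      · rw [indicator_of_notMem (fun h => hv h.2)]
        simp [Set.indicator, hv]
    · intro v
      simp_rw [key]
      by_cases hv : v ∈ (⋃ i, D i) ∩ Prod.snd ⁻¹' T
      · obtain ⟨i, hi⟩ := mem_iUnion.1 hv.1
        rw [indicator_of_mem hv]
        refine tendsto_const_nhds.congr' ?_
        filter_upwards [Filter.eventually_gt_atTop i] with k hk
        rw [indicator_of_mem]
        exact ⟨mem_biUnion (Finset.mem_range.2 hk) hi, hv.2⟩
      · rw [indicator_of_notMem hv]
        refine tendsto_const_nhds.congr fun k => ?_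
        rw [indicator_of_notMem]
        rintro ⟨h1, h2⟩
        obtain ⟨i, _, hi⟩ := mem_iUnion₂.1 h1
        exact hv ⟨mem_iUnion.2 ⟨i, hi⟩, h2⟩

/-- A jointly strongly measurable function with all sections in `L^q` is strongly measurable as an
`L^q`-valued function. -/
theorem of_stronglyMeasurable [SigmaFinite β] (hq : q ≠ ∞) {G : X × Y → B}
    (hG : StronglyMeasurable G) (hmem : ∀ x, MemLp (fun y => G (x, y)) q β) :
    IsLpMeasurable β q G := by
  classical
  set T := spanningSets β
  have hT : ∀ k, MeasurableSet (T k) := measurableSet_spanningSets β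
  set S : ℕ → Set (X × Y) := fun k => {v | ‖hG.approx k v‖ ≤ 2 * ‖G v‖} with hS
  have mS : ∀ k, MeasurableSet (S k) := fun k =>
    measurableSet_le ((hG.approx k).stronglyMeasurable.norm.measurable)
      (hG.norm.measurable.const_mul 2)
  set f : ℕ → X × Y → B := fun k => (S k ∩ Prod.snd ⁻¹' T k).indicator (hG.approx k) with hf
  have ef : ∀ k, f k = ∑ b ∈ (hG.approx k).range,
      (((hG.approx k ⁻¹' {b}) ∩ S k) ∩ Prod.snd ⁻¹' T k).indicator fun _ => b := by
    intro k
    funext v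
    rw [Finset.sum_apply]
    by_cases hv : v ∈ S k ∩ Prod.snd ⁻¹' T k
    · simp only [hf]
      rw [indicator_of_mem hv, Finset.sum_eq_single (hG.approx k v)]
      · rw [indicator_of_mem]
        exact ⟨⟨rfl, hv.1⟩, hv.2⟩
      · intro b _ hb
        rw [indicator_of_notMem]
        rintro ⟨⟨h1, _⟩, _⟩
        exact hb h1.symm
      · intro h
        exact absurd (SimpleFunc.mem_range_self _ v) h
    · simp only [hf]
      rw [indicator_of_notMem hv]
      refine (Finset.sum_eq_zero fun b _ => ?_).symm
      rw [indicator_of_notMem]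
      rintro ⟨⟨_, h1⟩, h2⟩
      exact hv ⟨h1, h2⟩
  refine of_tendsto hq (f := f) (H := fun v => 2 * ‖G v‖) (fun k => ?_)
    (fun x => (hmem x).norm.const_mul 2) ?_ ?_
  · rw [ef]
    exact sum _ fun b _ => indicator hq (hT k) (measure_spanningSets_lt_top β k).ne b
      (((hG.approx k).measurableSet_preimage {b}).inter (mS k))
  · intro k v
    by_cases hv : v ∈ S k ∩ Prod.snd ⁻¹' T k
    · simp only [hf]
      rw [indicator_of_mem hv]; exact hv.1
    · simp only [hf]
      rw [indicator_of_notMem hv, norm_zero]; positivity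
  · intro v
    have h1 := hG.tendsto_approx v
    obtain ⟨j, hj⟩ := mem_iUnion.1 ((iUnion_spanningSets β).symm ▸ mem_univ v.2)
    have hT' : ∀ᶠ k in Filter.atTop, v.2 ∈ T k := by
      filter_upwards [Filter.eventually_ge_atTop j] with k hk using monotone_spanningSets β hk hj
    rcases eq_or_ne (G v) 0 with h0 | h0
    · rw [h0]
      refine tendsto_const_nhds.congr fun k => ?_
      by_cases hv : v ∈ S k ∩ Prod.snd ⁻¹' T k
      · have : ‖hG.approx k v‖ ≤ 2 * ‖G v‖ := hv.1
        rw [h0, norm_zero, mul_zero, norm_le_zero_iff] at this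
        simp only [hf]
        rw [indicator_of_mem hv, this]
      · simp only [hf]
        rw [indicator_of_notMem hv]
    · have hS' : ∀ᶠ k in Filter.atTop, v ∈ S k := by
        have : ‖G v‖ < 2 * ‖G v‖ := by linarith [norm_pos_iff.2 h0]
        filter_upwards [h1.norm.eventually (gt_mem_nhds this)] with k hk using le_of_lt hk
      refine h1.congr' ?_
      filter_upwards [hT', hS'] with k h2 h3
      simp only [hf]
      rw [indicator_of_mem (show v ∈ S k ∩ Prod.snd ⁻¹' T k from ⟨h3, h2⟩)]

end IsLpMeasurable

theorem enorm_Lp_eq (hq : q ≠ ∞) (f : Lp B q β) :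
    ‖f‖ₑ = (∫⁻ y, ‖f y‖ₑ ^ q.toReal ∂β) ^ (1 / q.toReal) := by
  rw [Lp.enorm_def, eLpNorm_eq_lintegral_rpow_enorm_toReal (zero_lt_one.trans_le Fact.out).ne' hq]

/-- The norm of `L^p(α; L^q(β; B))` is the mixed norm. -/
theorem enorm_LpLp_eq [Fact (1 ≤ p)] (hp : p ≠ ∞) (hq : q ≠ ∞) (F : Lp (Lp B q β) p α)
    {G : X × Y → B} (hFG : ∀ᵐ x ∂α, F x =ᵐ[β] fun y => G (x, y)) :
    ‖F‖ₑ = mixedNorm α β p.toReal q.toReal fun v => ‖G v‖ₑ := by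
  rw [enorm_Lp_eq hp, mixedNorm]
  congr 1
  refine lintegral_congr_ae ?_
  filter_upwards [hFG] with x hx
  rw [enorm_Lp_eq hq, ← ENNReal.rpow_mul, one_div_mul_eq_div]
  congr 1
  refine lintegral_congr_ae ?_
  filter_upwards [hx] with y hy
  rw [hy]

/-- A jointly measurable function of finite mixed norm defines an element of
`L^p(α; L^q(β; B))`. -/
theorem exists_LpLp_of_mixedNorm_ne_top [SigmaFinite β] [Fact (1 ≤ p)] (hp : p ≠ ∞) (hq : q ≠ ∞)
    {G : X × Y → B} (hG : StronglyMeasurable G)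
    (hfin : mixedNorm α β p.toReal q.toReal (fun v => ‖G v‖ₑ) ≠ ∞) :
    ∃ F : Lp (Lp B q β) p α, ∀ᵐ x ∂α, F x =ᵐ[β] fun y => G (x, y) := by
  have hp0 : p ≠ 0 := (zero_lt_one.trans_le Fact.out).ne'
  have hq0 : q ≠ 0 := (zero_lt_one.trans_le Fact.out).ne'
  have hpp : 0 < p.toReal := ENNReal.toReal_pos hp0 hp
  have hqq : 0 < q.toReal := ENNReal.toReal_pos hq0 hq
  have mI : Measurable fun x => ∫⁻ y, ‖G (x, y)‖ₑ ^ q.toReal ∂β :=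
    (hG.enorm.pow_const _).lintegral_prod_right'
  have hfin2 : ∫⁻ x, (∫⁻ y, ‖G (x, y)‖ₑ ^ q.toReal ∂β) ^ (p.toReal / q.toReal) ∂α ≠ ∞ := by
    intro h
    apply hfin
    rw [mixedNorm, h, ENNReal.top_rpow_of_pos (by positivity)]
  set S : Set X := {x | ∫⁻ y, ‖G (x, y)‖ₑ ^ q.toReal ∂β < ∞} with hS
  have mS : MeasurableSet S := measurableSet_lt mI measurable_const
  have hSae : ∀ᵐ x ∂α, x ∈ S := by
    filter_upwards [ae_lt_top (mI.pow_const _) hfin2] with x hx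
    by_contra hcon
    have : ∫⁻ y, ‖G (x, y)‖ₑ ^ q.toReal ∂β = ∞ := not_lt_top_iff.1 hcon
    rw [this, ENNReal.top_rpow_of_pos (by positivity)] at hx
    exact lt_irrefl _ hx
  obtain ⟨Φ, h1, h2⟩ := IsLpMeasurable.of_stronglyMeasurable (β := β) hq
    (hG.indicator (mS.prod MeasurableSet.univ)) (fun x => by
      by_cases hx : x ∈ S
      · have e : (fun y => (S ×ˢ univ).indicator G (x, y)) = fun y => G (x, y) := by
          funext y
          rw [indicator_of_mem (show (x, y) ∈ S ×ˢ (univ : Set Y) from ⟨hx, mem_univ _⟩)]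
        rw [e]
        refine ⟨(hG.comp_measurable measurable_prodMk_left).aestronglyMeasurable, ?_⟩
        rw [eLpNorm_eq_lintegral_rpow_enorm_toReal hq0 hq]
        exact ENNReal.rpow_lt_top_of_nonneg (by positivity) (ne_of_lt hx)
      · have e : (fun y => (S ×ˢ univ).indicator G (x, y)) = 0 := by
          funext y
          rw [indicator_of_notMem (fun h => hx h.1)]; rfl
        rw [e]
        exact MemLp.zero)
  have h3 : ∀ᵐ x ∂α, Φ x =ᵐ[β] fun y => G (x, y) := by
    filter_upwards [hSae] with x hx
    filter_upwards [h2 x] with y hy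
    rw [hy, indicator_of_mem (show (x, y) ∈ S ×ˢ (univ : Set Y) from ⟨hx, mem_univ _⟩)]
  have memΦ : MemLp Φ p α := by
    refine ⟨h1.aestronglyMeasurable, ?_⟩
    rw [eLpNorm_eq_lintegral_rpow_enorm_toReal hp0 hp]
    refine ENNReal.rpow_lt_top_of_nonneg (by positivity) (ne_top_of_le_ne_top hfin2 (le_of_eq ?_))
    refine lintegral_congr_ae ?_
    filter_upwards [h3] with x hx
    rw [enorm_Lp_eq hq, ← ENNReal.rpow_mul, one_div_mul_eq_div]
    congr 1
    refine lintegral_congr_ae ?_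
    filter_upwards [hx] with y hy
    rw [hy]
  refine ⟨memΦ.toLp, ?_⟩
  filter_upwards [memΦ.coeFn_toLp, h3] with x e1 e2
  rw [e1]
  exact e2

end Joint

section Joint

variable {X Y B : Type*} [MeasurableSpace X] [MeasurableSpace Y] [NormedAddCommGroup B]
  {β : Measure Y} {q : ℝ≥0∞}

theorem stronglyMeasurable_simpleFunc_Lp (s : SimpleFunc X (Lp B q β)) :
    StronglyMeasurable fun v : X × Y => s v.1 v.2 := by
  classical
  have e : (fun v : X × Y => s v.1 v.2) = fun v => ∑ b ∈ s.range,
      (Prod.fst ⁻¹' (s ⁻¹' {b})).indicator (fun v : X × Y => b v.2) v := by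
    funext v
    rw [Finset.sum_eq_single (s v.1)]
    · rw [indicator_of_mem (by simp)]
    · intro b _ hb
      rw [indicator_of_notMem]
      exact fun h => hb h.symm
    · exact fun h => absurd (SimpleFunc.mem_range_self _ _) h
  rw [e]
  exact Finset.stronglyMeasurable_fun_sum _ fun b _ =>
    ((Lp.stronglyMeasurable b).comp_measurable measurable_snd).indicator
      (measurable_fst (s.measurableSet_preimage {b}))

/-- Gluing along a measurable choice of an index. -/
theorem stronglyMeasurable_glue {f : ℕ → X × Y → B} (hf : ∀ k, StronglyMeasurable (f k))
    {N : X → ℕ} (hN : Measurable N) : StronglyMeasurable fun v : X × Y => f (N v.1) v := by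
  refine stronglyMeasurable_of_tendsto Filter.atTop (f := fun M v => ∑ m ∈ Finset.range M,
      (Prod.fst ⁻¹' (N ⁻¹' {m})).indicator (f m) v) (fun M => ?_) (tendsto_pi_nhds.2 fun v => ?_)
  · exact Finset.stronglyMeasurable_fun_sum _ fun m _ =>
      (hf m).indicator (measurable_fst (hN (measurableSet_singleton m)))
  · refine tendsto_const_nhds.congr' ?_
    filter_upwards [Filter.eventually_gt_atTop (N v.1)] with M hM
    rw [Finset.sum_eq_single (N v.1)]
    · rw [indicator_of_mem (by simp)]
    · intro b _ hb
      rw [indicator_of_notMem]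
      exact fun h => hb h.symm
    · exact fun h => absurd (Finset.mem_range.2 hM) h

/-- An `L^q`-valued strongly measurable function is given by a jointly strongly measurable function
of two variables: the representatives of a sequence of functions with countably many values that
converges fast enough converge almost everywhere in the second variable. -/
theorem exists_stronglyMeasurable_rep [Fact (1 ≤ q)] [CompleteSpace B] {f : X → Lp B q β}
    (hf : StronglyMeasurable f) :
    ∃ F : X × Y → B, StronglyMeasurable F ∧ ∀ x, f x =ᵐ[β] fun y => F (x, y) := by
  classical
  have hq1 : 1 ≤ q := Fact.out
  have hq0 : q ≠ 0 := (zero_lt_one.trans_le hq1).ne'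
  set ε : ℕ → ℝ≥0∞ := fun j => (2⁻¹ : ℝ≥0∞) ^ j with hε
  have εpos : ∀ j, 0 < ε j := fun j => ENNReal.pow_pos (by simp) j
  have ex : ∀ j x, ∃ m, edist (hf.approx m x) (f x) < ε j := fun j x =>
    ((tendsto_iff_edist_tendsto_0.1 (hf.tendsto_approx x)).eventually (gt_mem_nhds (εpos j))).exists
  set N : ℕ → X → ℕ := fun j x => Nat.find (ex j x) with hN
  have mN : ∀ j, Measurable (N j) := fun j => measurable_find (ex j) fun k =>
    ((hf.approx k).stronglyMeasurable.edist hf).measurableSet_lt stronglyMeasurable_const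
  set F' : ℕ → X × Y → B := fun j v => hf.approx (N j v.1) v.1 v.2 with hF'
  have mF' : ∀ j, StronglyMeasurable (F' j) := fun j =>
    stronglyMeasurable_glue (fun k => stronglyMeasurable_simpleFunc_Lp (hf.approx k)) (mN j)
  refine ⟨fun v => Filter.atTop.limUnder fun j => F' j v, StronglyMeasurable.limUnder mF',
    fun x => ?_⟩
  have dist : ∀ j, edist (hf.approx (N j x) x) (f x) < ε j := fun j => Nat.find_spec (ex j x)
  have sm : ∀ j, AEStronglyMeasurable (fun y => F' j (x, y)) β := fun j =>
    Lp.aestronglyMeasurable (hf.approx (N j x) x)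
  have hsum : ∑' j, (2 * ε j) ≠ ∞ := by
    rw [ENNReal.tsum_mul_left, ENNReal.tsum_geometric]
    exact ENNReal.mul_ne_top (by simp) (by simp)
  have hcau : ∀ M j k, M ≤ j → M ≤ k →
      eLpNorm ((fun y => F' j (x, y)) - fun y => F' k (x, y)) q β < 2 * ε M := by
    intro M j k hj hk
    have anti : ∀ {j}, M ≤ j → ε j ≤ ε M := fun h => pow_le_pow_right_of_le_one' (by simp) h
    have : edist (hf.approx (N j x) x) (hf.approx (N k x) x) < 2 * ε M := by
      refine (edist_triangle_right _ _ (f x)).trans_lt ?_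
      rw [two_mul]
      exact ENNReal.add_lt_add ((dist j).trans_le (anti hj)) ((dist k).trans_le (anti hk))
    rwa [Lp.edist_def] at this
  have hlim := Lp.ae_tendsto_of_cauchy_eLpNorm sm hq1 hsum hcau
  have hlim' : ∀ᵐ y ∂β, Filter.Tendsto (fun j => F' j (x, y)) Filter.atTop
      (nhds (Filter.atTop.limUnder fun j => F' j (x, y))) := by
    filter_upwards [hlim] with y hy using tendsto_nhds_limUnder hy
  have smF : AEStronglyMeasurable (fun y => Filter.atTop.limUnder fun j => F' j (x, y)) β :=
    aestronglyMeasurable_of_tendsto_ae _ sm hlim'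
  have c1 := tendstoInMeasure_of_tendsto_eLpNorm hq0 sm smF
    (Lp.cauchy_tendsto_of_tendsto sm _ hsum hcau hlim')
  have c2 : TendstoInMeasure β (fun j y => F' j (x, y)) Filter.atTop (f x) := by
    refine tendstoInMeasure_of_tendsto_eLpNorm hq0 sm (Lp.aestronglyMeasurable _) ?_
    have hε0 : Filter.Tendsto ε Filter.atTop (nhds 0) :=
      ENNReal.tendsto_pow_atTop_nhds_zero_of_lt_one (by simp)
    refine tendsto_of_tendsto_of_tendsto_of_le_of_le tendsto_const_nhds hε0
      (fun _ => zero_le) fun j => ?_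
    have := (dist j).le
    rwa [Lp.edist_def] at this
  exact tendstoInMeasure_ae_unique c2 c1

theorem exists_stronglyMeasurable_rep_ae [Fact (1 ≤ q)] {α : Measure X} [CompleteSpace B] {f : X → Lp B q β}
    (hf : AEStronglyMeasurable f α) :
    ∃ F : X × Y → B, StronglyMeasurable F ∧ ∀ᵐ x ∂α, f x =ᵐ[β] fun y => F (x, y) := by
  obtain ⟨F, h1, h2⟩ := exists_stronglyMeasurable_rep hf.stronglyMeasurable_mk
  refine ⟨F, h1, ?_⟩
  filter_upwards [hf.ae_eq_mk] with x hx
  rw [hx]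
  exact h2 x

end Joint

/-! ### The integral operator with kernel `φ_s * φ_t` -/

/-- The estimates for the kernels `φ_s * φ_t` on which the bounds for `Φ` rest. -/
structure IsKernBounded {n : ℕ} (φ : ℝ → E n → ℝ) (K : ℝ) : Prop where
  nonneg : 0 ≤ K
  continuousAt : ∀ s t, 0 < s → 0 < t → ∀ x : E n,
    ContinuousAt (fun v : ℝ × ℝ × E n => kern φ v.1 v.2.1 v.2.2) (s, t, x)
  abs_le : ∀ s t, 0 < s → 0 < t → ∀ x, |kern φ s t x| ≤ K * sk n (1 / 4) (1 / 2) s t ‖x‖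
  abs_sub_le : ∀ s t, 0 < s → 0 < t → ∀ x x' D, 0 ≤ D → D ≤ ‖x‖ → D ≤ ‖x'‖ →
    |kern φ s t x - kern φ s t x'| ≤
      K * (‖x - x'‖ ^ (1 / 2 : ℝ) * sk n (1 / 8) (3 / 4) s t D)

theorem exists_isKernBounded (n : ℕ) : ∃ K : ℝ, ∀ φ : ℝ → E n → ℝ,
    (φ = phiTime n ∨ ∃ i, φ = phiSpace n i) → IsKernBounded φ K := by
  obtain ⟨C, hC⟩ := exists_isPoissonType n
  obtain ⟨K, hK, h1⟩ := IsPoissonType.exists_abs_kern_le n C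
  obtain ⟨L, hL, h2⟩ := IsPoissonType.exists_abs_kern_sub_le n C
  refine ⟨max K L, fun φ hφ => ⟨hK.trans (le_max_left _ _), fun s t hs ht x =>
    (hC φ hφ).continuousAt_kern hs ht x, fun s t hs ht x => ?_,
    fun s t hs ht x x' D hD hx hx' => ?_⟩⟩
  · exact (h1 φ (hC φ hφ) s t hs ht x).trans
      (mul_le_mul_of_nonneg_right (le_max_left _ _) (sk_nonneg hs ht (norm_nonneg _)))
  · exact (h2 φ (hC φ hφ) s t hs ht x x' D hD hx hx').trans
      (mul_le_mul_of_nonneg_right (le_max_right _ _)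
        (mul_nonneg (by positivity) (sk_nonneg hs ht hD)))

theorem sk_le_of_le_mul {n : ℕ} {a b s t d d' c : ℝ} (hb : 0 ≤ b) (hs : 0 < s) (ht : 0 < t)
    (hd : 0 ≤ d) (hd' : 0 ≤ d') (hc : 0 ≤ c) (h : s + t + d' ≤ c * (s + t + d)) :
    sk n a b s t d ≤ c ^ ((n : ℝ) + b) * sk n a b s t d' := by
  unfold sk
  rw [mul_div_assoc', div_le_div_iff₀ (by positivity) (by positivity)]
  calc (s * t) ^ a * (s + t + d') ^ ((n : ℝ) + b)
      ≤ (s * t) ^ a * (c * (s + t + d)) ^ ((n : ℝ) + b) := by gcongr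
    _ = _ := by rw [Real.mul_rpow hc (by positivity)]; ring

theorem sk_le_pk {n : ℕ} {s t d : ℝ} (hs : 0 < s) (ht : 0 < t) (hd : 0 ≤ d) :
    sk n (1 / 4) (1 / 2) s t d ≤ pk n (1 / 4) s d := by
  unfold sk pk
  rw [Real.mul_rpow hs.le ht.le, div_le_div_iff₀ (by positivity) (by positivity)]
  have e : (s + t + d) ^ ((n : ℝ) + 1 / 2) =
      (s + t + d) ^ (1 / 4 : ℝ) * (s + t + d) ^ ((n : ℝ) + 1 / 4) := by
    rw [← Real.rpow_add (by positivity)]; ring_nf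
  rw [e, mul_assoc]
  gcongr
  · linarith
  · linarith

section

variable {n : ℕ}

/-- The kernel of `Φ` in all variables, extended by zero to heights `≤ 0`. -/
def opKernel (φ : ℝ → E n → ℝ) (v v' : E n × (E n × ℝ)) : ℝ :=
  if 0 < v.2.2 ∧ 0 < v'.2.2 then kern φ v.2.2 v'.2.2 (v.1 + v.2.1 + v'.2.1 - v'.1) else 0

namespace IsKernBounded

variable {φ : ℝ → E n → ℝ} {K : ℝ}

theorem measurable_opKernel (h : IsKernBounded φ K) :
    Measurable (Function.uncurry (opKernel φ)) := by
  classical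
  set S : Set ((E n × (E n × ℝ)) × (E n × (E n × ℝ))) := {z | 0 < z.1.2.2 ∧ 0 < z.2.2.2} with hS
  have h1 : Continuous fun z : (E n × (E n × ℝ)) × (E n × (E n × ℝ)) => z.1.2.2 := by fun_prop
  have h2 : Continuous fun z : (E n × (E n × ℝ)) × (E n × (E n × ℝ)) => z.2.2.2 := by fun_prop
  have oS : IsOpen S := (isOpen_lt continuous_const h1).inter (isOpen_lt continuous_const h2)
  have e : Function.uncurry (opKernel φ) = S.piecewise (fun z => kern φ z.1.2.2 z.2.2.2
      (z.1.1 + z.1.2.1 + z.2.2.1 - z.2.1)) (fun _ => 0) := by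
    funext z
    by_cases hz : z ∈ S
    · rw [piecewise_eq_of_mem _ _ _ hz]
      exact if_pos hz
    · rw [piecewise_eq_of_notMem _ _ _ hz]
      exact if_neg hz
  rw [e]
  refine ContinuousOn.measurable_piecewise (fun z hz => ContinuousAt.continuousWithinAt ?_)
    continuousOn_const oS.measurableSet
  have c : Continuous fun z : (E n × (E n × ℝ)) × (E n × (E n × ℝ)) =>
      ((z.1.2.2, z.2.2.2, z.1.1 + z.1.2.1 + z.2.2.1 - z.2.1) : ℝ × ℝ × E n) := by fun_prop
  exact ContinuousAt.comp (f := fun z : (E n × (E n × ℝ)) × (E n × (E n × ℝ)) =>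
    ((z.1.2.2, z.2.2.2, z.1.1 + z.1.2.1 + z.2.2.1 - z.2.1) : ℝ × ℝ × E n))
    (h.continuousAt _ _ hz.1 hz.2 _) c.continuousAt

/-- The cone condition: `‖u‖ ≤ s` and `‖z‖ ≤ t` allow replacing `x + u + z - y` by `x - y`, since this
changes `s + t + ‖·‖` by a factor of at most `2`. -/
theorem enorm_opKernel_le (h : IsKernBounded φ K) {v v' : E n × (E n × ℝ)}
    (hv : ‖v.2.1‖ ≤ v.2.2) (hv' : ‖v'.2.1‖ ≤ v'.2.2) :
    ‖opKernel φ v v'‖ₑ ≤ ENNReal.ofReal (K * 2 ^ ((n : ℝ) + 1 / 2)) * coneKernel n v v' := by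
  unfold opKernel coneKernel
  split_ifs with hpos
  · have hK := h.nonneg
    rw [← ENNReal.ofReal_mul (by positivity), ← ofReal_norm, Real.norm_eq_abs]
    refine ENNReal.ofReal_le_ofReal ((h.abs_le _ _ hpos.1 hpos.2 _).trans ?_)
    rw [mul_assoc]
    refine mul_le_mul_of_nonneg_left (sk_le_of_le_mul (by norm_num) hpos.1 hpos.2 (norm_nonneg _)
      (norm_nonneg _) (by norm_num) ?_) hK
    have e : v.1 - v'.1 = (v.1 + v.2.1 + v'.2.1 - v'.1) - v.2.1 - v'.2.1 := by abel
    have h1 := norm_sub_le ((v.1 + v.2.1 + v'.2.1 - v'.1) - v.2.1) v'.2.1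
    have h2 := norm_sub_le (v.1 + v.2.1 + v'.2.1 - v'.1) v.2.1
    rw [← e] at h1
    have := norm_nonneg (v.1 + v.2.1 + v'.2.1 - v'.1)
    linarith
  · simp

end IsKernBounded

theorem ae_prod_mem_cone :
    ∀ᵐ v ∂((volume : Measure (E n)).prod (coneMeasure n)), v.2 ∈ cone n :=
  (Measure.ae_prod_iff_ae_ae (measurable_snd measurableSet_cone)).2
    (Filter.Eventually.of_forall fun _ => ae_mem_cone)

/-- Testing `coneKernel` against a function, by its `L^q` norms over the cone. -/
theorem lintegral_coneKernel_mul_le {q q' : ℝ} (hq : q.HolderConjugate q')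
    {H : E n × (E n × ℝ) → ℝ≥0∞} (hH : Measurable H) {v : E n × (E n × ℝ)} (hs : 0 < v.2.2) :
    ∫⁻ v', coneKernel n v v' * H v' ∂((volume : Measure (E n)).prod (coneMeasure n)) ≤
      coneConst n (1 / 4) (1 / 2) ^ (1 / q') *
        ∫⁻ y, ENNReal.ofReal (pk n (1 / 4) v.2.2 ‖v.1 - y‖) *
          (∫⁻ w, H (y, w) ^ q ∂(coneMeasure n)) ^ (1 / q) := by
  have mk : Measurable (coneKernel n v) := measurable_coneKernel.comp measurable_prodMk_left
  have hq' := hq.symm.pos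
  have hq0 := hq.pos
  have hfin : coneConst n (1 / 4) (1 / 2) ^ (1 / q') ≠ ∞ :=
    ENNReal.rpow_ne_top_of_nonneg (by positivity) (coneConst_ne_top _ _ _)
  rw [lintegral_prod (fun v' => coneKernel n v v' * H v') (mk.mul hH).aemeasurable,
    ← lintegral_const_mul' _ _ hfin]
  refine lintegral_mono fun y => ?_
  set r := ENNReal.ofReal (pk n (1 / 4) v.2.2 ‖v.1 - y‖) with hr
  have hle : ∀ w, coneKernel n v (y, w) ≤ r := by
    intro w
    unfold coneKernel
    split_ifs with hpos
    · exact ENNReal.ofReal_le_ofReal (sk_le_pk hpos.1 hpos.2 (norm_nonneg _))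
    · exact zero_le
  have hI := lintegral_coneKernel_le v y
  rw [if_pos hs, ← hr] at hI
  have mH : Measurable fun w => H (y, w) ^ q := (hH.comp measurable_prodMk_left).pow_const q
  calc _ ≤ (∫⁻ w, coneKernel n v (y, w) ∂(coneMeasure n)) ^ (1 / q') *
        (∫⁻ w, coneKernel n v (y, w) * H (y, w) ^ q ∂(coneMeasure n)) ^ (1 / q) :=
        lintegral_weight_mul_le hq (mk.comp measurable_prodMk_left)
          (hH.comp measurable_prodMk_left)
    _ ≤ (coneConst n (1 / 4) (1 / 2) * r) ^ (1 / q') *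
        (r * ∫⁻ w, H (y, w) ^ q ∂(coneMeasure n)) ^ (1 / q) := by
        gcongr
        rw [← lintegral_const_mul _ mH]
        exact lintegral_mono fun w => mul_le_mul_left (hle w) _
    _ = _ := by
        rw [ENNReal.mul_rpow_of_nonneg _ _ (by positivity : 0 ≤ 1 / q'),
          ENNReal.mul_rpow_of_nonneg _ _ (by positivity : 0 ≤ 1 / q)]
        have e : r ^ (1 / q') * r ^ (1 / q) = r := by
          rw [← ENNReal.rpow_add_of_nonneg _ _ (by positivity) (by positivity), add_comm,
            one_div, one_div, hq.inv_add_inv_eq_one, ENNReal.rpow_one]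
        calc _ = coneConst n (1 / 4) (1 / 2) ^ (1 / q') * ((r ^ (1 / q') * r ^ (1 / q)) *
            (∫⁻ w, H (y, w) ^ q ∂(coneMeasure n)) ^ (1 / q)) := by ring
          _ = _ := by rw [e]

theorem pk_le_inv {s d : ℝ} (hs : 0 < s) (hd : 0 ≤ d) :
    pk n (1 / 4) s d ≤ (s ^ n)⁻¹ := by
  refine (pk_anti (by norm_num) hs le_rfl hd).trans (le_of_eq ?_)
  unfold pk
  rw [add_zero, Real.rpow_add hs, Real.rpow_natCast]
  have := Real.rpow_pos_of_pos hs (1 / 4)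
  field_simp

theorem measurable_pk_sub {s : ℝ} (hs : 0 < s) (x : E n) :
    Measurable fun y : E n => ENNReal.ofReal (pk n (1 / 4) s ‖x - y‖) :=
  ENNReal.measurable_ofReal.comp ((continuous_pk_norm (by norm_num) hs).measurable.comp
    (measurable_const.sub measurable_id))

/-- The majorant of the operator is bounded from `L¹` with values in `L^q` to bounded functions, at
fixed heights. -/
theorem lintegral_coneKernel_mul_le_mixedNorm_one {q q' : ℝ} (hq : q.HolderConjugate q')
    {H : E n × (E n × ℝ) → ℝ≥0∞} (hH : Measurable H) {v : E n × (E n × ℝ)} (hs : 0 < v.2.2) :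
    ∫⁻ v', coneKernel n v v' * H v' ∂((volume : Measure (E n)).prod (coneMeasure n)) ≤
      coneConst n (1 / 4) (1 / 2) ^ (1 / q') * ENNReal.ofReal (v.2.2 ^ n)⁻¹ *
        mixedNorm volume (coneMeasure n) 1 q H := by
  refine (lintegral_coneKernel_mul_le hq hH hs).trans ?_
  rw [mul_assoc]
  refine mul_le_mul_right ?_ _
  rw [mixedNorm, div_one, ENNReal.rpow_one, ← lintegral_const_mul' _ _ ENNReal.ofReal_ne_top]
  exact lintegral_mono fun y =>
    mul_le_mul_left (ENNReal.ofReal_le_ofReal (pk_le_inv hs (norm_nonneg _))) _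

/-- Absolute convergence, at every point of positive height, of the integral defining the operator
for an arbitrary function of finite mixed norm. -/
theorem lintegral_coneKernel_mul_lt_top {p q q' : ℝ} (hp : 1 ≤ p) (hq : q.HolderConjugate q')
    {H : E n × (E n × ℝ) → ℝ≥0∞} (hH : Measurable H)
    (hfin : mixedNorm volume (coneMeasure n) p q H ≠ ∞) {v : E n × (E n × ℝ)} (hs : 0 < v.2.2) :
    ∫⁻ v', coneKernel n v v' * H v' ∂((volume : Measure (E n)).prod (coneMeasure n)) < ∞ := by
  have hp0 : 0 < p := by linarith
  have hq0 := hq.pos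
  have hq' := hq.symm.pos
  have hfin2 : ∫⁻ y, (∫⁻ w, H (y, w) ^ q ∂(coneMeasure n)) ^ (p / q) ≠ ∞ := by
    intro h
    apply hfin
    rw [mixedNorm, h, ENNReal.top_rpow_of_pos (by positivity)]
  refine (lintegral_coneKernel_mul_le hq hH hs).trans_lt (ENNReal.mul_lt_top
    (ENNReal.rpow_lt_top_of_nonneg (by positivity) (coneConst_ne_top _ _ _)) ?_)
  have mp := measurable_pk_sub hs v.1
  calc _ ≤ ∫⁻ y, (ENNReal.ofReal (pk n (1 / 4) v.2.2 ‖v.1 - y‖) +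
        ENNReal.ofReal (v.2.2 ^ n)⁻¹ * (∫⁻ w, H (y, w) ^ q ∂(coneMeasure n)) ^ (p / q)) := by
        refine lintegral_mono fun y => ?_
        -- `h ≤ 1 + h ^ p`
        set h := (∫⁻ w, H (y, w) ^ q ∂(coneMeasure n)) ^ (1 / q) with hh
        have e : (∫⁻ w, H (y, w) ^ q ∂(coneMeasure n)) ^ (p / q) = h ^ p := by
          rw [hh, ← ENNReal.rpow_mul, one_div_mul_eq_div]
        have hle : h ≤ 1 + h ^ p := by
          rcases le_total h 1 with h1 | h1
          · exact h1.trans le_self_add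
          · exact (ENNReal.rpow_one h ▸ ENNReal.rpow_le_rpow_of_exponent_le h1 hp).trans
              le_add_self
        calc _ ≤ ENNReal.ofReal (pk n (1 / 4) v.2.2 ‖v.1 - y‖) * (1 + h ^ p) :=
              mul_le_mul_right hle _
          _ ≤ _ := by
              rw [mul_add, mul_one, e]
              refine add_le_add le_rfl (mul_le_mul_left (ENNReal.ofReal_le_ofReal
                (pk_le_inv hs (norm_nonneg _))) _)
    _ < ∞ := by
        rw [lintegral_add_left mp, lintegral_const_mul' _ _ ENNReal.ofReal_ne_top]
        refine ENNReal.add_lt_top.2 ⟨?_, ENNReal.mul_lt_top ENNReal.ofReal_lt_top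
          (lt_top_iff_ne_top.2 hfin2)⟩
        exact ((integrable_pk_sub (by norm_num) hs v.1).lintegral_lt_top)

end

section

variable {n : ℕ} {B : Type*} [NormedAddCommGroup B]

/-- `F` is jointly strongly measurable and represents the `A`-valued function `f` as a function of
three variables. -/
structure IsRep {q : ℝ≥0∞} (f : E n → A n q B) (F : E n × (E n × ℝ) → B) : Prop where
  stronglyMeasurable : StronglyMeasurable F
  ae_eq : ∀ᵐ x, f x =ᵐ[coneMeasure n] fun w => F (x, w)

namespace IsRep

variable {q : ℝ≥0∞} {f f' : E n → A n q B} {F F' : E n × (E n × ℝ) → B}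

theorem prod_ae_eq (h : IsRep f F) (h' : IsRep f' F') (hf : f =ᵐ[volume] f') :
    F =ᵐ[(volume : Measure (E n)).prod (coneMeasure n)] F' := by
  refine (Measure.ae_prod_iff_ae_ae
    (h.stronglyMeasurable.measurableSet_eq_fun h'.stronglyMeasurable)).2 ?_
  filter_upwards [h.ae_eq, h'.ae_eq, hf] with x h1 h2 h3
  filter_upwards [h1, h2] with w h4 h5
  rw [← h4, ← h5, h3]

theorem ae_eq_of_prod_ae_eq (h : IsRep f F) (h' : IsRep f' F')
    (hF : F =ᵐ[(volume : Measure (E n)).prod (coneMeasure n)] F') : f =ᵐ[volume] f' := by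
  filter_upwards [h.ae_eq, h'.ae_eq, Measure.ae_ae_of_ae_prod hF] with x h1 h2 h3
  refine Lp.ext ?_
  filter_upwards [h1, h2, h3] with w h4 h5 h6
  rw [h4, h5, h6]

theorem congr (h : IsRep f F) (hf : f' =ᵐ[volume] f) : IsRep f' F := by
  refine ⟨h.stronglyMeasurable, ?_⟩
  filter_upwards [h.ae_eq, hf] with x h1 h2
  rw [h2]
  exact h1

theorem add (h : IsRep f F) (h' : IsRep f' F') : IsRep (f + f') (F + F') := by
  refine ⟨h.stronglyMeasurable.add h'.stronglyMeasurable, ?_⟩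
  filter_upwards [h.ae_eq, h'.ae_eq] with x h1 h2
  filter_upwards [h1, h2, Lp.coeFn_add (f x) (f' x)] with w h3 h4 h5
  rw [Pi.add_apply, h5, Pi.add_apply, h3, h4]
  rfl

theorem sub (h : IsRep f F) (h' : IsRep f' F') : IsRep (f - f') (F - F') := by
  refine ⟨h.stronglyMeasurable.sub h'.stronglyMeasurable, ?_⟩
  filter_upwards [h.ae_eq, h'.ae_eq] with x h1 h2
  filter_upwards [h1, h2, Lp.coeFn_sub (f x) (f' x)] with w h3 h4 h5
  rw [Pi.sub_apply, h5, Pi.sub_apply, h3, h4]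
  rfl

theorem smul {𝕜 : Type*} [RCLike 𝕜] [NormedSpace 𝕜 B] (h : IsRep f F) (c : 𝕜) :
    IsRep (c • f) (c • F) := by
  refine ⟨h.stronglyMeasurable.const_smul c, ?_⟩
  filter_upwards [h.ae_eq] with x h1
  filter_upwards [h1, Lp.coeFn_smul c (f x)] with w h3 h5
  rw [Pi.smul_apply, h5, Pi.smul_apply, h3]
  rfl

variable [Fact (1 ≤ q)] {p : ℝ≥0∞}

theorem enorm_eq [Fact (1 ≤ p)] (hp : p ≠ ∞) (hq : q ≠ ∞) {f : LpA n p q B} (h : IsRep (⇑f) F) :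
    ‖f‖ₑ = mixedNorm volume (coneMeasure n) p.toReal q.toReal fun v => ‖F v‖ₑ :=
  enorm_LpLp_eq hp hq f h.ae_eq

theorem exists_rep [CompleteSpace B] (f : LpA n p q B) :
    ∃ F : E n × (E n × ℝ) → B, IsRep (⇑f) F := by
  obtain ⟨F, h1, h2⟩ := exists_stronglyMeasurable_rep_ae (Lp.aestronglyMeasurable f)
  exact ⟨F, h1, h2⟩

end IsRep

variable [NormedSpace ℝ B]

/-- The integral operator with kernel `opKernel φ`. -/
def op (φ : ℝ → E n → ℝ) (F : E n × (E n × ℝ) → B) (v : E n × (E n × ℝ)) : B :=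
  ∫ v', opKernel φ v v' • F v' ∂((volume : Measure (E n)).prod (coneMeasure n))

/-- Absolute convergence of the integral operator at all points of the closed cone. -/
def OpConverges (φ : ℝ → E n → ℝ) (F : E n × (E n × ℝ) → B) : Prop :=
  ∀ v : E n × (E n × ℝ), 0 < v.2.2 → ‖v.2.1‖ ≤ v.2.2 →
    Integrable (fun v' => opKernel φ v v' • F v') ((volume : Measure (E n)).prod (coneMeasure n))

theorem op_congr {φ : ℝ → E n → ℝ} {F F' : E n × (E n × ℝ) → B}
    (h : F =ᵐ[(volume : Measure (E n)).prod (coneMeasure n)] F') : op φ F = op φ F' := by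
  funext v
  refine integral_congr_ae ?_
  filter_upwards [h] with v' hv'
  rw [hv']

namespace IsKernBounded

variable {φ : ℝ → E n → ℝ} {K : ℝ} {F : E n × (E n × ℝ) → B}

theorem stronglyMeasurable_smul (h : IsKernBounded φ K) (hF : StronglyMeasurable F) :
    StronglyMeasurable (Function.uncurry fun v v' => opKernel φ v v' • F v') :=
  h.measurable_opKernel.stronglyMeasurable.smul (hF.comp_measurable measurable_snd)

theorem stronglyMeasurable_op (h : IsKernBounded φ K) (hF : StronglyMeasurable F) :
    StronglyMeasurable (op φ F) :=
  (h.stronglyMeasurable_smul hF).integral_prod_right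

theorem lintegral_enorm_smul_le (h : IsKernBounded φ K) {v : E n × (E n × ℝ)}
    (hv : ‖v.2.1‖ ≤ v.2.2) :
    ∫⁻ v', ‖opKernel φ v v' • F v'‖ₑ ∂((volume : Measure (E n)).prod (coneMeasure n)) ≤
      ENNReal.ofReal (K * 2 ^ ((n : ℝ) + 1 / 2)) *
        ∫⁻ v', coneKernel n v v' * ‖F v'‖ₑ ∂((volume : Measure (E n)).prod (coneMeasure n)) := by
  rw [← lintegral_const_mul' _ _ ENNReal.ofReal_ne_top]
  refine lintegral_mono_ae ?_
  filter_upwards [ae_prod_mem_cone] with v' hv'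
  rw [enorm_smul, ← mul_assoc]
  exact mul_le_mul_left (h.enorm_opKernel_le hv (le_of_lt hv')) _

theorem enorm_op_le (h : IsKernBounded φ K) {v : E n × (E n × ℝ)} (hv : ‖v.2.1‖ ≤ v.2.2) :
    ‖op φ F v‖ₑ ≤ ENNReal.ofReal (K * 2 ^ ((n : ℝ) + 1 / 2)) *
        ∫⁻ v', coneKernel n v v' * ‖F v'‖ₑ ∂((volume : Measure (E n)).prod (coneMeasure n)) :=
  (enorm_integral_le_lintegral_enorm _).trans (h.lintegral_enorm_smul_le hv)

theorem opConverges (h : IsKernBounded φ K) (hF : StronglyMeasurable F) {p q : ℝ} (hp : 1 ≤ p)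
    (hq : 1 < q) (hfin : mixedNorm volume (coneMeasure n) p q (fun v => ‖F v‖ₑ) ≠ ∞) :
    OpConverges φ F := by
  intro v hs hv
  refine ⟨((h.stronglyMeasurable_smul hF).comp_measurable
    measurable_prodMk_left).aestronglyMeasurable, ?_⟩
  refine (h.lintegral_enorm_smul_le hv).trans_lt (ENNReal.mul_lt_top ENNReal.ofReal_lt_top ?_)
  exact lintegral_coneKernel_mul_lt_top hp (Real.HolderConjugate.conjExponent hq) hF.enorm hfin hs

end IsKernBounded

theorem op_add {φ : ℝ → E n → ℝ} {F F' : E n × (E n × ℝ) → B} (h : OpConverges φ F)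
    (h' : OpConverges φ F') {v : E n × (E n × ℝ)} (hv : v.2 ∈ cone n) :
    op φ (F + F') v = op φ F v + op φ F' v := by
  have hs := pos_of_mem_cone hv
  unfold op
  rw [← integral_add (h v hs (le_of_lt hv)) (h' v hs (le_of_lt hv))]
  simp only [Pi.add_apply, smul_add]

theorem op_sub {φ : ℝ → E n → ℝ} {F F' : E n × (E n × ℝ) → B} (h : OpConverges φ F)
    (h' : OpConverges φ F') {v : E n × (E n × ℝ)} (hv : v.2 ∈ cone n) :
    op φ (F - F') v = op φ F v - op φ F' v := by
  have hs := pos_of_mem_cone hv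
  unfold op
  rw [← integral_sub (h v hs (le_of_lt hv)) (h' v hs (le_of_lt hv))]
  simp only [Pi.sub_apply, smul_sub]

theorem op_smul {𝕜 : Type*} [RCLike 𝕜] [NormedSpace 𝕜 B] {φ : ℝ → E n → ℝ}
    {F : E n × (E n × ℝ) → B} (c : 𝕜) (v : E n × (E n × ℝ)) :
    op φ (c • F) v = c • op φ F v := by
  unfold op
  rw [← integral_smul]
  refine integral_congr_ae (Filter.Eventually.of_forall fun v' => ?_)
  exact smul_comm _ _ _

theorem OpConverges.add {φ : ℝ → E n → ℝ} {F F' : E n × (E n × ℝ) → B} (h : OpConverges φ F)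
    (h' : OpConverges φ F') : OpConverges φ (F + F') := fun v hs hv => by
  refine ((h v hs hv).add (h' v hs hv)).congr (Filter.Eventually.of_forall fun v' => ?_)
  exact (smul_add _ _ _).symm

theorem OpConverges.smul {𝕜 : Type*} [RCLike 𝕜] [NormedSpace 𝕜 B] {φ : ℝ → E n → ℝ}
    {F : E n × (E n × ℝ) → B} (h : OpConverges φ F) (c : 𝕜) : OpConverges φ (c • F) :=
  fun v hs hv => by
    have := (h v hs hv).smul c
    refine this.congr (Filter.Eventually.of_forall fun v' => ?_)
    exact smul_comm _ _ _

/-- The extension of `Φ` as a relation: `g` is the image of `f`, both as functions with values in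
`A`. -/
def IsOp {q : ℝ≥0∞} (φ : ℝ → E n → ℝ) (f g : E n → A n q B) : Prop :=
  ∃ F, IsRep f F ∧ OpConverges φ F ∧ IsRep g (op φ F)

namespace IsOp

variable {q : ℝ≥0∞} {φ : ℝ → E n → ℝ} {f f' g g' : E n → A n q B}

theorem unique (h : IsOp φ f g) (h' : IsOp φ f' g') (hf : f =ᵐ[volume] f') :
    g =ᵐ[volume] g' := by
  obtain ⟨F, h1, h2, h3⟩ := h
  obtain ⟨F', h4, h5, h6⟩ := h'
  refine h3.ae_eq_of_prod_ae_eq h6 ?_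
  rw [op_congr (h1.prod_ae_eq h4 hf)]

theorem congr (h : IsOp φ f g) (hf : f' =ᵐ[volume] f) (hg : g' =ᵐ[volume] g) : IsOp φ f' g' := by
  obtain ⟨F, h1, h2, h3⟩ := h
  exact ⟨F, h1.congr hf, h2, h3.congr hg⟩

theorem add {K : ℝ} (hφ : IsKernBounded φ K) (h : IsOp φ f g) (h' : IsOp φ f' g') :
    IsOp φ (f + f') (g + g') := by
  obtain ⟨F, h1, h2, h3⟩ := h
  obtain ⟨F', h4, h5, h6⟩ := h'
  have h7 := h1.add h4
  have h8 := h3.add h6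
  have h9 : IsRep (g + g') (op φ (F + F')) := by
    refine ⟨hφ.stronglyMeasurable_op h7.stronglyMeasurable, ?_⟩
    filter_upwards [h8.ae_eq] with x hx
    filter_upwards [hx, ae_mem_cone] with w hw hw'
    exact hw.trans (op_add (v := (x, w)) h2 h5 hw').symm
  exact ⟨F + F', h7, h2.add h5, h9⟩

theorem smul {𝕜 : Type*} [RCLike 𝕜] [NormedSpace 𝕜 B] (h : IsOp φ f g) (c : 𝕜) :
    IsOp φ (c • f) (c • g) := by
  obtain ⟨F, h1, h2, h3⟩ := h
  refine ⟨c • F, h1.smul c, h2.smul c, ?_⟩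
  have e : op φ (c • F) = c • op φ F := funext fun v => op_smul c v
  rw [e]
  exact h3.smul c

end IsOp

end

section

variable {X Y : Type*} [MeasurableSpace X] [MeasurableSpace Y] {α : Measure X} {β : Measure Y}

theorem mixedNorm_mono_ae {p q : ℝ} (hp : 0 ≤ p) (hq : 0 ≤ q) {F G : X × Y → ℝ≥0∞}
    (h : ∀ x, ∀ᵐ y ∂β, F (x, y) ≤ G (x, y)) : mixedNorm α β p q F ≤ mixedNorm α β p q G := by
  unfold mixedNorm
  refine ENNReal.rpow_le_rpow (lintegral_mono fun x => ?_) (by positivity)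
  refine ENNReal.rpow_le_rpow (lintegral_mono_ae ?_) (by positivity)
  filter_upwards [h x] with y hy using ENNReal.rpow_le_rpow hy hq

theorem mixedNorm_const_mul {p q : ℝ} (hp : 0 < p) (hq : 0 < q) {c : ℝ≥0∞} (hc : c ≠ ∞)
    (F : X × Y → ℝ≥0∞) : mixedNorm α β p q (fun v => c * F v) = c * mixedNorm α β p q F := by
  unfold mixedNorm
  have e : ∀ x, (∫⁻ y, (c * F (x, y)) ^ q ∂β) ^ (p / q) =
      c ^ p * (∫⁻ y, F (x, y) ^ q ∂β) ^ (p / q) := by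
    intro x
    simp_rw [ENNReal.mul_rpow_of_nonneg _ _ hq.le]
    rw [lintegral_const_mul' _ _ (ENNReal.rpow_ne_top_of_nonneg hq.le hc),
      ENNReal.mul_rpow_of_nonneg _ _ (by positivity : 0 ≤ p / q), ← ENNReal.rpow_mul,
      mul_div_cancel₀ _ hq.ne']
  simp_rw [e]
  rw [lintegral_const_mul' _ _ (ENNReal.rpow_ne_top_of_nonneg hp.le hc),
    ENNReal.mul_rpow_of_nonneg _ _ (by positivity : 0 ≤ 1 / p), ← ENNReal.rpow_mul,
    mul_one_div_cancel hp.ne', ENNReal.rpow_one]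

theorem one_lt_toReal {q : ℝ≥0∞} (hq : 1 < q) (hq' : q ≠ ∞) : 1 < q.toReal := by
  simpa using (ENNReal.toReal_lt_toReal ENNReal.one_ne_top hq').2 hq

end

section

variable {n : ℕ} {B : Type*} [NormedAddCommGroup B] [NormedSpace ℝ B]
  {p q : ℝ≥0∞} [Fact (1 ≤ p)] [Fact (1 ≤ q)] {φ : ℝ → E n → ℝ} {K : ℝ}

theorem IsRep.opConverges (hφ : IsKernBounded φ K) (hp : p ≠ ∞) (hq1 : 1 < q) (hq : q ≠ ∞)
    {f : LpA n p q B} {F : E n × (E n × ℝ) → B} (h : IsRep (⇑f) F) : OpConverges φ F := by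
  have hp1 : 1 ≤ p.toReal := by
    simpa using (ENNReal.toReal_le_toReal ENNReal.one_ne_top hp).2 Fact.out
  refine hφ.opConverges h.stronglyMeasurable hp1 (one_lt_toReal hq1 hq) ?_
  rw [← h.enorm_eq hp hq]
  exact enorm_ne_top

/-- An a priori bound of the image in `L^r(L^q)` makes it an element of that space. -/
theorem IsRep.exists_isOp (hφ : IsKernBounded φ K) (hp : p ≠ ∞) (hq1 : 1 < q) (hq : q ≠ ∞)
    {f : LpA n p q B} {F : E n × (E n × ℝ) → B} (h : IsRep (⇑f) F) {r : ℝ≥0∞} [Fact (1 ≤ r)]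
    (hr : r ≠ ∞) {c : ℝ≥0∞} (hc : c ≠ ∞)
    (hfin : mixedNorm volume (coneMeasure n) r.toReal q.toReal (fun v => ‖op φ F v‖ₑ) ≤ c) :
    ∃ g : LpA n r q B, IsOp φ f g ∧ ‖g‖ₑ ≤ c := by
  have sm := hφ.stronglyMeasurable_op h.stronglyMeasurable
  obtain ⟨g, hg⟩ := exists_LpLp_of_mixedNorm_ne_top (α := (volume : Measure (E n))) hr hq sm
    (ne_top_of_le_ne_top hc hfin)
  have hg' : IsRep (⇑g) (op φ F) := ⟨sm, hg⟩
  refine ⟨g, ⟨F, h, h.opConverges hφ hp hq1 hq, hg'⟩, ?_⟩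
  rw [hg'.enorm_eq hr hq]
  exact hfin

/-- The operator is bounded on `L^p(ℝⁿ; L^q)`. -/
theorem exists_mixedNorm_op_le (hn : 0 < n) (K : ℝ) {p q : ℝ} (hp : 1 < p) (hq : 1 < q) :
    ∃ c : ℝ≥0∞, c ≠ ∞ ∧ ∀ (B : Type*) [NormedAddCommGroup B] [NormedSpace ℝ B]
      (φ : ℝ → E n → ℝ), IsKernBounded φ K → ∀ F : E n × (E n × ℝ) → B, StronglyMeasurable F →
      mixedNorm volume (coneMeasure n) p q (fun v => ‖op φ F v‖ₑ) ≤
        c * mixedNorm volume (coneMeasure n) p q fun v => ‖F v‖ₑ := by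
  obtain ⟨C, hC, hmain⟩ := (isMaximalKernel_coneKernel hn).exists_mixedNorm_le hp hq
  refine ⟨ENNReal.ofReal (K * 2 ^ ((n : ℝ) + 1 / 2)) * C,
    ENNReal.mul_ne_top ENNReal.ofReal_ne_top hC, fun B _ _ φ hφ F hF => ?_⟩
  rw [mul_assoc]
  refine le_trans ?_ (mul_le_mul_right (hmain _ hF.enorm) _)
  rw [← mixedNorm_const_mul (by linarith) (by linarith) ENNReal.ofReal_ne_top]
  refine mixedNorm_mono_ae (by linarith) (by linarith) fun x => ?_
  filter_upwards [ae_mem_cone] with w hw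
  exact hφ.enorm_op_le (v := (x, w)) (le_of_lt hw)

/-- The relation `IsOp` is closed with respect to convergence in `L¹`. -/
theorem IsOp.of_tendsto [CompleteSpace B] (hφ : IsKernBounded φ K) (hq1 : 1 < q) (hq : q ≠ ∞)
    {f g : ℕ → LpA n 1 q B} {f₀ g₀ : LpA n 1 q B} (h : ∀ k, IsOp φ (f k) (g k))
    (hf : Filter.Tendsto f Filter.atTop (nhds f₀)) (hg : Filter.Tendsto g Filter.atTop (nhds g₀)) :
    IsOp φ f₀ g₀ := by
  obtain ⟨F₀, hF₀⟩ := IsRep.exists_rep f₀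
  choose F hF1 hF2 hF3 using h
  have hconv := hF₀.opConverges hφ ENNReal.one_ne_top hq1 hq
  have hqc := Real.HolderConjugate.conjExponent (one_lt_toReal hq1 hq)
  have hq' := hqc.symm.pos
  -- pointwise convergence of the images
  have key : ∀ v : E n × (E n × ℝ), v.2 ∈ cone n →
      Filter.Tendsto (fun k => op φ (F k) v) Filter.atTop (nhds (op φ F₀ v)) := by
    intro v hv
    have hs := pos_of_mem_cone hv
    have hrep : ∀ k, IsRep (⇑(f k - f₀)) (F k - F₀) := fun k =>
      ((hF1 k).sub hF₀).congr (Lp.coeFn_sub _ _)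
    set c := ENNReal.ofReal (K * 2 ^ ((n : ℝ) + 1 / 2)) *
      (coneConst n (1 / 4) (1 / 2) ^ (1 / q.toReal.conjExponent) * ENNReal.ofReal (v.2.2 ^ n)⁻¹)
      with hc
    have hctop : c ≠ ∞ := ENNReal.mul_ne_top ENNReal.ofReal_ne_top (ENNReal.mul_ne_top
      (ENNReal.rpow_ne_top_of_nonneg (by positivity) (coneConst_ne_top _ _ _))
      ENNReal.ofReal_ne_top)
    have hle : ∀ k, edist (op φ (F k) v) (op φ F₀ v) ≤ c * edist (f k) f₀ := by
      intro k
      rw [edist_eq_enorm_sub, edist_eq_enorm_sub, ← op_sub (hF2 k) hconv hv,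
        (hrep k).enorm_eq ENNReal.one_ne_top hq, ENNReal.toReal_one, hc, mul_assoc]
      exact (hφ.enorm_op_le (le_of_lt hv)).trans (mul_le_mul_right
        (lintegral_coneKernel_mul_le_mixedNorm_one hqc (hrep k).stronglyMeasurable.enorm hs) _)
    refine tendsto_iff_edist_tendsto_0.2 ?_
    have h0 := ENNReal.Tendsto.const_mul (tendsto_iff_edist_tendsto_0.1 hf) (Or.inr hctop)
    rw [mul_zero] at h0
    exact tendsto_of_tendsto_of_tendsto_of_le_of_le tendsto_const_nhds h0 (fun _ => zero_le) hle
  obtain ⟨ns, hns, hlim⟩ := (tendstoInMeasure_of_tendsto_Lp hg).exists_seq_tendsto_ae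
  refine ⟨F₀, hF₀, hconv, hφ.stronglyMeasurable_op hF₀.stronglyMeasurable, ?_⟩
  filter_upwards [hlim, ae_all_iff.2 fun k => (hF3 k).ae_eq] with x h1 h2
  obtain ⟨ms, hms, hlim2⟩ := (tendstoInMeasure_of_tendsto_Lp h1).exists_seq_tendsto_ae
  filter_upwards [hlim2, ae_all_iff.2 h2, ae_mem_cone] with w h3 h4 hw
  refine tendsto_nhds_unique h3 ?_
  simp_rw [h4]
  exact (key (x, w) hw).comp (hns.tendsto_atTop.comp hms.tendsto_atTop)

end

/-! ### The class of nice functions -/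

section

variable {n : ℕ} {B : Type*} [NormedAddCommGroup B] [NormedSpace ℝ B]
  {q : ℝ≥0∞} [Fact (1 ≤ q)] {φ : ℝ → E n → ℝ} {K : ℝ}

theorem ae_volume_of_ae_coneMeasure {P : E n × ℝ → Prop} (h : ∀ᵐ w ∂(coneMeasure n), P w) :
    ∀ᵐ w, w ∈ cone n → P w := by
  rw [coneMeasure, ae_withDensity_iff measurable_coneDensity,
    ae_restrict_iff' measurableSet_cone] at h
  filter_upwards [h] with w hw hw'
  refine hw hw' ?_
  have := pos_of_mem_cone hw'
  simp only [ne_eq, ENNReal.ofReal_eq_zero, not_le]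
  positivity

namespace IsNice

variable {h : E n → A n q B} {g : E n → E n × ℝ → B}

omit [NormedSpace ℝ B] in
/-- By definition `g x` is continuous on the cone only; it vanishes off a compact subset of the cone,
hence is continuous everywhere. -/
theorem continuous_apply (hg : IsNice h g) (x : E n) : Continuous (g x) := by
  obtain ⟨C, hC, hCc, h0⟩ := hg.compact_support
  refine continuous_iff_continuousAt.2 fun w => ?_
  by_cases hw : w ∈ cone n
  · exact (hg.continuousOn x).continuousAt (isOpen_cone.mem_nhds hw)
  · have : g x =ᶠ[nhds w] fun _ => 0 := by
      filter_upwards [hC.isClosed.isOpen_compl.mem_nhds fun h => hw (hCc h)] with w' hw'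
      exact h0 x w' hw'
    exact continuousAt_const.congr this.symm

/-- For a fixed point of the cone, `g` is the limit of averages over small balls, which do not depend
on the choice of the version of `h`. -/
theorem stronglyMeasurable_left [CompleteSpace B] (hg : IsNice h g) (w₀ : E n × ℝ) :
    StronglyMeasurable fun x => g x w₀ := by
  obtain ⟨C, hC, hCc, h0⟩ := hg.compact_support
  by_cases hw₀ : w₀ ∈ cone n
  swap
  · have : (fun x => g x w₀) = fun _ => 0 := funext fun x => h0 x w₀ fun h => hw₀ (hCc h)
    rw [this]
    exact stronglyMeasurable_const
  obtain ⟨F, hF, hhF⟩ := exists_stronglyMeasurable_rep hg.continuous.stronglyMeasurable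
  set r : ℕ → ℝ := fun k => 1 / ((k : ℝ) + 1) with hr
  have rpos : ∀ k, 0 < r k := fun k => Nat.one_div_pos_of_nat
  have rlim : Filter.Tendsto r Filter.atTop (nhds 0) := tendsto_one_div_add_atTop_nhds_zero_nat
  refine stronglyMeasurable_of_tendsto Filter.atTop
    (f := fun k x => ⨍ w in Metric.ball w₀ (r k), F (x, w)) (fun k => ?_)
    (tendsto_pi_nhds.2 fun x => ?_)
  · simp only [setAverage_eq]
    exact (StronglyMeasurable.integral_prod_right (f := fun x w => F (x, w)) hF).const_smul _
  · have hae : ∀ᵐ w, w ∈ cone n → F (x, w) = g x w := by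
      refine ae_volume_of_ae_coneMeasure ?_
      filter_upwards [hhF x, hg.represents x] with w h1 h2
      rw [← h1, h2]
    refine Metric.tendsto_atTop.2 fun ε hε => ?_
    have hnear : ∀ᶠ w in nhds w₀, dist (g x w) (g x w₀) < ε / 2 ∧ w ∈ cone n :=
      (Metric.tendsto_nhds.1 (hg.continuous_apply x).continuousAt (ε / 2) (by positivity)).and
        (isOpen_cone.mem_nhds hw₀)
    obtain ⟨δ, hδ, hball⟩ := Metric.eventually_nhds_iff_ball.1 hnear
    obtain ⟨k₀, hk₀⟩ := Filter.eventually_atTop.1 (rlim.eventually (gt_mem_nhds hδ))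
    refine ⟨k₀, fun k hk => ?_⟩
    have hsub : Metric.ball w₀ (r k) ⊆ Metric.ball w₀ δ := Metric.ball_subset_ball (hk₀ k hk).le
    have hfs : ∀ᵐ w ∂(volume.restrict (Metric.ball w₀ (r k))),
        F (x, w) ∈ Metric.closedBall (g x w₀) (ε / 2) := by
      rw [ae_restrict_iff' measurableSet_ball]
      filter_upwards [hae] with w hw hw'
      have := hball w (hsub hw')
      rw [hw this.2]
      exact this.1.le
    have hfin : volume (Metric.ball w₀ (r k)) ≠ ∞ := measure_ball_lt_top.ne
    have hint : IntegrableOn (fun w => F (x, w)) (Metric.ball w₀ (r k)) := by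
      refine Measure.integrableOn_of_bounded (M := ‖g x w₀‖ + ε / 2) hfin
        (hF.comp_measurable measurable_prodMk_left).aestronglyMeasurable ?_
      filter_upwards [hfs] with w hw
      have h1 : ‖F (x, w) - g x w₀‖ ≤ ε / 2 := by rw [← dist_eq_norm]; exact hw
      have h2 := norm_add_le (F (x, w) - g x w₀) (g x w₀)
      rw [sub_add_cancel] at h2
      linarith
    have := (convex_closedBall (g x w₀) (ε / 2)).set_average_mem Metric.isClosed_closedBall
      (Metric.measure_ball_pos volume w₀ (rpos k)).ne' hfin hfs hint
    exact lt_of_le_of_lt this (by linarith)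

theorem isRep [CompleteSpace B] (hg : IsNice h g) : IsRep h fun v => g v.1 v.2 := by
  refine ⟨?_, Filter.Eventually.of_forall hg.represents⟩
  have := stronglyMeasurable_uncurry_of_continuous_of_stronglyMeasurable
    (u := fun w x => g x w) (fun x => hg.continuous_apply x) hg.stronglyMeasurable_left
  exact this.comp_measurable measurable_swap

theorem opConverges [CompleteSpace B] (hφ : IsKernBounded φ K) (hq1 : 1 < q) (hq : q ≠ ∞)
    (hg : IsNice h g) : OpConverges φ fun v => g v.1 v.2 := by
  have hi : Integrable h (volume : Measure (E n)) :=
    hg.continuous.integrable_of_hasCompactSupport hg.hasCompactSupport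
  have hm : MemLp h 1 (volume : Measure (E n)) := memLp_one_iff_integrable.2 hi
  exact (hg.isRep.congr hm.coeFn_toLp).opConverges hφ ENNReal.one_ne_top hq1 hq

theorem phiConverges [CompleteSpace B] (hφ : IsKernBounded φ K) (hq1 : 1 < q) (hq : q ≠ ∞)
    (hg : IsNice h g) (x u : E n) {s : ℝ} (hs : 0 < s) : PhiConverges φ g x u s := by
  have h1 := (hg.opConverges hφ hq1 hq (x + u, (0, s)) hs (by simpa using hs.le)).swap
  refine h1.congr ?_
  have hae : ∀ᵐ v ∂((coneMeasure n).prod (volume : Measure (E n))), v.1 ∈ cone n :=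
    (Measure.ae_prod_iff_ae_ae (measurable_fst measurableSet_cone)).2 (by
      filter_upwards [ae_mem_cone] with w hw
      exact Filter.Eventually.of_forall fun _ => hw)
  filter_upwards [hae] with v hv
  have ht := pos_of_mem_cone hv
  simp [opKernel, hs, ht]

theorem phi_eq [CompleteSpace B] (hφ : IsKernBounded φ K) (hq1 : 1 < q) (hq : q ≠ ∞)
    (hg : IsNice h g) (x : E n) {w : E n × ℝ} (hw : w ∈ cone n) :
    Phi φ g x w.1 w.2 = op φ (fun v => g v.1 v.2) (x, w) := by
  have hs := pos_of_mem_cone hw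
  unfold Phi op
  rw [integral_prod_symm _ (hg.opConverges hφ hq1 hq (x, w) hs (le_of_lt hw))]
  refine integral_congr_ae ?_
  filter_upwards [ae_mem_cone] with w' hw'
  have ht := pos_of_mem_cone hw'
  simp [opKernel, hs, ht]

end IsNice

theorem IsOp.isPhi [CompleteSpace B] (hφ : IsKernBounded φ K) (hq1 : 1 < q) (hq : q ≠ ∞)
    {h : E n → A n q B} {g : E n → E n × ℝ → B} (hg : IsNice h g) {f f' : E n → A n q B}
    (hf : f =ᵐ[volume] h) (hop : IsOp φ f f') : IsPhi φ g f' := by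
  obtain ⟨F, h1, h2, h3⟩ := hop
  have e := op_congr (φ := φ) (h1.prod_ae_eq hg.isRep hf)
  filter_upwards [h3.ae_eq] with x hx
  filter_upwards [hx, ae_mem_cone] with w hw hw'
  rw [hw, e, hg.phi_eq hφ hq1 hq x hw']

end

/-! ### Images of atoms -/

section

variable {X Y B : Type*} [MeasurableSpace X] [MeasurableSpace Y] {α : Measure X} {β : Measure Y}

/-- Schur's test for a symmetric kernel. -/
theorem lintegral_rpow_schur_le [SFinite β] {q q' : ℝ} (hq : q.HolderConjugate q')
    {S : Y → Y → ℝ≥0∞} (hS : Measurable (Function.uncurry S)) (hsymm : ∀ w w', S w w' = S w' w)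
    {D : ℝ≥0∞} (hD : ∀ w, ∫⁻ w', S w w' ∂β ≤ D) {h : Y → ℝ≥0∞} (hh : Measurable h) :
    ∫⁻ w, (∫⁻ w', S w w' * h w' ∂β) ^ q ∂β ≤ D ^ q * ∫⁻ w, h w ^ q ∂β := by
  have hq0 := hq.pos
  have hq' := hq.symm.pos
  have mS : ∀ w, Measurable (S w) := fun w => hS.comp measurable_prodMk_left
  have m2 : Measurable fun z : Y × Y => S z.1 z.2 * h z.2 ^ q :=
    hS.mul ((hh.comp measurable_snd).pow_const q)
  have hpt : ∀ w, (∫⁻ w', S w w' * h w' ∂β) ^ q ≤ D ^ (q / q') * ∫⁻ w', S w w' * h w' ^ q ∂β := by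
    intro w
    refine (ENNReal.rpow_le_rpow (lintegral_weight_mul_le hq (mS w) hh) hq0.le).trans ?_
    rw [ENNReal.mul_rpow_of_nonneg _ _ hq0.le, ← ENNReal.rpow_mul, ← ENNReal.rpow_mul,
      one_div_mul_cancel hq0.ne', ENNReal.rpow_one, one_div_mul_eq_div]
    exact mul_le_mul_left (ENNReal.rpow_le_rpow (hD w) (by positivity)) _
  have e1 : q / q' + 1 = q := by
    have := hq.inv_add_inv_eq_one
    field_simp at this ⊢
    linarith
  calc _ ≤ ∫⁻ w, D ^ (q / q') * ∫⁻ w', S w w' * h w' ^ q ∂β ∂β := lintegral_mono hpt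
    _ = D ^ (q / q') * ∫⁻ w, ∫⁻ w', S w w' * h w' ^ q ∂β ∂β :=
        lintegral_const_mul _ m2.lintegral_prod_right'
    _ = D ^ (q / q') * ∫⁻ w', (∫⁻ w, S w' w ∂β) * h w' ^ q ∂β := by
        rw [lintegral_lintegral_swap m2.aemeasurable]
        congr 1
        refine lintegral_congr fun w' => ?_
        rw [← lintegral_mul_const _ (mS w')]
        simp_rw [hsymm w']
    _ ≤ D ^ (q / q') * ∫⁻ w', D * h w' ^ q ∂β := by
        gcongr with w'
        exact hD w'
    _ = D ^ q * ∫⁻ w, h w ^ q ∂β := by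
        rw [lintegral_const_mul _ (hh.pow_const q), ← mul_assoc]
        congr 1
        nth_rw 2 [← ENNReal.rpow_one D]
        rw [← ENNReal.rpow_add_of_nonneg _ _ (by positivity) zero_le_one, e1]

/-- If an integrable function with values in `L^q` has integral zero, then so has its product with a
function in the dual exponent, as a function of two variables. -/
theorem integral_smul_eq_zero_of_integral_eq_zero [SigmaFinite α] [SigmaFinite β]
    [NormedAddCommGroup B] [NormedSpace ℝ B] [CompleteSpace B] {q q' : ℝ≥0∞} [Fact (1 ≤ q)]
    [Fact (1 ≤ q')] [hqq : q'.HolderConjugate q] (hq1 : 1 < q) (hq : q ≠ ∞)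
    {k : Y → ℝ} (hkm : Measurable k) (hk : MemLp k q' β) {f : Lp (Lp B q β) 1 α} {F : X × Y → B}
    (hF : StronglyMeasurable F) (hfF : ∀ᵐ x ∂α, f x =ᵐ[β] fun y => F (x, y))
    (hf : ∫ x, f x ∂α = 0) :
    Integrable (fun v => k v.2 • F v) (α.prod β) ∧ ∫ v, k v.2 • F v ∂(α.prod β) = 0 := by
  have hqr := one_lt_toReal hq1 hq
  have hq't : q' ≠ ∞ := by
    rintro rfl
    have := hqq.inv_add_inv_eq_one
    simp only [ENNReal.inv_top, zero_add, ENNReal.inv_eq_one] at this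
    exact hq1.ne' this
  have hc : q'.toReal.HolderConjugate q.toReal := (ENNReal.HolderConjugate.toReal (p := q) (q := q') hqr).symm
  have hint : Integrable (fun v => k v.2 • F v) (α.prod β) := by
    refine ⟨((hkm.comp measurable_snd).stronglyMeasurable.smul hF).aestronglyMeasurable, ?_⟩
    unfold HasFiniteIntegral
    simp_rw [enorm_smul]
    rw [lintegral_prod (fun v => ‖k v.2‖ₑ * ‖F v‖ₑ)
      ((hkm.comp measurable_snd).enorm.mul hF.enorm).aemeasurable]
    calc _ ≤ ∫⁻ x, eLpNorm k q' β * ‖f x‖ₑ ∂α := by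
          refine lintegral_mono_ae ?_
          filter_upwards [hfF] with x hx
          rw [enorm_Lp_eq hq, eLpNorm_eq_lintegral_rpow_enorm_toReal
            (zero_lt_one.trans_le Fact.out).ne' hq't]
          refine (ENNReal.lintegral_mul_le_Lp_mul_Lq β hc hkm.enorm.aemeasurable
            (hF.comp_measurable measurable_prodMk_left).enorm.aemeasurable).trans (le_of_eq ?_)
          congr 2
          refine lintegral_congr_ae ?_
          filter_upwards [hx] with y hy
          rw [hy]
          rfl
      _ < ∞ := by
          rw [lintegral_const_mul' _ _ hk.eLpNorm_lt_top.ne]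
          exact ENNReal.mul_lt_top hk.eLpNorm_lt_top (L1.integrable_coeFn f).2
  refine ⟨hint, ?_⟩
  rw [integral_prod _ hint]
  set L : Lp B q β →L[ℝ] B :=
    ContinuousLinearMap.lpPairing β q' q (ContinuousLinearMap.lsmul ℝ ℝ) hk.toLp with hL
  have e : ∀ᵐ x ∂α, ∫ y, k y • F (x, y) ∂β = L (f x) := by
    filter_upwards [hfF] with x hx
    rw [hL, ContinuousLinearMap.lpPairing_eq_integral]
    refine integral_congr_ae ?_
    filter_upwards [hx, hk.coeFn_toLp] with y h1 h2
    rw [h1, h2]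
    rfl
  rw [integral_congr_ae e, L.integral_comp_comm (L1.integrable_coeFn f), hf, map_zero]

end

section

variable {n : ℕ}

theorem cube_eq (b : E n) (l : ℝ) : cube b l =
    (MeasurableEquiv.toLp 2 (Fin n → ℝ)).symm ⁻¹' (Icc (fun i => b i) fun i => b i + l) := by
  ext x
  simp only [cube, mem_preimage, mem_Icc, Pi.le_def, mem_ofPred_eq]
  exact forall_and

theorem measurableSet_cube (b : E n) (l : ℝ) : MeasurableSet (cube b l) := by
  rw [cube_eq]
  exact (MeasurableEquiv.measurable _) measurableSet_Icc

theorem volume_cube (b : E n) {l : ℝ} (hl : 0 ≤ l) : volume (cube b l) = ENNReal.ofReal (l ^ n) := by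
  rw [cube_eq, (EuclideanSpace.volume_preserving_symm_measurableEquiv_toLp (Fin n)).measure_preimage
    measurableSet_Icc.nullMeasurableSet, Real.volume_Icc_pi]
  simp [ENNReal.ofReal_pow hl]

theorem norm_sub_le_of_mem_cube {b x : E n} {l : ℝ} (hl : 0 ≤ l) (hx : x ∈ cube b l) :
    ‖x - b‖ ≤ n * l := by
  rw [EuclideanSpace.norm_eq]
  refine Real.sqrt_le_iff.2 ⟨by positivity, ?_⟩
  have h1 : ∀ i : Fin n, ‖(x - b) i‖ ^ 2 ≤ l ^ 2 := by
    intro i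
    have := hx i
    rw [PiLp.sub_apply, Real.norm_eq_abs, abs_of_nonneg (by linarith)]
    exact pow_le_pow_left₀ (by linarith) (by linarith) 2
  calc _ ≤ ∑ _i : Fin n, l ^ 2 := Finset.sum_le_sum fun i _ => h1 i
    _ = n * l ^ 2 := by simp
    _ ≤ (n * l) ^ 2 := by
      rw [mul_pow]
      refine mul_le_mul_of_nonneg_right ?_ (by positivity)
      exact_mod_cast Nat.le_self_pow (by norm_num) n

/-- The majorant of the differences of the kernels, at distance `d` from the singularity. -/
def farKernel (n : ℕ) (d : ℝ) (w w' : E n × ℝ) : ℝ≥0∞ :=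
  if 0 < w.2 ∧ 0 < w'.2 then ENNReal.ofReal (sk n (1 / 8) (3 / 4) w.2 w'.2 d) else 0

theorem measurable_farKernel (d : ℝ) : Measurable (Function.uncurry (farKernel n d)) := by
  unfold farKernel Function.uncurry
  refine Measurable.ite ?_ ?_ measurable_const
  · have h1 : Measurable fun v : (E n × ℝ) × (E n × ℝ) => v.1.2 := by fun_prop
    have h2 : Measurable fun v : (E n × ℝ) × (E n × ℝ) => v.2.2 := by fun_prop
    exact (measurableSet_lt measurable_const h1).inter (measurableSet_lt measurable_const h2)
  · exact ENNReal.measurable_ofReal.comp (measurable_sk (by fun_prop) (by fun_prop) (by fun_prop))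

theorem farKernel_symm (d : ℝ) (w w' : E n × ℝ) : farKernel n d w w' = farKernel n d w' w := by
  unfold farKernel sk
  simp only [and_comm, mul_comm w.2, add_comm w.2]

/-- Together with the symmetry of `farKernel`, the hypothesis of Schur's test on the cone. -/
theorem lintegral_farKernel_le {d : ℝ} (hd : 0 < d) (w : E n × ℝ) :
    ∫⁻ w', farKernel n d w w' ∂(coneMeasure n) ≤
      coneConst n (1 / 8) (3 / 4) * ENNReal.ofReal (d ^ ((n : ℝ) + 1 / 2))⁻¹ := by
  by_cases hs : 0 < w.2
  · have hn : (0 : ℝ) ≤ n := by positivity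
    have h := lintegral_sk_le (n := n) (a := 1 / 8) (b := 3 / 4) (by norm_num)
      (by linarith) hs hd.le
    refine le_trans (lintegral_mono fun w => ?_) (h.trans ?_)
    · unfold farKernel
      split_ifs <;> simp
    · refine mul_le_mul_right (ENNReal.ofReal_le_ofReal ?_) _
      rw [inv_eq_one_div, div_le_div_iff₀ (by positivity) (by positivity), one_mul,
        show (n : ℝ) + 3 / 4 - 1 / 8 = 1 / 8 + (n + 1 / 2) by ring,
        Real.rpow_add (by positivity : 0 < w.2 + d)]
      gcongr <;> linarith
  · simp [farKernel, hs]

/-- Moving the singularity by at most `ρ`, at distance at least `2 ρ` from it, gains the factor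
`(ρ / ‖x - b‖) ^ (1 / 2)` which makes the difference of the kernels integrable in `x`. -/
theorem IsKernBounded.enorm_opKernel_sub_le {φ : ℝ → E n → ℝ} {K : ℝ} (h : IsKernBounded φ K)
    {x b y : E n} {w w' : E n × ℝ} {ρ : ℝ} (hw : w ∈ cone n) (hw' : w' ∈ cone n)
    (hy : ‖y - b‖ ≤ ρ) (hx : 2 * ρ ≤ ‖x - b‖) :
    ‖opKernel φ (x, w) (y, w') - opKernel φ (x, w) (b, w')‖ₑ ≤
      ENNReal.ofReal (K * 4 ^ ((n : ℝ) + 3 / 4) * ρ ^ (1 / 2 : ℝ)) *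
        farKernel n ‖x - b‖ w w' := by
  have hs := pos_of_mem_cone hw
  have ht := pos_of_mem_cone hw'
  have hK := h.nonneg
  have hρ : 0 ≤ ρ := (norm_nonneg _).trans hy
  unfold opKernel farKernel
  simp only [hs, ht, and_self, if_true]
  rw [← ENNReal.ofReal_mul (by positivity), ← ofReal_norm, Real.norm_eq_abs]
  refine ENNReal.ofReal_le_ofReal ?_
  set ξ := x + w.1 + w'.1 - y with hξ
  set ξ' := x + w.1 + w'.1 - b with hξ'
  have hw1 : ‖w.1‖ < w.2 := hw
  have hw2 : ‖w'.1‖ < w'.2 := hw'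
  have hd1 : ‖x - y‖ ≤ ‖ξ‖ + ‖w.1‖ + ‖w'.1‖ := by
    have e : x - y = ξ - w.1 - w'.1 := by rw [hξ]; abel
    rw [e]
    exact (norm_sub_le _ _).trans (by gcongr; exact norm_sub_le _ _)
  have hd2 : ‖x - b‖ ≤ ‖ξ'‖ + ‖w.1‖ + ‖w'.1‖ := by
    have e : x - b = ξ' - w.1 - w'.1 := by rw [hξ']; abel
    rw [e]
    exact (norm_sub_le _ _).trans (by gcongr; exact norm_sub_le _ _)
  have hd3 : ‖x - b‖ ≤ ‖x - y‖ + ‖y - b‖ := norm_sub_le_norm_sub_add_norm_sub x y b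
  have hD : 0 ≤ min ‖ξ‖ ‖ξ'‖ := le_min (norm_nonneg _) (norm_nonneg _)
  have hm := h.abs_sub_le _ _ hs ht ξ ξ' (min ‖ξ‖ ‖ξ'‖) hD (min_le_left _ _) (min_le_right _ _)
  have e : ξ - ξ' = b - y := by rw [hξ, hξ']; abel
  rw [e, norm_sub_rev] at hm
  have hsk : sk n (1 / 8) (3 / 4) w.2 w'.2 (min ‖ξ‖ ‖ξ'‖) ≤
      4 ^ ((n : ℝ) + 3 / 4) * sk n (1 / 8) (3 / 4) w.2 w'.2 ‖x - b‖ := by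
    refine sk_le_of_le_mul (by norm_num) hs ht hD (norm_nonneg _) (by norm_num) ?_
    rcases le_total ‖ξ‖ ‖ξ'‖ with hle | hle
    · rw [min_eq_left hle]; linarith [norm_nonneg ξ]
    · rw [min_eq_right hle]; linarith [norm_nonneg ξ']
  have hsk0 := sk_nonneg (n := n) (a := 1 / 8) (b := 3 / 4) hs ht (norm_nonneg (x - b))
  have hsk1 := sk_nonneg (n := n) (a := 1 / 8) (b := 3 / 4) hs ht hD
  calc _ ≤ _ := hm
    _ ≤ K * (ρ ^ (1 / 2 : ℝ) *
        (4 ^ ((n : ℝ) + 3 / 4) * sk n (1 / 8) (3 / 4) w.2 w'.2 ‖x - b‖)) := by gcongr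
    _ = _ := by ring

end

section

variable {n : ℕ} {φ : ℝ → E n → ℝ} {K : ℝ}

theorem coneKernel_le_inv {v v' : E n × (E n × ℝ)} (hs : 0 < v.2.2) :
    coneKernel n v v' ≤ ENNReal.ofReal (v.2.2 ^ n)⁻¹ := by
  unfold coneKernel
  split_ifs with hpos
  · exact ENNReal.ofReal_le_ofReal ((sk_le_pk hpos.1 hpos.2 (norm_nonneg _)).trans
      (pk_le_inv hs (norm_nonneg _)))
  · exact zero_le

theorem lintegral_coneKernel_lt_top {v : E n × (E n × ℝ)} (hs : 0 < v.2.2) (y : E n) :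
    ∫⁻ w, coneKernel n v (y, w) ∂(coneMeasure n) < ∞ := by
  refine (lintegral_coneKernel_le v y).trans_lt ?_
  rw [if_pos hs]
  exact ENNReal.mul_lt_top (lt_top_iff_ne_top.2 (coneConst_ne_top _ _ _)) ENNReal.ofReal_lt_top

/-- The sections of the kernel lie in all Lebesgue spaces over the cone. -/
theorem IsKernBounded.memLp_opKernel (h : IsKernBounded φ K) {r : ℝ≥0∞} (hr1 : 1 ≤ r)
    (hr : r ≠ ∞) (x b : E n) {w : E n × ℝ} (hw : w ∈ cone n) :
    MemLp (fun w' => opKernel φ (x, w) (b, w')) r (coneMeasure n) := by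
  have hs := pos_of_mem_cone hw
  have hrr : 1 ≤ r.toReal := by simpa using (ENNReal.toReal_le_toReal ENNReal.one_ne_top hr).2 hr1
  have hr0 : 0 ≤ r.toReal := by linarith
  refine ⟨(h.measurable_opKernel.comp (measurable_prodMk_left.comp
    measurable_prodMk_left)).aestronglyMeasurable, ?_⟩
  rw [eLpNorm_lt_top_iff_lintegral_rpow_enorm_lt_top (zero_lt_one.trans_le hr1).ne' hr]
  set c := ENNReal.ofReal (K * 2 ^ ((n : ℝ) + 1 / 2)) with hc
  set R := ENNReal.ofReal (w.2 ^ n)⁻¹ with hR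
  calc _ ≤ ∫⁻ w', c ^ r.toReal * (R ^ (r.toReal - 1) * coneKernel n (x, w) (b, w'))
        ∂(coneMeasure n) := by
        refine lintegral_mono_ae ?_
        filter_upwards [ae_mem_cone] with w' hw'
        refine (ENNReal.rpow_le_rpow (h.enorm_opKernel_le (v := (x, w)) (v' := (b, w'))
          (le_of_lt hw) (le_of_lt hw')) hr0).trans ?_
        rw [ENNReal.mul_rpow_of_nonneg _ _ hr0]
        refine mul_le_mul_right ?_ _
        have e : coneKernel n (x, w) (b, w') ^ r.toReal =
            coneKernel n (x, w) (b, w') ^ (r.toReal - 1) * coneKernel n (x, w) (b, w') := by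
          conv_rhs => rw [← ENNReal.rpow_one (coneKernel n (x, w) (b, w')), ← ENNReal.rpow_mul,
            one_mul, ← ENNReal.rpow_add_of_nonneg _ _ (by linarith) zero_le_one, sub_add_cancel]
        rw [e]
        exact mul_le_mul_left (ENNReal.rpow_le_rpow (coneKernel_le_inv hs) (by linarith)) _
    _ < ∞ := by
        rw [lintegral_const_mul' _ _ (ENNReal.rpow_ne_top_of_nonneg hr0 ENNReal.ofReal_ne_top),
          lintegral_const_mul' _ _ (ENNReal.rpow_ne_top_of_nonneg (by linarith)
            ENNReal.ofReal_ne_top)]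
        exact ENNReal.mul_lt_top (ENNReal.rpow_lt_top_of_nonneg hr0 ENNReal.ofReal_ne_top)
          (ENNReal.mul_lt_top (ENNReal.rpow_lt_top_of_nonneg (by linarith) ENNReal.ofReal_ne_top)
            (lintegral_coneKernel_lt_top hs b))

variable {B : Type*} [NormedAddCommGroup B] [NormedSpace ℝ B]

/-- Away from its support, the image of a function with integral zero is controlled by the
differences of the kernel. -/
theorem IsKernBounded.enorm_op_le_of_cancel (h : IsKernBounded φ K) {F : E n × (E n × ℝ) → B}
    (hF : StronglyMeasurable F) (hconv : OpConverges φ F) {b : E n} {ρ : ℝ}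
    (hsupp : ∀ v : E n × (E n × ℝ), ρ < ‖v.1 - b‖ → F v = 0) {x : E n} (hx : 2 * ρ ≤ ‖x - b‖)
    {w : E n × ℝ} (hw : w ∈ cone n)
    (hint : Integrable (fun v' => opKernel φ (x, w) (b, v'.2) • F v')
      ((volume : Measure (E n)).prod (coneMeasure n)))
    (hzero : ∫ v', opKernel φ (x, w) (b, v'.2) • F v'
      ∂((volume : Measure (E n)).prod (coneMeasure n)) = 0) :
    ‖op φ F (x, w)‖ₑ ≤ ENNReal.ofReal (K * 4 ^ ((n : ℝ) + 3 / 4) * ρ ^ (1 / 2 : ℝ)) *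
      ∫⁻ w', farKernel n ‖x - b‖ w w' * (∫⁻ y, ‖F (y, w')‖ₑ) ∂(coneMeasure n) := by
  have hs := pos_of_mem_cone hw
  have e1 : op φ F (x, w) = ∫ v', (opKernel φ (x, w) v' - opKernel φ (x, w) (b, v'.2)) • F v'
      ∂((volume : Measure (E n)).prod (coneMeasure n)) := by
    simp only [sub_smul]
    rw [integral_sub (hconv (x, w) hs (le_of_lt hw)) hint, hzero, sub_zero]
    rfl
  have mS : Measurable (farKernel n ‖x - b‖ w) :=
    (measurable_farKernel ‖x - b‖).comp measurable_prodMk_left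
  have m2 : Measurable fun v' : E n × (E n × ℝ) => farKernel n ‖x - b‖ w v'.2 * ‖F v'‖ₑ :=
    (mS.comp measurable_snd).mul hF.enorm
  rw [e1]
  refine (enorm_integral_le_lintegral_enorm _).trans ?_
  calc _ ≤ ∫⁻ v', ENNReal.ofReal (K * 4 ^ ((n : ℝ) + 3 / 4) * ρ ^ (1 / 2 : ℝ)) *
        (farKernel n ‖x - b‖ w v'.2 * ‖F v'‖ₑ)
          ∂((volume : Measure (E n)).prod (coneMeasure n)) := by
        refine lintegral_mono_ae ?_
        filter_upwards [ae_prod_mem_cone] with v' hv'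
        rw [enorm_smul, ← mul_assoc]
        rcases le_or_gt ‖v'.1 - b‖ ρ with hle | hlt
        · exact mul_le_mul_left (h.enorm_opKernel_sub_le hw hv' hle hx) _
        · simp [hsupp v' hlt]
    _ = _ := by
        rw [lintegral_const_mul' _ _ ENNReal.ofReal_ne_top,
          lintegral_prod_symm (fun v' => farKernel n ‖x - b‖ w v'.2 * ‖F v'‖ₑ) m2.aemeasurable]
        congr 1
        refine lintegral_congr fun w' => ?_
        exact lintegral_const_mul (farKernel n ‖x - b‖ w w')
          (f := fun y => ‖F (y, w')‖ₑ) (hF.comp_measurable measurable_prodMk_right).enorm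

/-- The contribution of the points far from the support. -/
theorem IsKernBounded.lintegral_enorm_op_rpow_le (h : IsKernBounded φ K)
    {F : E n × (E n × ℝ) → B} (hF : StronglyMeasurable F) (hconv : OpConverges φ F) {b : E n}
    {ρ : ℝ} (hρ : 0 < ρ)
    (hsupp : ∀ v : E n × (E n × ℝ), ρ < ‖v.1 - b‖ → F v = 0) {x : E n} (hx : 2 * ρ ≤ ‖x - b‖)
    (hcancel : ∀ w ∈ cone n, Integrable (fun v' => opKernel φ (x, w) (b, v'.2) • F v')
      ((volume : Measure (E n)).prod (coneMeasure n)) ∧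
      ∫ v', opKernel φ (x, w) (b, v'.2) • F v'
        ∂((volume : Measure (E n)).prod (coneMeasure n)) = 0) {q q' : ℝ}
    (hq : q.HolderConjugate q')
    (hmass : ∫⁻ w, (∫⁻ y, ‖F (y, w)‖ₑ) ^ q ∂(coneMeasure n) ≤ 1) :
    (∫⁻ w, ‖op φ F (x, w)‖ₑ ^ q ∂(coneMeasure n)) ^ (1 / q) ≤
      ENNReal.ofReal (K * 4 ^ ((n : ℝ) + 3 / 4) * 2 ^ ((n : ℝ) + 1 / 2)) *
        coneConst n (1 / 8) (3 / 4) * ENNReal.ofReal (pk n (1 / 2) ρ ‖x - b‖) := by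
  have hq0 := hq.pos
  have hK := h.nonneg
  have hd : 0 < ‖x - b‖ := by linarith
  set c := ENNReal.ofReal (K * 4 ^ ((n : ℝ) + 3 / 4) * ρ ^ (1 / 2 : ℝ)) with hc
  set D := coneConst n (1 / 8) (3 / 4) * ENNReal.ofReal (‖x - b‖ ^ ((n : ℝ) + 1 / 2))⁻¹ with hD
  have mh : Measurable fun w => ∫⁻ y, ‖F (y, w)‖ₑ := hF.enorm.lintegral_prod_left'
  have hcD : ∫⁻ w, ‖op φ F (x, w)‖ₑ ^ q ∂(coneMeasure n) ≤ (c * D) ^ q := by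
    calc _ ≤ ∫⁻ w, c ^ q * (∫⁻ w', farKernel n ‖x - b‖ w w' * (∫⁻ y, ‖F (y, w')‖ₑ)
          ∂(coneMeasure n)) ^ q ∂(coneMeasure n) := by
          refine lintegral_mono_ae ?_
          filter_upwards [ae_mem_cone] with w hw
          rw [← ENNReal.mul_rpow_of_nonneg _ _ hq0.le]
          exact ENNReal.rpow_le_rpow (h.enorm_op_le_of_cancel hF hconv hsupp hx hw
            (hcancel w hw).1 (hcancel w hw).2) hq0.le
      _ ≤ c ^ q * (D ^ q * 1) := by
          rw [lintegral_const_mul' _ _ (ENNReal.rpow_ne_top_of_nonneg hq0.le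
            ENNReal.ofReal_ne_top)]
          refine mul_le_mul_right ?_ _
          exact (lintegral_rpow_schur_le hq (measurable_farKernel _) (farKernel_symm _)
            (lintegral_farKernel_le hd) mh).trans (mul_le_mul_right hmass _)
      _ = (c * D) ^ q := by rw [mul_one, ENNReal.mul_rpow_of_nonneg c D hq0.le]
  calc _ ≤ ((c * D) ^ q) ^ (1 / q) := ENNReal.rpow_le_rpow hcD (by positivity)
    _ = c * D := by rw [← ENNReal.rpow_mul, mul_one_div_cancel hq0.ne', ENNReal.rpow_one]
    _ = coneConst n (1 / 8) (3 / 4) * ENNReal.ofReal (K * 4 ^ ((n : ℝ) + 3 / 4) *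
        (ρ ^ (1 / 2 : ℝ) * (‖x - b‖ ^ ((n : ℝ) + 1 / 2))⁻¹)) := by
        rw [hc, hD, ← mul_assoc, mul_comm _ (coneConst n (1 / 8) (3 / 4)), mul_assoc,
          ← ENNReal.ofReal_mul (by positivity)]
        ring_nf
    _ ≤ coneConst n (1 / 8) (3 / 4) * ENNReal.ofReal (K * 4 ^ ((n : ℝ) + 3 / 4) *
        (2 ^ ((n : ℝ) + 1 / 2) * pk n (1 / 2) ρ ‖x - b‖)) := by
        refine mul_le_mul_right (ENNReal.ofReal_le_ofReal (mul_le_mul_of_nonneg_left ?_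
          (by positivity))) _
        unfold pk
        rw [← div_eq_mul_inv, mul_div_assoc', div_le_div_iff₀ (by positivity) (by positivity)]
        have : (ρ + ‖x - b‖) ^ ((n : ℝ) + 1 / 2) ≤
            2 ^ ((n : ℝ) + 1 / 2) * ‖x - b‖ ^ ((n : ℝ) + 1 / 2) := by
          rw [← Real.mul_rpow (by norm_num) hd.le]
          gcongr
          linarith
        calc _ ≤ ρ ^ (1 / 2 : ℝ) * (2 ^ ((n : ℝ) + 1 / 2) * ‖x - b‖ ^ ((n : ℝ) + 1 / 2)) := by
              gcongr
          _ = _ := by ring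
    _ = _ := by
        rw [← mul_assoc (K * _), ENNReal.ofReal_mul (by positivity)]
        ring

end

section

variable {n : ℕ} {B : Type*} [NormedAddCommGroup B] {q : ℝ≥0∞} [Fact (1 ≤ q)]

theorem IsRep.indicator_cube {a : LpA n 1 q B} {F : E n × (E n × ℝ) → B} (hF : IsRep (⇑a) F)
    {b : E n} {l : ℝ} (h : ∀ᵐ x, x ∉ cube b l → a x = 0) :
    IsRep (⇑a) ((Prod.fst ⁻¹' cube b l).indicator F) := by
  refine ⟨hF.stronglyMeasurable.indicator (measurable_fst (measurableSet_cube b l)), ?_⟩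
  filter_upwards [hF.ae_eq, h] with x h1 h2
  by_cases hx : x ∈ cube b l
  · filter_upwards [h1] with w hw
    rw [hw, indicator_of_mem (show (x, w) ∈ Prod.fst ⁻¹' cube b l from hx)]
  · rw [h2 hx]
    filter_upwards [Lp.coeFn_zero B q (coneMeasure n)] with w hw
    rw [hw, indicator_of_notMem (show (x, w) ∉ Prod.fst ⁻¹' cube b l from hx)]
    rfl

/-- The `L^q` mass of an atom with values in `L^q`. -/
theorem IsRep.lintegral_rpow_le (hq : q ≠ ∞) {a : LpA n 1 q B} {F : E n × (E n × ℝ) → B}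
    (hF : IsRep (⇑a) F) {b : E n} {l : ℝ} (hl : 0 < l)
    (hsupp : ∀ v : E n × (E n × ℝ), v.1 ∉ cube b l → F v = 0)
    (hsize : ∀ᵐ x, ‖a x‖ ≤ 1 / volume.real (cube b l)) :
    ∫⁻ x, ∫⁻ w, ‖F (x, w)‖ₑ ^ q.toReal ∂(coneMeasure n) ≤
      ENNReal.ofReal (l ^ n) * (ENNReal.ofReal (l ^ n))⁻¹ ^ q.toReal := by
  have hq0 : 0 < q.toReal := ENNReal.toReal_pos (zero_lt_one.trans_le Fact.out).ne' hq
  set V := ENNReal.ofReal (l ^ n) with hV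
  have hvol : volume (cube b l) = V := volume_cube b hl.le
  calc _ ≤ ∫⁻ x, (cube b l).indicator (fun _ => V⁻¹ ^ q.toReal) x := by
        refine lintegral_mono_ae ?_
        filter_upwards [hF.ae_eq, hsize] with x h1 h2
        by_cases hx : x ∈ cube b l
        · rw [indicator_of_mem hx]
          have e : ∫⁻ w, ‖F (x, w)‖ₑ ^ q.toReal ∂(coneMeasure n) = ‖a x‖ₑ ^ q.toReal := by
            rw [enorm_Lp_eq hq, ← ENNReal.rpow_mul, one_div_mul_cancel hq0.ne', ENNReal.rpow_one]
            refine lintegral_congr_ae ?_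
            filter_upwards [h1] with w hw
            rw [hw]
          rw [e]
          refine ENNReal.rpow_le_rpow ?_ hq0.le
          rw [← ofReal_norm]
          refine (ENNReal.ofReal_le_ofReal h2).trans (le_of_eq ?_)
          rw [Measure.real, hvol, hV, ENNReal.toReal_ofReal (by positivity), one_div,
            ENNReal.ofReal_inv_of_pos (by positivity)]
        · rw [indicator_of_notMem hx]
          refine le_of_eq (lintegral_eq_zero_of_ae_eq_zero (Filter.Eventually.of_forall fun w => ?_))
          simp [hsupp (x, w) hx, hq0]
    _ = _ := by
        rw [lintegral_indicator (measurableSet_cube b l), setLIntegral_const, hvol, mul_comm]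

end

section

variable {n : ℕ} {B : Type*} [NormedAddCommGroup B]

/-- By Jensen's inequality, the integral of an atom of `L^q` over the first variable has `L^q` norm
at most one. -/
theorem lintegral_lintegral_rpow_le_one {q q' : ℝ} (hq : q.HolderConjugate q')
    {F : E n × (E n × ℝ) → B} (hF : StronglyMeasurable F) {b : E n} {l : ℝ} (hl : 0 < l)
    (hsupp : ∀ v : E n × (E n × ℝ), v.1 ∉ cube b l → F v = 0)
    (hmass : ∫⁻ x, ∫⁻ w, ‖F (x, w)‖ₑ ^ q ∂(coneMeasure n) ≤
      ENNReal.ofReal (l ^ n) * (ENNReal.ofReal (l ^ n))⁻¹ ^ q) :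
    ∫⁻ w, (∫⁻ y, ‖F (y, w)‖ₑ) ^ q ∂(coneMeasure n) ≤ 1 := by
  have hq0 := hq.pos
  have hq' := hq.symm.pos
  set V := ENNReal.ofReal (l ^ n) with hV
  have hvol : volume (cube b l) = V := volume_cube b hl.le
  have V0 : V ≠ 0 := by rw [hV]; simp only [ne_eq, ENNReal.ofReal_eq_zero, not_le]; positivity
  have Vt : V ≠ ∞ := ENNReal.ofReal_ne_top
  have e1 : q / q' + 1 = q := by
    have := hq.inv_add_inv_eq_one
    field_simp at this ⊢
    linarith
  have hpt : ∀ w, (∫⁻ y, ‖F (y, w)‖ₑ) ^ q ≤ V ^ (q / q') * ∫⁻ y, ‖F (y, w)‖ₑ ^ q := by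
    intro w
    have mF : Measurable fun y => ‖F (y, w)‖ₑ :=
      (hF.comp_measurable measurable_prodMk_right).enorm
    have h1 := lintegral_weight_mul_le (μ := (volume : Measure (E n))) hq
      (k := (cube b l).indicator fun _ => 1) (H := fun y => ‖F (y, w)‖ₑ)
      (measurable_const.indicator (measurableSet_cube b l)) mF
    rw [lintegral_indicator (measurableSet_cube b l), setLIntegral_const, one_mul, hvol] at h1
    have e2 : ∀ y, (cube b l).indicator (fun _ => (1 : ℝ≥0∞)) y * ‖F (y, w)‖ₑ = ‖F (y, w)‖ₑ := by
      intro y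
      by_cases hy : y ∈ cube b l
      · simp [hy]
      · simp [hsupp (y, w) hy]
    have e3 : ∀ y, (cube b l).indicator (fun _ => (1 : ℝ≥0∞)) y * ‖F (y, w)‖ₑ ^ q ≤
        ‖F (y, w)‖ₑ ^ q := by
      intro y
      by_cases hy : y ∈ cube b l <;> simp [hy]
    simp_rw [e2] at h1
    refine (ENNReal.rpow_le_rpow (h1.trans (mul_le_mul_right (ENNReal.rpow_le_rpow
      (lintegral_mono e3) (by positivity)) _)) hq0.le).trans (le_of_eq ?_)
    rw [ENNReal.mul_rpow_of_nonneg _ _ hq0.le, ← ENNReal.rpow_mul, ← ENNReal.rpow_mul,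
      one_div_mul_cancel hq0.ne', ENNReal.rpow_one, one_div_mul_eq_div]
  calc _ ≤ ∫⁻ w, V ^ (q / q') * (∫⁻ y, ‖F (y, w)‖ₑ ^ q) ∂(coneMeasure n) := lintegral_mono hpt
    _ = V ^ (q / q') * ∫⁻ x, ∫⁻ w, ‖F (x, w)‖ₑ ^ q ∂(coneMeasure n) := by
        rw [lintegral_const_mul' _ _ (ENNReal.rpow_ne_top_of_nonneg (by positivity) Vt),
          lintegral_lintegral_swap (f := fun w x => ‖F (x, w)‖ₑ ^ q)
            ((hF.enorm.pow_const q).comp measurable_swap).aemeasurable]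
    _ ≤ V ^ (q / q') * (V * V⁻¹ ^ q) := mul_le_mul_right hmass _
    _ = 1 := by
        rw [← mul_assoc]
        nth_rw 2 [← ENNReal.rpow_one V]
        rw [← ENNReal.rpow_add _ _ V0 Vt, e1, ← ENNReal.mul_rpow_of_nonneg _ _ hq0.le,
          ENNReal.mul_inv_cancel V0 Vt, ENNReal.one_rpow]

end

/-- The images of atoms are bounded in `L¹`. -/
theorem exists_mixedNorm_op_atom_le {n : ℕ} (hn : 0 < n) (K : ℝ) {q : ℝ≥0∞} [Fact (1 ≤ q)]
    (hq1 : 1 < q) (hq : q ≠ ∞) :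
    ∃ c : ℝ≥0∞, c ≠ ∞ ∧ ∀ (B : Type*) [NormedAddCommGroup B] [NormedSpace ℝ B] [CompleteSpace B]
      (φ : ℝ → E n → ℝ), IsKernBounded φ K → ∀ a : LpA n 1 q B, IsAtom a →
      ∀ F : E n × (E n × ℝ) → B, IsRep (⇑a) F →
      mixedNorm volume (coneMeasure n) 1 q.toReal (fun v => ‖op φ F v‖ₑ) ≤ c := by
  have hqr := one_lt_toReal hq1 hq
  obtain ⟨C, hC, hmain⟩ := exists_mixedNorm_op_le hn K hqr hqr
  -- the dual exponent
  set q' := q.conjExponent with hq'def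
  have hqq : q.HolderConjugate q' := ENNReal.HolderConjugate.conjExponent hq1.le
  have hqq2 : q'.HolderConjugate q := hqq.symm
  have : Fact (1 ≤ q') := ⟨ENNReal.HolderConjugate.one_le q' q⟩
  have hc : q.toReal.HolderConjugate q'.toReal := ENNReal.HolderConjugate.toReal hqr
  have hq't : q' ≠ ∞ := by
    intro h
    have := hc.symm.pos
    rw [h] at this
    simp at this
  have hq0 := hc.pos
  have hq'0 := hc.symm.pos
  set ω := volume (Metric.ball (0 : E n) 1) with hω
  set c₁ := (ENNReal.ofReal ((2 * (n : ℝ)) ^ n) * ω) ^ (1 / q'.toReal) * C with hc₁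
  set c₂ := ENNReal.ofReal (K * 4 ^ ((n : ℝ) + 3 / 4) * 2 ^ ((n : ℝ) + 1 / 2)) *
        coneConst n (1 / 8) (3 / 4) with hc₂
  have hc₁t : c₁ ≠ ∞ := ENNReal.mul_ne_top (ENNReal.rpow_ne_top_of_nonneg (by positivity)
    (ENNReal.mul_ne_top ENNReal.ofReal_ne_top (volume_ball_ne_top _))) hC
  have hc₂t : c₂ ≠ ∞ := ENNReal.mul_ne_top ENNReal.ofReal_ne_top (coneConst_ne_top _ _ _)
  refine ⟨c₁ + c₂ * ENNReal.ofReal (pkMass n (1 / 2)), ENNReal.add_ne_top.2 ⟨hc₁t,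
    ENNReal.mul_ne_top hc₂t ENNReal.ofReal_ne_top⟩, fun B _ _ _ φ hφ a ha F₀ hF₀ => ?_⟩
  obtain ⟨b, l, hl, hasupp, hazero, hasize⟩ := ha
  -- a representative which vanishes off the cube
  set F := (Prod.fst ⁻¹' cube b l).indicator F₀ with hFdef
  have hF : IsRep (⇑a) F := hF₀.indicator_cube hasupp
  rw [op_congr (hF₀.prod_ae_eq hF (ae_eq_refl _))]
  have hsm := hF.stronglyMeasurable
  have hsupp : ∀ v : E n × (E n × ℝ), v.1 ∉ cube b l → F v = 0 := fun v hv =>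
    indicator_of_notMem (show v ∉ Prod.fst ⁻¹' cube b l from hv) _
  have hmass := hF.lintegral_rpow_le hq hl hsupp hasize
  have hn' : (0 : ℝ) < n := by exact_mod_cast hn
  set ρ : ℝ := n * l with hρdef
  have hρ : 0 < ρ := by positivity
  set V := ENNReal.ofReal (l ^ n) with hV
  have V0 : V ≠ 0 := by rw [hV]; simp only [ne_eq, ENNReal.ofReal_eq_zero, not_le]; positivity
  have Vt : V ≠ ∞ := ENNReal.ofReal_ne_top
  have mop : Measurable fun x => ∫⁻ w, ‖op φ F (x, w)‖ₑ ^ q.toReal ∂(coneMeasure n) :=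
    ((hφ.stronglyMeasurable_op hsm).enorm.pow_const _).lintegral_prod_right'
  rw [mixedNorm, div_one, ENNReal.rpow_one,
    ← lintegral_add_compl _ (measurableSet_ball (x := b) (ε := 2 * ρ))]
  refine add_le_add ?_ ?_
  · -- near the cube: Hölder's inequality and the bound on `L^q(L^q)`
    have h1 := lintegral_weight_mul_le (μ := volume.restrict (Metric.ball b (2 * ρ))) hc
      (k := fun _ => 1) (H := fun x => (∫⁻ w, ‖op φ F (x, w)‖ₑ ^ q.toReal
        ∂(coneMeasure n)) ^ (1 / q.toReal)) measurable_const (mop.pow_const _)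
    simp only [one_mul, lintegral_const, Measure.restrict_apply_univ] at h1
    have e1 : ∀ x, ((∫⁻ w, ‖op φ F (x, w)‖ₑ ^ q.toReal ∂(coneMeasure n)) ^
        (1 / q.toReal)) ^ q.toReal = ∫⁻ w, ‖op φ F (x, w)‖ₑ ^ q.toReal ∂(coneMeasure n) := by
      intro x
      rw [← ENNReal.rpow_mul, one_div_mul_cancel hq0.ne', ENNReal.rpow_one]
    simp_rw [e1] at h1
    have h2 := hmain B φ hφ F hsm
    simp only [mixedNorm, div_self hq0.ne', ENNReal.rpow_one] at h2
    have hball : volume (Metric.ball b (2 * ρ)) = ENNReal.ofReal ((2 * (n : ℝ)) ^ n) * ω * V := by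
      rw [volume_ball_eq b (by positivity), hρdef, ← mul_assoc, mul_pow,
        ENNReal.ofReal_mul (by positivity)]
      ring
    calc _ ≤ _ := h1
      _ ≤ volume (Metric.ball b (2 * ρ)) ^ (1 / q'.toReal) *
          (C * (V * V⁻¹ ^ q.toReal) ^ (1 / q.toReal)) := by
          refine mul_le_mul_right ?_ _
          refine (ENNReal.rpow_le_rpow (setLIntegral_le_lintegral _ _) (by positivity)).trans ?_
          exact h2.trans (mul_le_mul_right (ENNReal.rpow_le_rpow hmass (by positivity)) _)
      _ = c₁ * (V ^ (1 / q'.toReal) * V ^ (1 / q.toReal) * V⁻¹) := by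
          rw [hball, ENNReal.mul_rpow_of_nonneg _ V (by positivity : 0 ≤ 1 / q'.toReal),
            ENNReal.mul_rpow_of_nonneg _ _ (by positivity : 0 ≤ 1 / q.toReal),
            ← ENNReal.rpow_mul V⁻¹, mul_one_div_cancel hq0.ne', ENNReal.rpow_one, hc₁]
          ring
      _ = c₁ := by
          rw [← ENNReal.rpow_add _ _ V0 Vt, one_div, one_div, hc.symm.inv_add_inv_eq_one,
            ENNReal.rpow_one, ENNReal.mul_inv_cancel V0 Vt, mul_one]
  · -- away from the cube: cancellation
    have hfar := lintegral_lintegral_rpow_le_one hc hsm hl hsupp hmass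
    have hconv := hF.opConverges hφ ENNReal.one_ne_top hq1 hq
    have hsupp' : ∀ v : E n × (E n × ℝ), ρ < ‖v.1 - b‖ → F v = 0 := fun v hv =>
      hsupp v fun h => absurd (norm_sub_le_of_mem_cube hl.le h) (not_le.2 hv)
    calc _ ≤ ∫⁻ x in (Metric.ball b (2 * ρ))ᶜ,
          c₂ * ENNReal.ofReal (pk n (1 / 2) ρ ‖b - x‖) := by
          refine setLIntegral_mono' measurableSet_ball.compl fun x hx => ?_
          have hx' : 2 * ρ ≤ ‖x - b‖ := by
            rw [← dist_eq_norm]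
            exact not_lt.1 hx
          rw [norm_sub_rev b x]
          refine hφ.lintegral_enorm_op_rpow_le hsm hconv hρ hsupp' hx' (fun w hw => ?_) hc hfar
          exact integral_smul_eq_zero_of_integral_eq_zero (q' := q') hq1 hq
            (hφ.measurable_opKernel.comp (measurable_prodMk_left.comp measurable_prodMk_left))
            (hφ.memLp_opKernel Fact.out hq't x b hw) hsm hF.ae_eq hazero
      _ ≤ ∫⁻ x, c₂ * ENNReal.ofReal (pk n (1 / 2) ρ ‖b - x‖) := setLIntegral_le_lintegral _ _
      _ = _ := by
          rw [lintegral_const_mul' _ _ hc₂t, ← ofReal_integral_eq_lintegral_ofReal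
            (integrable_pk_sub (by norm_num) hρ b)
            (Filter.Eventually.of_forall fun y => pk_nonneg hρ (norm_nonneg _)),
            integral_pk_sub hρ]

/-! ### The operators on `L^p` and on the Hardy space -/

section

variable {𝕜 : Type*} [RCLike 𝕜] {n : ℕ} {B : Type*} [NormedAddCommGroup B] [NormedSpace ℝ B]
  [NormedSpace 𝕜 B] {q : ℝ≥0∞} [Fact (1 ≤ q)]
  {φ : ℝ → E n → ℝ} {K : ℝ}

/-- A relation given by `IsOp` that is total on a vector space of `L^p` functions is a linear
operator. -/
theorem exists_linearMap_isOp {p r : ℝ≥0∞} (hφ : IsKernBounded φ K) {M : Type*} [AddCommGroup M]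
    [Module 𝕜 M] (ι : M →ₗ[𝕜] LpA n p q B) (h : ∀ f : M, ∃ g : LpA n r q B, IsOp φ (ι f) g) :
    ∃ T : M →ₗ[𝕜] LpA n r q B, ∀ f : M, IsOp φ (ι f) (T f) := by
  choose T hT using h
  refine ⟨⟨⟨T, fun f f' => ?_⟩, fun c f => ?_⟩, hT⟩
  · refine Lp.ext ((hT (f + f')).unique (((hT f).add hφ (hT f')).congr ?_ ?_) (ae_eq_refl _))
    · rw [map_add]
      exact Lp.coeFn_add _ _
    · exact Lp.coeFn_add _ _
  · refine Lp.ext ((hT (c • f)).unique (((hT f).smul c).congr ?_ ?_) (ae_eq_refl _))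
    · rw [map_smul]
      exact Lp.coeFn_smul _ _
    · exact Lp.coeFn_smul _ _

/-- The image of an atomic decomposition. -/
theorem IsAtomicDecomposition.exists_isOp [CompleteSpace B] (hφ : IsKernBounded φ K) (hq1 : 1 < q)
    (hq : q ≠ ∞) {c : ℝ} (hatom : ∀ a : LpA n 1 q B, IsAtom a →
      ∃ g : LpA n 1 q B, IsOp φ a g ∧ ‖g‖ ≤ c) {f : LpA n 1 q B} {d : ℕ → 𝕜}
    {a : ℕ → LpA n 1 q B} (h : IsAtomicDecomposition 𝕜 f d a) :
    ∃ g : LpA n 1 q B, IsOp φ f g ∧ ‖g‖ ≤ c * ∑' k, ‖d k‖ := by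
  obtain ⟨ha, hd, hf⟩ := h
  choose g hg hgc using fun k => hatom (a k) (ha k)
  have hle : ∀ k, ‖d k • g k‖ ≤ c * ‖d k‖ := fun k => by
    rw [norm_smul, mul_comm]
    exact mul_le_mul_of_nonneg_right (hgc k) (norm_nonneg _)
  have hs : Summable fun k => d k • g k := (hd.mul_left c).of_norm_bounded hle
  refine ⟨∑' k, d k • g k, ?_, tsum_of_norm_bounded (hd.hasSum.mul_left c) hle⟩
  refine IsOp.of_tendsto hφ hq1 hq (fun N => ?_) hf.tendsto_sum_nat hs.hasSum.tendsto_sum_nat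
  induction N with
  | zero =>
    refine ((hg 0).smul (0 : 𝕜)).congr ?_ ?_
    · simpa only [Finset.range_zero, Finset.sum_empty, zero_smul] using Lp.coeFn_zero _ _ _
    · simpa only [Finset.range_zero, Finset.sum_empty, zero_smul] using Lp.coeFn_zero _ _ _
  | succ N ih =>
    refine (ih.add hφ ((hg N).smul (d N))).congr ?_ ?_
    · rw [Finset.sum_range_succ]
      exact (Lp.coeFn_add _ _).trans ((ae_eq_refl _).add (Lp.coeFn_smul _ _))
    · rw [Finset.sum_range_succ]
      exact (Lp.coeFn_add _ _).trans ((ae_eq_refl _).add (Lp.coeFn_smul _ _))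

theorem norm_le_of_enorm_le {c : ℝ≥0∞} (hc : c ≠ ∞) {X Y : Type*} [NormedAddCommGroup X]
    [NormedAddCommGroup Y] {g : X} {f : Y} (h : ‖g‖ₑ ≤ c * ‖f‖ₑ) : ‖g‖ ≤ c.toReal * ‖f‖ := by
  have := ENNReal.toReal_mono (ENNReal.mul_ne_top hc enorm_ne_top) h
  rwa [ENNReal.toReal_mul, toReal_enorm, toReal_enorm] at this

end

end LusinCone

end

open LusinCone
set_option maxHeartbeats 1000000 in
theorem mainTheorem5 (n : ℕ) (hn : 0 < n) (p q : ℝ≥0∞) [Fact (1 ≤ p)] [Fact (1 ≤ q)]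
    (hp : 1 < p) (hp' : p < ∞) (hq : 1 < q) (hq' : q < ∞) :
    ∃ c : ℝ, 0 < c ∧
      ∀ (𝕜 : Type*) [RCLike 𝕜] (B : Type*) [NormedAddCommGroup B] [NormedSpace ℝ B]
        [NormedSpace 𝕜 B] [CompleteSpace B] (φ : ℝ → E n → ℝ),
        (φ = phiTime n ∨ ∃ i, φ = phiSpace n i) →
        (∀ (h : E n → A n q B) (g : E n → E n × ℝ → B), IsNice h g →
          ∀ (x u : E n) (s : ℝ), 0 < s → PhiConverges φ g x u s) ∧
        ∃ (T : LpA n p q B →L[𝕜] LpA n p q B) (T₁ : hardy 𝕜 n (A n q B) →ₗ[𝕜] LpA n 1 q B),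
          -- `T` extends `Φ` and is bounded on `L^p`
          (∀ (h : E n → A n q B) (g : E n → E n × ℝ → B), IsNice h g →
            ∀ f : LpA n p q B, f =ᵐ[volume] h → IsPhi φ g (T f)) ∧
          ‖T‖ ≤ c ∧
          -- `T₁` extends `Φ` and is bounded from `H¹_a` to `L¹`
          (∀ (h : E n → A n q B) (g : E n → E n × ℝ → B), IsNice h g →
            ∀ f : hardy 𝕜 n (A n q B), (f : LpA n 1 q B) =ᵐ[volume] h → IsPhi φ g (T₁ f)) ∧
          (∀ f : hardy 𝕜 n (A n q B), ‖T₁ f‖ ≤ c * hardyNorm 𝕜 (f : LpA n 1 q B)) ∧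
          -- both are extensions of the same map: they agree on `L^p ∩ H¹_a`
          (∀ (f : LpA n p q B) (f₁ : hardy 𝕜 n (A n q B)),
            f =ᵐ[volume] (f₁ : LpA n 1 q B) → T f =ᵐ[volume] T₁ f₁) := by
  have hpt := hp'.ne
  have hqt := hq'.ne
  obtain ⟨K, hK⟩ := exists_isKernBounded n
  obtain ⟨cp, hcp, hLp⟩ := exists_mixedNorm_op_le hn K (one_lt_toReal hp hpt)
    (one_lt_toReal hq hqt)
  obtain ⟨c₁, hc₁, hL1⟩ := exists_mixedNorm_op_atom_le hn K hq hqt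
  have hcp0 : 0 ≤ cp.toReal := ENNReal.toReal_nonneg
  have hc₁0 : 0 ≤ c₁.toReal := ENNReal.toReal_nonneg
  refine ⟨cp.toReal + c₁.toReal + 1, by positivity,
    fun 𝕜 _ B _ _ _ _ φ hφ' => ⟨fun h g hg x u s hs => ?_, ?_⟩⟩
  · exact hg.phiConverges (hK φ hφ') hq hqt x u hs
  have hφ := hK φ hφ'
  -- the image of a function in `L^p`
  have exLp : ∀ f : LpA n p q B, ∃ g : LpA n p q B, IsOp φ f g ∧ ‖g‖ₑ ≤ cp * ‖f‖ₑ := by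
    intro f
    obtain ⟨F, hF⟩ := IsRep.exists_rep f
    refine hF.exists_isOp hφ hpt hq hqt hpt (ENNReal.mul_ne_top hcp enorm_ne_top) ?_
    rw [hF.enorm_eq hpt hqt]
    exact hLp B φ hφ F hF.stronglyMeasurable
  -- the image of a function in the Hardy space
  have exAtom : ∀ a : LpA n 1 q B, IsAtom a →
      ∃ g : LpA n 1 q B, IsOp φ a g ∧ ‖g‖ ≤ c₁.toReal := by
    intro a ha
    obtain ⟨F, hF⟩ := IsRep.exists_rep a
    obtain ⟨g, hg1, hg2⟩ := hF.exists_isOp hφ ENNReal.one_ne_top hq hqt (r := 1)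
      ENNReal.one_ne_top hc₁ (by rw [ENNReal.toReal_one]; exact hL1 B φ hφ a ha F hF)
    refine ⟨g, hg1, ?_⟩
    have := ENNReal.toReal_mono hc₁ hg2
    rwa [toReal_enorm] at this
  obtain ⟨T₂, hT₂⟩ := exists_linearMap_isOp (𝕜 := 𝕜) (r := p) hφ
    (LinearMap.id : LpA n p q B →ₗ[𝕜] LpA n p q B) fun f => (exLp f).imp fun _ h => h.1
  obtain ⟨T₁, hT₁⟩ := exists_linearMap_isOp (𝕜 := 𝕜) (r := 1) hφ (hardy 𝕜 n (A n q B)).subtype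
    fun f => by
      obtain ⟨d, a, h⟩ := f.2
      exact (h.exists_isOp hφ hq hqt exAtom).imp fun _ h => h.1
  have hbound : ∀ f, ‖T₂ f‖ ≤ cp.toReal * ‖f‖ := by
    intro f
    obtain ⟨g, hg1, hg2⟩ := exLp f
    rw [Lp.ext ((hT₂ f).unique hg1 (ae_eq_refl _))]
    exact norm_le_of_enorm_le hcp hg2
  refine ⟨T₂.mkContinuous cp.toReal hbound, T₁, fun h g hg f hf => ?_, ?_, fun h g hg f hf => ?_,
    fun f => ?_, fun f f₁ hf => ?_⟩
  · exact (hT₂ f).isPhi hφ hq hqt hg hf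
  · exact (LinearMap.mkContinuous_norm_le _ hcp0 _).trans (by linarith)
  · exact (hT₁ f).isPhi hφ hq hqt hg hf
  · have hcpos : 0 < cp.toReal + c₁.toReal + 1 := by positivity
    rw [← div_le_iff₀' hcpos]
    obtain ⟨d₀, a₀, h₀⟩ := f.2
    refine le_csInf ⟨_, d₀, a₀, h₀, rfl⟩ ?_
    rintro _ ⟨d, a, h, rfl⟩
    obtain ⟨g, hg1, hg2⟩ := h.exists_isOp hφ hq hqt exAtom
    rw [div_le_iff₀' hcpos, Lp.ext ((hT₁ f).unique hg1 (ae_eq_refl _))]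
    refine hg2.trans (mul_le_mul_of_nonneg_right (by linarith) ?_)
    exact tsum_nonneg fun _ => norm_nonneg _
  · exact (hT₂ f).unique (hT₁ f₁) hf
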